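/- **Setting.** Let $K\ge 1$ be an integer, $K=kM$ with integers $k,M\ge1$, and let $1\le M_1\le M$. Let $q\ge 1$ be odd and squarefree, let $q_3$ be the product of the primes $p\mid q$ with $p\equiv 3\pmod 4$, and let $\tilde a_1,\tilde a_2$ be reduced residue classes mod $q$. For $1\le i\le M_1k$ let $a_i$ be the smallest positive integer with $a_i\equiv \tilde a_1\pmod q$ and $a_i\equiv 1\pmod 4$; for $M_1k<i\le K$ let $a_i$ be the second smallest positive integer with $a_i\equiv\tilde a_2\pmod q$ and $a_i\equiv1\pmod 4$. Let $\eta>0$, $0<\theta_2<1/18$ and $0<\xi<1/4$ be fixed. For $x$ large put $R=x^{\theta_2/2}$, $D_0=\eta\sqrt{\log x}$ and $W=\prod_{p\le D_0,\ p\equiv 3 (4),\ p\nmid q}p$. Let $\mathcal B$ be the set of integer tuples $\mathbf b=(b_1,\dots,b_K)$ with all $b_i\equiv 3\pmod 4$, $b_1=3$, $3\le b_i\le \frac{\eta}{2q}\sqrt{\log x}$ for $2\le i\le M_1k$, and $\frac{\eta}{2q}\sqrt{\log x}<b_i\le\frac{\eta}{q}\sqrt{\log x}$ for $M_1k<i\le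 K$. Put $\ell_i(n)=qn+a_i+qb_i$ and $\mathcal L=\mathcal L(\mathbf b)=(\ell_1,\dots,\ell_K)$, and call $\mathcal L$ *admissible* if its $K$ forms are pairwise distinct and for every prime $p\equiv3\pmod 4$ there is an $n$ with $p\nmid \ell_1(n)\cdots\ell_K(n)$. For an integer $b\ge1$ put $\ell^{(b)}(n)=qn+b$. Let $g(t)=\frac1{1+t}$ for $0\le t\le1$, $g(t)=0$ for $t>1$, let $F(t_1,\dots,t_K)=\prod_{i=1}^K g(Kt_i)$, and let $L_K(F)=\int_{[0,1]^K}F(t)^2\prod_i \frac{dt_i}{\sqrt{t_i}}$. Let $\mathcal D_K$ be the set of tuples $\mathbf d$ of $K$ positive integers that are prime to $q_3W$, pairwise coprime, and divisible only by primes $\equiv 3\pmod 4$. Put $$\lambda_{\mathbf d}=\Big(\prod_{i=1}^K\mu(d_i)d_i\Big)\sum_{\substack{\mathbf r\in\mathcal D_K\\ d_i\mid r_i\ \forall i}}\frac{\mu(r_1\cdots r_K)^2}{\phi(r_1\cdots r_K)}F\Big(\frac{\log r_1}{\log R},\dots,\frac{\log r_K}{\log R}\Big),\qquad w_n(\mathcal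 L)=\Big(\sum_{\substack{\mathbf d\in\mathcal D_K\\ d_i\mid\ell_i(n)\ \forall i}}\lambda_{\mathbf d}\Big)^2 .$$ Let $S(\xi)$ be the set of integers $m$ such that for every prime $p<x^\xi$ with $p\equiv3\pmod4$ either $p\nmid m$ or $p^2\mid m$. For a residue class $\nu_1$ mod $q_3^2W^2$ put $$S_6^{(b)}(\nu_1)=\sum_{\substack{x<n\le2x\\ n\equiv1\ (4)\\ n\equiv\nu_1\ (q_3^2W^2)}}\mathbf 1_{S(\xi)}(\ell^{(b)}(n))\,w_n(\mathcal L).$$ **Statement.** There is a constant $C_K>0$, depending only on $K$, such that for all $k,M,M_1,q,\tilde a_1,\tilde a_2,\eta,\theta_2,\xi$ as above and all $x$ sufficiently large (in terms of these parameters), $$\sum_{\substack{\mathbf b\in\mathcal B\\ \mathcal L=\mathcal L(\mathbf b)\text{ adm.}}}\ \sum_{\substack{\nu_1\bmod q_3^2W^2\\(\ell(\nu_1),W)=1\ \forall\ell\in\mathcal L}}\ \sum_{\substack{1\le b\le\eta\sqrt{\log x}\\ \ell^{(b)}\notin\mathcal L\\ (\ell^{(b)}(\nu_1),q_3^2W^2)=\square}}S_6^{(b)}(\nu_1)\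 \le\ C_K\,\xi^{-1/2}\theta_2^{K/2-1}L_K(F)\Big(\frac{q_3}{\phi(q_3)}\Big)^K\frac{\eta^K}{q^{K-1}}\,\frac{(\log x)^{K-1/2}}{(\log D_0)^K}\,x .$$ Moreover, for every residue class $r$ mod $q_3^2$, the same triple sum with $\nu_1$ restricted to the $W^2$ classes mod $q_3^2W^2$ that satisfy $\nu_1\equiv r\pmod{q_3^2}$ is at most $$C_K\,\xi^{-1/2}\theta_2^{K/2-1}L_K(F)\Big(\frac{q_3}{\phi(q_3)}\Big)^K\frac{\eta^K}{q_3^2\,q^{K-1}}\,\frac{(\log x)^{K-1/2}}{(\log D_0)^K}\,x .$$ -/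

import Mathlib

namespace TwoSquareSieve

noncomputable section

open scoped Classical

/-- The part of `q` composed of primes congruent to 3 modulo 4 (for squarefree `q`). -/
def q3 (q : ℕ) : ℕ := ∏ p ∈ q.primeFactors.filter (fun p => p % 4 = 3), p

/-- `D₀ = η √(log x)`. -/
def D0 (η x : ℝ) : ℝ := η * Real.sqrt (Real.log x)

/-- The product of the primes `p ≤ D₀` with `p ≡ 3 (mod 4)` and `p ∤ q`. -/
def W (q : ℕ) (η x : ℝ) : ℕ :=
  ∏ p ∈ (Finset.range (⌊D0 η x⌋₊ + 1)).filter
    (fun p => p.Prime ∧ p % 4 = 3 ∧ ¬ p ∣ q), p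

/-- The sieve level `R = x ^ (θ₂ / 2)`. -/
def level (θ₂ x : ℝ) : ℝ := x ^ (θ₂ / 2)

/-- The smallest positive integer that is `≡ a (mod q)` and `≡ 1 (mod 4)`. -/
def leastRep (q : ℕ) (a : ZMod q) : ℕ :=
  sInf {m : ℕ | 0 < m ∧ (m : ZMod q) = a ∧ m % 4 = 1}

/-- The integers `a_1, …, a_K` (indexed from 0). The first `N` of them are the smallest positive
integer in the class of `α₁` that is 1 mod 4; the others are the second smallest such integer in
the class of `α₂`. -/
def offset {K : ℕ} (q N : ℕ) (α₁ α₂ : ZMod q) (i : Fin K) : ℕ :=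
  if (i : ℕ) < N then leastRep q α₁ else leastRep q α₂ + 4 * q

/-- The conditions that define the set `𝓑` of tuples `(b_1, …, b_K)` (indexed from 0, with
`N = M₁ k` entries in the first group). -/
def IsShiftTuple {K : ℕ} (q N : ℕ) (η x : ℝ) (b : Fin K → ℕ) : Prop :=
  ∀ i : Fin K, b i % 4 = 3 ∧
    ((i : ℕ) = 0 → b i = 3) ∧
    ((i : ℕ) ≠ 0 → (i : ℕ) < N →
      3 ≤ b i ∧ (b i : ℝ) ≤ η / (2 * q) * Real.sqrt (Real.log x)) ∧
    (N ≤ (i : ℕ) →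
      η / (2 * q) * Real.sqrt (Real.log x) < (b i : ℝ) ∧
        (b i : ℝ) ≤ η / q * Real.sqrt (Real.log x))

/-- The finite set `𝓑`. The box in which the tuples are looked for loses none of them when `1 ≤ N`,
`η ≥ 0`, since every entry is either 3 or at most `(η / q) √(log x)`. -/
def shiftTuples (K q N : ℕ) (η x : ℝ) : Finset (Fin K → ℕ) :=
  (Fintype.piFinset
    (fun _ : Fin K => Finset.Icc 3 (max 3 ⌊η / q * Real.sqrt (Real.log x)⌋₊))).filter
    (IsShiftTuple q N η x)

/-- The linear forms `ℓ_i(n) = q n + a_i + q b_i` of the tuple `𝓛(b)`. -/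
def form {K : ℕ} (q : ℕ) (a b : Fin K → ℕ) (i : Fin K) (n : ℕ) : ℕ :=
  q * n + a i + q * b i

/-- Admissibility of a `K`-tuple of linear forms with respect to sums of two squares: the `K` forms
are pairwise distinct, and for no prime `p ≡ 3 (mod 4)` is their product always divisible by `p`. -/
def IsAdmissible {K : ℕ} (l : Fin K → ℕ → ℕ) : Prop :=
  Function.Injective l ∧
    ∀ p : ℕ, p.Prime → p % 4 = 3 → ∃ n : ℕ, ∀ i, ¬ p ∣ l i n

/-- The set `𝓓_K` of tuples of positive integers, prime to `Q = q₃ W`, pairwise coprime, with all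
prime factors congruent to 3 modulo 4. -/
def IsSieveTuple {K : ℕ} (Q : ℕ) (d : Fin K → ℕ) : Prop :=
  (∀ i, 0 < d i ∧ Nat.Coprime (d i) Q ∧ ∀ p : ℕ, p.Prime → p ∣ d i → p % 4 = 3) ∧
    ∀ i j, i ≠ j → Nat.Coprime (d i) (d j)

/-- `g(t) = 1 / (1 + t)` for `t ≤ 1`, and `0` otherwise. -/
def gFun (t : ℝ) : ℝ := if t ≤ 1 then 1 / (1 + t) else 0

/-- `F(t_1, …, t_K) = ∏ g(K t_i)`. -/
def FFun {K : ℕ} (t : Fin K → ℝ) : ℝ := ∏ i, gFun (K * t i)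

/-- `L_K(F) = ∫_{[0,1]^K} F(x)² ∏ dx_i / √x_i`. -/
def LK (K : ℕ) : ℝ :=
  ∫ t in Set.Icc (0 : Fin K → ℝ) 1, FFun t ^ 2 * ∏ i, (1 / Real.sqrt (t i))

/-- The sieve coefficients `λ_d`. Only `r` with all `r_i ≤ R` are summed over, since
`F(log r_1 / log R, …)` vanishes when some `r_i > R > 1`. -/
def sieveCoeff {K : ℕ} (Q : ℕ) (R : ℝ) (d : Fin K → ℕ) : ℝ :=
  (∏ i, ((ArithmeticFunction.moebius (d i) : ℤ) : ℝ) * (d i : ℝ)) *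
    ∑ r ∈ (Fintype.piFinset (fun _ : Fin K => Finset.Icc 1 ⌊R⌋₊)).filter
        (fun r => IsSieveTuple Q r ∧ ∀ i, d i ∣ r i),
      ((ArithmeticFunction.moebius (∏ i, r i) : ℤ) : ℝ) ^ 2 / (Nat.totient (∏ i, r i) : ℝ) *
        FFun (fun i => Real.log (r i) / Real.log R)

/-- The sieve weights `w_n(𝓛) = (∑_{d ∈ 𝓓_K, d_i ∣ ℓ_i(n)} λ_d)²`. -/
def sieveWeight {K : ℕ} (Q : ℕ) (R : ℝ) (l : Fin K → ℕ → ℕ) (n : ℕ) : ℝ :=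
  (∑ d ∈ (Fintype.piFinset (fun i : Fin K => (l i n).divisors)).filter (IsSieveTuple Q),
    sieveCoeff Q R d) ^ 2

/-- The set `S(ξ)` of integers that no prime `p < x ^ ξ`, `p ≡ 3 (mod 4)`, divides exactly once. -/
def sievedSet (ξ x : ℝ) : Set ℕ :=
  {m | ∀ p : ℕ, p.Prime → p % 4 = 3 → (p : ℝ) < x ^ ξ → ¬ p ∣ m ∨ p ^ 2 ∣ m}

/-- `S₆^{(c)}(ν)`: the sum of `w_n(𝓛)` over `x < n ≤ 2x` with `n ≡ 1 (mod 4)`,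
`n ≡ ν (mod q₃² W²)` and `q n + c ∈ S(ξ)`. -/
def S6 {K : ℕ} (q : ℕ) (l : Fin K → ℕ → ℕ) (η θ₂ ξ x : ℝ) (c ν : ℕ) : ℝ :=
  ∑ n ∈ (Finset.Ioc ⌊x⌋₊ ⌊2 * x⌋₊).filter
      (fun n => n % 4 = 1 ∧ n ≡ ν [MOD q3 q ^ 2 * W q η x ^ 2]),
    (sievedSet ξ x).indicator (fun _ => (1 : ℝ)) (q * n + c) *
      sieveWeight (q3 q * W q η x) (level θ₂ x) l n

/-- The sum of `S₆^{(c)}(ν)` over the admissible `b ∈ 𝓑`, over the classes `ν` in `T` for which all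
`ℓ(ν)`, `ℓ ∈ 𝓛(b)`, are prime to `W`, and over the shifts `1 ≤ c ≤ η √(log x)` for which `q n + c`
is not one of the forms in `𝓛(b)` and `(q ν + c, q₃² W²)` is a square. -/
def exclusionSum (K q N : ℕ) (α₁ α₂ : ZMod q) (η θ₂ ξ x : ℝ) (T : Finset ℕ) : ℝ :=
  ∑ b ∈ (shiftTuples K q N η x).filter
      (fun b => IsAdmissible (form q (offset q N α₁ α₂) b)),
    ∑ ν ∈ T.filter
        (fun ν => ∀ i, Nat.Coprime (form q (offset q N α₁ α₂) b i ν) (W q η x)),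
      ∑ c ∈ (Finset.Icc 1 ⌊D0 η x⌋₊).filter
          (fun c => (∀ i, (fun n : ℕ => q * n + c) ≠ form q (offset q N α₁ α₂) b i) ∧
            IsSquare (Nat.gcd (q * ν + c) (q3 q ^ 2 * W q η x ^ 2))),
        S6 q (form q (offset q N α₁ α₂) b) η θ₂ ξ x c ν

end

end TwoSquareSieve

/-! ### Partial summation and Mertens' theorem for primes congruent to 3 mod 4 -/

namespace TwoSquareSieve

open Finset ArithmeticFunction

/-! Only the order of magnitude matters: `C` may depend on `K` and `LK K` is a positive number, so
`F` enters through `|F| ≤ 1` and its support alone. The inner sum `S6` is bounded uniformly over all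
triples (tuple, class, shift), and the triples are then counted by sieves.

Uniform bound (`S6_le`). Interchanging the sums over `d` and `r` diagonalises the sieve weight
(`sum_sieveCoeff_eq`): its square root is a combination, with coefficients `F`, of products over
primes of functions equal to -1 if `p ∣ ℓ_i(n)` and to `1 / (p - 1)` otherwise. These have mean 0
and mean square `1 / (p - 1)`. For `p > D₀` no two forms of the tuple are divisible by `p` together,
so distinct local functions are orthogonal up to `O(1 / p²)`. The condition that no `p ≤ z` exactly
divides `ℓ^(b)(n)` is imposed by Selberg's device: multiply by a truncated sum `T(n)` of products of
analogous local functions, which takes a constant value `G` on the sifted `n`, and drop the sifting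
condition in the sum of `(T(n) · …)²`. Expanding this square over primes (`sum_sq_prod_le`) gives a
local factor `1 + K/p + 1/p + O(1/p²)`, the `1/p` being present for `p ≤ z` only, while `G ≫ exp(∑
1/p)` by Rankin's trick (`half_prod_le_sum_truncated`). Division by `G²` leaves
(`sum_formSum_sq_sifted_le`) `x / (q₃² W²) · exp(K ∑_{D₀<p≤R} 1/p - ∑_{D₀<p≤z} 1/p)`, all primes
being 3 mod 4. By Mertens this is of order `(log R / log D₀)^(K/2) (log D₀ / log z)^(1/2)`; with `z`
a power `x^(c ξ θ₂²)` it yields `ξ^(-1/2) θ₂^(K/2-1) (log x / log D₀)^((K-1)/2)`.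

Counting (`exclusionSum_le`). In one class mod `q₃²` there are `≪ W² (q₃/φ(q₃)) (log D₀)^(-1/2)`
classes at which the first form, which does not depend on the tuple because `b_1 = 3`, is prime to
`W`. For each, the other `K - 1` entries lie in sifted intervals of length `D₀/q`, and the gcd
condition puts the shift in a sifted interval of length `D₀`; each of these gains another `(log
D₀)^(-1/2)`. Multiplying everything gives the second bound, and summing it over the `q₃²` classes
gives the first. -/

theorem abs_sum_mul_antitone_le (c a : ℕ → ℝ) (M : ℕ) (B : ℝ)
    (hc : ∀ N, M ≤ N → |∑ n ∈ Ioc M N, c n| ≤ B) (ha : ∀ n, M < n → a (n + 1) ≤ a n)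
    (ha0 : ∀ n, M < n → 0 ≤ a n) (N : ℕ) (hN : M ≤ N) :
    |∑ n ∈ Ioc M N, c n * a n| ≤ B * a (M + 1) := by
  have hB : 0 ≤ B := (abs_nonneg _).trans (hc M le_rfl)
  rcases hN.eq_or_lt with rfl | hN
  · simpa using mul_nonneg hB (ha0 _ (Nat.lt_succ_self _))
  -- Abel summation by induction: with the boundary term subtracted, the increments telescope to `B
  -- (a (M+1) - a N)`.
  have key : ∀ N, M + 1 ≤ N →
      |∑ n ∈ Ioc M N, c n * a n - (∑ n ∈ Ioc M N, c n) * a N| ≤ B * (a (M + 1) - a N) := by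
    intro N hN
    induction N, hN using Nat.le_induction with
    | base => simp
    | succ N hN ih =>
      rw [Finset.sum_Ioc_succ_top (by omega), Finset.sum_Ioc_succ_top (by omega)]
      have h1 : ∑ n ∈ Ioc M N, c n * a n + c (N + 1) * a (N + 1)
          - (∑ n ∈ Ioc M N, c n + c (N + 1)) * a (N + 1)
          = (∑ n ∈ Ioc M N, c n * a n - (∑ n ∈ Ioc M N, c n) * a N)
            + (∑ n ∈ Ioc M N, c n) * (a N - a (N + 1)) := by ring
      rw [h1]
      have h2 : |(∑ n ∈ Ioc M N, c n) * (a N - a (N + 1))| ≤ B * (a N - a (N + 1)) := by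
        rw [abs_mul, abs_of_nonneg (sub_nonneg.2 (ha N (by omega)))]
        exact mul_le_mul_of_nonneg_right (hc N (by omega)) (sub_nonneg.2 (ha N (by omega)))
      calc _ ≤ _ := abs_add_le _ _
        _ ≤ _ := add_le_add ih h2
        _ = _ := by ring
  have h1 := key N hN
  have h2 : |(∑ n ∈ Ioc M N, c n) * a N| ≤ B * a N := by
    rw [abs_mul, abs_of_nonneg (ha0 N hN)]
    exact mul_le_mul_of_nonneg_right (hc N hN.le) (ha0 N hN)
  calc |∑ n ∈ Ioc M N, c n * a n|
      = |(∑ n ∈ Ioc M N, c n * a n - (∑ n ∈ Ioc M N, c n) * a N)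
          + (∑ n ∈ Ioc M N, c n) * a N| := by ring_nf
    _ ≤ _ := abs_add_le _ _
    _ ≤ _ := add_le_add h1 h2
    _ = _ := by ring

/-- The nontrivial character mod 4 with real values. -/
noncomputable def chi (n : ℕ) : ℝ := ((ZMod.χ₄ (n : ZMod 4) : ℤ) : ℝ)

theorem chi_mul (m n : ℕ) : chi (m * n) = chi m * chi n := by
  rw [chi, chi, chi, Nat.cast_mul, map_mul, Int.cast_mul]

theorem chi_eq (n : ℕ) : chi n = if n % 2 = 0 then 0 else if n % 4 = 1 then 1 else -1 := by
  rw [chi, ZMod.χ₄_nat_eq_if_mod_four]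
  split_ifs <;> simp

theorem sum_chi_range (N : ℕ) :
    ∑ n ∈ Ioc 0 N, chi n = if N % 4 = 1 ∨ N % 4 = 2 then 1 else 0 := by
  induction N with
  | zero => simp
  | succ N ih =>
    rw [Finset.sum_Ioc_succ_top (by omega), ih, chi_eq]
    have : N % 4 = 0 ∨ N % 4 = 1 ∨ N % 4 = 2 ∨ N % 4 = 3 := by omega
    rcases this with h | h | h | h <;>
    · have h1 : (N + 1) % 2 = (N % 4 + 1) % 2 := by omega
      have h2 : (N + 1) % 4 = (N % 4 + 1) % 4 := by omega
      rw [h1, h2, h]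
      norm_num

theorem abs_sum_chi_le (M N : ℕ) (h : M ≤ N) : |∑ n ∈ Ioc M N, chi n| ≤ 1 := by
  have h1 : ∑ n ∈ Ioc M N, chi n = ∑ n ∈ Ioc 0 N, chi n - ∑ n ∈ Ioc 0 M, chi n := by
    rw [eq_sub_iff_add_eq, add_comm, Finset.sum_Ioc_consecutive _ (Nat.zero_le _) h]
  rw [h1, sum_chi_range, sum_chi_range]
  split_ifs <;> norm_num

/-- Partial sums of `L(1, χ₄)`. -/
noncomputable def LPartial (N : ℕ) : ℝ := ∑ n ∈ Ioc 0 N, chi n * (1 / (n : ℝ))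

theorem abs_LPartial_sub_le (M N : ℕ) (h : M ≤ N) :
    |LPartial N - LPartial M| ≤ 1 / ((M : ℝ) + 1) := by
  have h1 : LPartial N - LPartial M = ∑ n ∈ Ioc M N, chi n * (1 / (n : ℝ)) := by
    rw [LPartial, LPartial, sub_eq_iff_eq_add, add_comm,
      Finset.sum_Ioc_consecutive _ (Nat.zero_le _) h]
  rw [h1]
  have := abs_sum_mul_antitone_le chi (fun n => 1 / (n : ℝ)) M 1
    (fun N hN => abs_sum_chi_le M N hN) (fun n hn => ?_) (fun n hn => by positivity) N h
  · simpa using this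
  · have : (0 : ℝ) < n := by exact_mod_cast (by omega : 0 < n)
    apply one_div_le_one_div_of_le this
    push_cast; linarith

/-- The tail after the first term 1 is at most 1/2. This is the quantitative form of `L(1, χ₄) ≠ 0`
that permits division by the partial sums. -/
theorem half_le_LPartial (N : ℕ) (h : 1 ≤ N) : 1 / 2 ≤ LPartial N := by
  have h1 := abs_LPartial_sub_le 1 N h
  have h2 : LPartial 1 = 1 := by simp [LPartial, chi_eq]
  rw [h2, abs_le] at h1
  norm_num at h1 ⊢
  linarith [h1.1]

theorem abs_sum_chi_log_le (N : ℕ) :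
    |∑ n ∈ Ioc 0 N, chi n * (Real.log n / n)| ≤ 1 := by
  rcases le_or_gt N 2 with h | h
  · interval_cases N <;> simp [Finset.sum_Ioc_succ_top, chi_eq]
  -- `log n / n` decreases only from `e` on; the terms `n = 1, 2` are split off and vanish, since
  -- `log 1 = 0` and `χ(2) = 0`.
  rw [← Finset.sum_Ioc_consecutive _ (Nat.zero_le 2) h.le]
  have h0 : ∑ n ∈ Ioc 0 2, chi n * (Real.log n / n) = 0 := by
    simp [Finset.sum_Ioc_succ_top, chi_eq]
  rw [h0, zero_add]
  have := abs_sum_mul_antitone_le chi (fun n => Real.log n / n) 2 1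
    (fun N hN => abs_sum_chi_le 2 N hN) (fun n hn => ?_) (fun n hn => by positivity) N h.le
  · refine this.trans ?_
    have h3 : Real.log 3 ≤ 2 := by
      have := Real.log_le_sub_one_of_pos (show (0 : ℝ) < 3 by norm_num); linarith
    norm_num
    linarith
  · apply Real.log_div_self_antitoneOn
    · change Real.exp 1 ≤ _
      have := Real.exp_one_lt_d9
      have h3 : (3 : ℝ) ≤ n := by exact_mod_cast hn
      linarith
    · change Real.exp 1 ≤ _
      have := Real.exp_one_lt_d9
      have h3 : (3 : ℝ) ≤ n := by exact_mod_cast hn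
      push_cast; linarith
    · push_cast; linarith

/-- Insert `log n = ∑_{d ∣ n} Λ(d)` and write `n = d m`. -/
theorem sum_mul_log_eq (g : ℕ → ℝ) (N : ℕ) :
    ∑ n ∈ Ioc 0 N, g n * Real.log n =
      ∑ d ∈ Ioc 0 N, vonMangoldt d * ∑ m ∈ Ioc 0 (N / d), g (d * m) := by
  have h1 : ∀ n ∈ Ioc 0 N, g n * Real.log n =
      ∑ x ∈ (Ioc 0 N ×ˢ Ioc 0 N) with x.1 * x.2 = n, vonMangoldt x.1 * g (x.1 * x.2) := by
    intro n hn
    simp only [mem_Ioc] at hn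
    rw [← vonMangoldt_sum, mul_sum, ← Nat.divisorsAntidiagonal_eq_prod_filter_of_le hn.1.ne' hn.2,
      ← Nat.sum_divisorsAntidiagonal (fun i _ => g n * vonMangoldt i)]
    refine sum_congr rfl fun x hx => ?_
    rw [(Nat.mem_divisorsAntidiagonal.1 hx).1, mul_comm]
  rw [sum_congr rfl h1]
  simp_rw [sum_filter]
  rw [sum_comm]
  rw [sum_product]
  refine sum_congr rfl fun d hd => ?_
  rw [mul_sum]
  simp only [mem_Ioc] at hd
  rw [← sum_filter_add_sum_filter_not (Ioc 0 N) (fun m => d * m ≤ N)]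
  have hz : ∑ m ∈ Ioc 0 N with ¬ d * m ≤ N,
      ∑ n ∈ Ioc 0 N, (if d * m = n then vonMangoldt d * g (d * m) else 0) = 0 := by
    refine sum_eq_zero fun m hm => sum_eq_zero fun n hn => ?_
    simp only [mem_filter, mem_Ioc] at hm hn
    rw [if_neg]; omega
  rw [hz, add_zero]
  have hs : (Ioc 0 N).filter (fun m => d * m ≤ N) = Ioc 0 (N / d) := by
    ext m
    simp only [mem_filter, mem_Ioc, Nat.le_div_iff_mul_le hd.1]
    constructor
    · rintro ⟨⟨h1, _⟩, h2⟩; exact ⟨h1, by rwa [mul_comm]⟩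
    · rintro ⟨h1, h2⟩
      refine ⟨⟨h1, ?_⟩, by rwa [mul_comm]⟩
      exact (Nat.le_mul_of_pos_right m hd.1).trans h2
  rw [hs]
  refine sum_congr rfl fun m hm => ?_
  have hm' : m ∈ (Ioc 0 N).filter (fun m => d * m ≤ N) := hs ▸ hm
  simp only [mem_filter, mem_Ioc] at hm'
  rw [sum_ite_eq, if_pos]
  simp only [mem_Ioc]
  exact ⟨Nat.mul_pos hd.1 hm'.1.1, hm'.2⟩

theorem sum_vonMangoldt_le (N : ℕ) :
    ∑ d ∈ Ioc 0 N, vonMangoldt d ≤ (Real.log 4 + 4) * N := by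
  have := Chebyshev.psi_le_const_mul_self (x := (N : ℝ)) (by positivity)
  simpa [Chebyshev.psi] using this

/-- The bounded sum `∑ χ(n) log n / n` equals `∑ χ(d) Λ(d)/d · L(N/d)`, where `L` denotes the
partial sums of `L(1, χ₄)`. Replacing `L(N/d)` by `L(N)` costs at most `d/N` times `Λ(d)/d`, in
total `ψ(N)/N = O(1)` by Chebyshev; then `L(N) ≥ 1/2` is divided out. -/
theorem abs_sum_chi_vonMangoldt_le (N : ℕ) :
    |∑ d ∈ Ioc 0 N, chi d * vonMangoldt d / d| ≤ 2 * (Real.log 4 + 5) := by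
  rcases Nat.eq_zero_or_pos N with rfl | hN
  · simp; positivity
  have h1 := sum_mul_log_eq (fun n => chi n / n) N
  have h2 : ∀ d ∈ Ioc 0 N, vonMangoldt d * ∑ m ∈ Ioc 0 (N / d), chi (d * m) / ((d * m : ℕ) : ℝ)
      = chi d * vonMangoldt d / d * LPartial (N / d) := by
    intro d hd
    rw [LPartial, mul_sum, mul_sum]
    refine sum_congr rfl fun m hm => ?_
    rw [chi_mul]; push_cast
    simp only [mem_Ioc] at hd hm
    have : (d : ℝ) ≠ 0 := by exact_mod_cast (by omega : d ≠ 0)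
    have : (m : ℝ) ≠ 0 := by exact_mod_cast (by omega : m ≠ 0)
    field_simp
  rw [sum_congr rfl h2] at h1
  have h3 : ∑ n ∈ Ioc 0 N, chi n / n * Real.log n = ∑ n ∈ Ioc 0 N, chi n * (Real.log n / n) :=
    sum_congr rfl fun n _ => by ring
  have h4 := abs_sum_chi_log_le N
  rw [← h3, h1] at h4
  have hchi : ∀ d, |chi d| ≤ 1 := by
    intro d; rw [chi_eq]; split_ifs <;> simp
  have h5 : |∑ d ∈ Ioc 0 N, chi d * vonMangoldt d / d * (LPartial N - LPartial (N / d))|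
      ≤ Real.log 4 + 4 := by
    refine (abs_sum_le_sum_abs _ _).trans ?_
    have hNr : (0 : ℝ) < N := by exact_mod_cast hN
    calc ∑ d ∈ Ioc 0 N, |chi d * vonMangoldt d / d * (LPartial N - LPartial (N / d))|
        ≤ ∑ d ∈ Ioc 0 N, vonMangoldt d / N := by
          refine sum_le_sum fun d hd => ?_
          simp only [mem_Ioc] at hd
          have hd0 : (0 : ℝ) < d := by exact_mod_cast hd.1
          have h6 := abs_LPartial_sub_le (N / d) N (Nat.div_le_self _ _)
          have h7 : 1 / (((N / d : ℕ) : ℝ) + 1) ≤ d / N := by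
            rw [div_le_div_iff₀ (by positivity) hNr, one_mul]
            have : N < d * (N / d + 1) := by
              have := Nat.div_add_mod N d
              have := Nat.mod_lt N hd.1
              rw [Nat.mul_add]; omega
            exact_mod_cast this.le
          rw [abs_mul, abs_div, abs_mul, abs_of_nonneg vonMangoldt_nonneg,
            abs_of_pos hd0]
          calc |chi d| * vonMangoldt d / d * |LPartial N - LPartial (N / d)|
              ≤ 1 * vonMangoldt d / d * (d / N) := by
                have hv : 0 ≤ vonMangoldt d := vonMangoldt_nonneg
                gcongr
                · exact hchi d
                · exact h6.trans h7
            _ = _ := by field_simp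
      _ = (∑ d ∈ Ioc 0 N, vonMangoldt d) / N := by rw [sum_div]
      _ ≤ _ := by
          rw [div_le_iff₀ hNr]; exact sum_vonMangoldt_le N
  have h8 : (∑ d ∈ Ioc 0 N, chi d * vonMangoldt d / d) * LPartial N =
      ∑ d ∈ Ioc 0 N, chi d * vonMangoldt d / d * (LPartial N - LPartial (N / d))
      + ∑ d ∈ Ioc 0 N, chi d * vonMangoldt d / d * LPartial (N / d) := by
    rw [← sum_add_distrib, sum_mul]
    exact sum_congr rfl fun d _ => by ring
  have h9 : |(∑ d ∈ Ioc 0 N, chi d * vonMangoldt d / d) * LPartial N| ≤ Real.log 4 + 5 := by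
    rw [h8]
    refine (abs_add_le _ _).trans ?_
    linarith
  have h10 := half_le_LPartial N hN
  rw [abs_mul, abs_of_nonneg (by linarith : 0 ≤ LPartial N)] at h9
  nlinarith [abs_nonneg (∑ d ∈ Ioc 0 N, chi d * vonMangoldt d / d)]

/-- Compare `log N! = ∑ Λ(d) ⌊N/d⌋` with `N ∑ Λ(d)/d`: the floors lose at most `ψ(N) = O(N)`, and
`log N!` lies between `N log N - N` and `N log N`. -/
theorem abs_sum_vonMangoldt_div_sub_log_le (N : ℕ) (hN : 1 ≤ N) :
    |∑ d ∈ Ioc 0 N, vonMangoldt d / d - Real.log N| ≤ Real.log 4 + 4 := by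
  have hNr : (0 : ℝ) < N := by exact_mod_cast hN
  have h1 := sum_mul_log_eq (fun _ => 1) N
  simp only [one_mul, sum_const, Nat.card_Ioc, Nat.sub_zero, nsmul_eq_mul, mul_one] at h1
  have h2 : ∑ n ∈ Ioc 0 N, Real.log n ≤ N * Real.log N := by
    calc _ ≤ ∑ n ∈ Ioc 0 N, Real.log N := by
          refine sum_le_sum fun n hn => ?_
          simp only [mem_Ioc] at hn
          exact Real.log_le_log (by exact_mod_cast hn.1) (by exact_mod_cast hn.2)
      _ = _ := by simp
  have h3 : N * Real.log N - N ≤ ∑ n ∈ Ioc 0 N, Real.log n := by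
    have h : ∑ n ∈ Ioc 0 N, Real.log n = Real.log (N.factorial) := by
      clear h1 h2 hN hNr
      induction N with
      | zero => simp
      | succ N ih =>
        rw [Finset.sum_Ioc_succ_top (by omega), ih, Nat.factorial_succ]
        push_cast
        rw [Real.log_mul (by positivity) (by positivity), add_comm]
    rw [h]
    -- `N^N / N! ≤ e^N` is the lower bound for `log N!`.
    have h4 := Real.pow_div_factorial_le_exp (N : ℝ) hNr.le N
    have h5 := Real.log_le_log (by positivity) h4
    rw [Real.log_exp, Real.log_div (by positivity) (by positivity), Real.log_pow] at h5
    linarith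
  have h4 : ∑ d ∈ Ioc 0 N, vonMangoldt d * ((N / d : ℕ) : ℝ)
      ≤ N * ∑ d ∈ Ioc 0 N, vonMangoldt d / d := by
    rw [mul_sum]
    refine sum_le_sum fun d hd => ?_
    have := Nat.cast_div_le (α := ℝ) (m := N) (n := d)
    calc vonMangoldt d * ((N / d : ℕ) : ℝ) ≤ vonMangoldt d * (N / d) :=
          mul_le_mul_of_nonneg_left this vonMangoldt_nonneg
      _ = _ := by ring
  have h5 : N * ∑ d ∈ Ioc 0 N, vonMangoldt d / d - ∑ d ∈ Ioc 0 N, vonMangoldt d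
      ≤ ∑ d ∈ Ioc 0 N, vonMangoldt d * ((N / d : ℕ) : ℝ) := by
    rw [mul_sum, ← sum_sub_distrib]
    refine sum_le_sum fun d hd => ?_
    simp only [mem_Ioc] at hd
    have hd0 : (0 : ℝ) < d := by exact_mod_cast hd.1
    have h6 : (N : ℝ) / d - 1 ≤ ((N / d : ℕ) : ℝ) := by
      rw [sub_le_iff_le_add, div_le_iff₀ hd0]
      have : N < (N / d + 1) * d := by
        have := Nat.div_add_mod N d
        have := Nat.mod_lt N hd.1
        rw [Nat.add_mul, mul_comm (N / d)]; omega
      exact_mod_cast this.le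
    calc _ = vonMangoldt d * (N / d - 1) := by ring
      _ ≤ _ := mul_le_mul_of_nonneg_left h6 vonMangoldt_nonneg
  have h6 := sum_vonMangoldt_le N
  rw [abs_le]
  have hl4 : 0 ≤ Real.log 4 := Real.log_nonneg (by norm_num)
  constructor
  · have : N * (Real.log N - 1) ≤ N * ∑ d ∈ Ioc 0 N, vonMangoldt d / d := by
      linarith
    have := le_of_mul_le_mul_left this hNr
    linarith
  · have : N * ∑ d ∈ Ioc 0 N, vonMangoldt d / d ≤ N * (Real.log N + (Real.log 4 + 4)) := by
      linarith
    have := le_of_mul_le_mul_left this hNr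
    linarith

/-- The primes `p ≤ N` with `p ≡ 3 (mod 4)`. -/
def primesThree (N : ℕ) : Finset ℕ := (Ioc 0 N).filter (fun p => p.Prime ∧ p % 4 = 3)

theorem mem_primesThree {N p : ℕ} : p ∈ primesThree N ↔ p ≤ N ∧ p.Prime ∧ p % 4 = 3 := by
  simp only [primesThree, mem_filter, mem_Ioc]
  exact ⟨fun h => ⟨h.1.2, h.2⟩, fun h => ⟨⟨h.2.1.pos, h.1⟩, h.2⟩⟩

/-- The sum of `1 / p` over the primes `p ≤ N` with `p ≡ 3 (mod 4)`. -/
noncomputable def recipSum (N : ℕ) : ℝ := ∑ p ∈ primesThree N, 1 / (p : ℝ)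

theorem exists_sum_vonMangoldt_nonprime_le :
    ∃ C : ℝ, 0 < C ∧ ∀ s : Finset ℕ, ∑ n ∈ s, (if n.Prime then 0 else vonMangoldt n) / (n : ℝ) ≤ C := by
  -- Modulo 1 there is a single residue class, so this is the convergence of the sum over all proper
  -- prime powers.
  have h := vonMangoldt.summable_residueClass_non_primes_div (q := 1) (a := 0)
  have h' : Summable fun n : ℕ => (if n.Prime then 0 else vonMangoldt n) / (n : ℝ) := by
    refine h.congr fun n => ?_
    have : vonMangoldt.residueClass (0 : ZMod 1) n = vonMangoldt n := by
      rw [vonMangoldt.residueClass]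
      exact Set.indicator_of_mem (s := {n : ℕ | (n : ZMod 1) = 0})
        (show (n : ZMod 1) = 0 from Subsingleton.elim _ _) _
    rw [this]
  have hnn : ∀ n : ℕ, 0 ≤ (if n.Prime then 0 else vonMangoldt n) / (n : ℝ) := by
    intro n
    have : 0 ≤ vonMangoldt n := vonMangoldt_nonneg
    split_ifs <;> positivity
  refine ⟨(∑' n : ℕ, (if n.Prime then 0 else vonMangoldt n) / (n : ℝ)) + 1, ?_, fun s => ?_⟩
  · have := (tsum_nonneg hnn : 0 ≤ ∑' n : ℕ, (if n.Prime then 0 else vonMangoldt n) / (n : ℝ)); linarith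
  · have := h'.sum_le_tsum s (fun n _ => hnn n); linarith

theorem sum_log_div_prime_le (N : ℕ) (hN : 1 ≤ N) :
    ∑ p ∈ primesThree N, Real.log p / p ≤ Real.log N + (Real.log 4 + 4) := by
  have h := (abs_le.1 (abs_sum_vonMangoldt_div_sub_log_le N hN)).2
  have h2 : ∑ p ∈ primesThree N, Real.log p / p ≤ ∑ d ∈ Ioc 0 N, vonMangoldt d / d := by
    calc _ = ∑ p ∈ primesThree N, vonMangoldt p / p := by
          refine sum_congr rfl fun p hp => ?_
          rw [vonMangoldt_apply_prime (mem_primesThree.1 hp).2.1]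
      _ ≤ _ := sum_le_sum_of_subset_of_nonneg (filter_subset _ _)
          fun d _ _ => div_nonneg vonMangoldt_nonneg (by positivity)
  linarith

/-- On odd primes `(1 - χ)/2` is the indicator of the class 3 mod 4. The sum of `Λ(d)/d` supplies
the main term `log N`, the twisted sum is bounded, and `p = 2` and proper prime powers contribute
`O(1)`. -/
theorem exists_abs_sum_log_div_sub_le :
    ∃ C : ℝ, 0 < C ∧ ∀ N : ℕ, 1 ≤ N →
      |∑ p ∈ primesThree N, Real.log p / p - 1 / 2 * Real.log N| ≤ C := by
  obtain ⟨C, hC, hCs⟩ := exists_sum_vonMangoldt_nonprime_le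
  refine ⟨3 * (Real.log 4 + 5) + C + 1, by positivity, fun N hN => ?_⟩
  have h1 := abs_sum_chi_vonMangoldt_le N
  have h2 := abs_sum_vonMangoldt_div_sub_log_le N hN
  have hlog2 : Real.log 2 ≤ 1 := by
    have := Real.log_le_sub_one_of_pos (show (0 : ℝ) < 2 by norm_num); linarith
  have hlog2' : 0 ≤ Real.log 2 := Real.log_nonneg (by norm_num)
  have hv : ∀ d, 0 ≤ vonMangoldt d := fun d => vonMangoldt_nonneg
  have key : ∀ d : ℕ, 2 * (if d.Prime ∧ d % 4 = 3 then Real.log d / d else 0) ≤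
      (1 - chi d) * vonMangoldt d / d := by
    intro d
    split_ifs with h
    · rw [vonMangoldt_apply_prime h.1, chi_eq, if_neg (by omega), if_neg (by omega)]
      exact le_of_eq (by ring)
    · have : chi d ≤ 1 := by rw [chi_eq]; split_ifs <;> norm_num
      have h3 := hv d
      rw [mul_zero]
      exact div_nonneg (mul_nonneg (by linarith) h3) (by positivity)
  -- The last term is for `d = 2`, where `χ` vanishes and `log 2 / 2 ≤ 1`.
  have key2 : ∀ d : ℕ, (1 - chi d) * vonMangoldt d / d ≤
      2 * (if d.Prime ∧ d % 4 = 3 then Real.log d / d else 0)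
      + 2 * ((if d.Prime then 0 else vonMangoldt d) / (d : ℝ)) + (if d = 2 then 1 else 0) := by
    intro d
    by_cases hp : d.Prime
    · rw [if_pos hp, zero_div, mul_zero, add_zero, vonMangoldt_apply_prime hp, chi_eq]
      rcases hp.eq_two_or_odd with rfl | ho
      · norm_num; linarith
      · rw [if_neg (by omega), if_neg (show ¬ d = 2 by omega)]
        have : d % 4 = 1 ∨ d % 4 = 3 := by omega
        rcases this with h | h
        · simp [h]
        · simp only [h, hp]; norm_num; exact le_of_eq (by ring)
    · rw [if_neg hp, if_neg (by tauto), if_neg (by rintro rfl; exact hp Nat.prime_two)]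
      have : -1 ≤ chi d := by rw [chi_eq]; split_ifs <;> norm_num
      have h3 := div_nonneg (hv d) (Nat.cast_nonneg (α := ℝ) d)
      calc _ = (1 - chi d) * (vonMangoldt d / d) := by ring
        _ ≤ 2 * (vonMangoldt d / d) := by gcongr; linarith
        _ = _ := by ring
  have e1 : ∑ d ∈ Ioc 0 N, (1 - chi d) * vonMangoldt d / d =
      ∑ d ∈ Ioc 0 N, vonMangoldt d / d - ∑ d ∈ Ioc 0 N, chi d * vonMangoldt d / d := by
    rw [← sum_sub_distrib]; exact sum_congr rfl fun d _ => by ring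
  have e2 : ∑ p ∈ primesThree N, Real.log p / p =
      ∑ d ∈ Ioc 0 N, (if d.Prime ∧ d % 4 = 3 then Real.log d / d else 0) := by
    rw [primesThree, sum_filter]
  have l1 := sum_le_sum fun d (_ : d ∈ Ioc 0 N) => key d
  have l2 := sum_le_sum fun d (_ : d ∈ Ioc 0 N) => key2 d
  rw [← mul_sum, ← e2] at l1
  rw [sum_add_distrib, sum_add_distrib, ← mul_sum, ← mul_sum, ← e2] at l2
  have l3 := hCs (Ioc 0 N)
  have l4 : ∑ d ∈ Ioc 0 N, (if d = 2 then (1 : ℝ) else 0) ≤ 1 := by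
    rw [sum_ite_eq']; split_ifs <;> norm_num
  rw [e1] at l1 l2
  rw [abs_le] at *
  constructor <;> linarith [h1.1, h1.2, h2.1, h2.2]

/-- With `a = log N` and `b = log (N+1)`, the new term `(b - a)/b` and the increment `log (b/a)`
differ by at most `(b - a)²/(ab) ≤ 3/N²`. The right side is what these errors telescope to after
`1/N² ≤ 1/(N-1) - 1/N`. -/
theorem loglog_telescope (N : ℕ) (hN : 2 ≤ N) :
    |∑ n ∈ Ioc 2 N, (Real.log n - Real.log (n - 1)) * (1 / Real.log n)
      - (Real.log (Real.log N) - Real.log (Real.log 2))| ≤ 3 * (1 - 1 / ((N : ℝ) - 1)) := by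
  induction N, hN using Nat.le_induction with
  | base => norm_num
  | succ N hN ih =>
    rw [Finset.sum_Ioc_succ_top (by omega)]
    have hN2 : (2 : ℝ) ≤ N := by exact_mod_cast hN
    have hl2 : (0.69 : ℝ) ≤ Real.log 2 := by have := Real.log_two_gt_d9; linarith
    have ha : Real.log 2 ≤ Real.log N := Real.log_le_log (by norm_num) hN2
    have hb : Real.log N ≤ Real.log (N + 1) := Real.log_le_log (by linarith) (by linarith)
    have ha0 : 0 < Real.log N := by linarith
    have hb0 : 0 < Real.log (N + 1) := by linarith
    have hd : Real.log (N + 1) - Real.log N ≤ 1 / N := by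
      rw [← Real.log_div (by linarith) (by linarith)]
      have := Real.log_le_sub_one_of_pos (show (0 : ℝ) < ((N : ℝ) + 1) / N by positivity)
      have e : ((N : ℝ) + 1) / N - 1 = 1 / N := by field_simp; ring
      linarith
    have hq : Real.log (Real.log (N + 1)) - Real.log (Real.log N)
        = Real.log (Real.log (N + 1) / Real.log N) := by
      rw [Real.log_div hb0.ne' ha0.ne']
    set a := Real.log N
    set b := Real.log (N + 1 : ℝ)
    have h1 : Real.log (b / a) ≤ b / a - 1 := Real.log_le_sub_one_of_pos (by positivity)
    have h2 : 1 - (b / a)⁻¹ ≤ Real.log (b / a) := Real.one_sub_inv_le_log_of_pos (by positivity)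
    have h3 : 1 - (b / a)⁻¹ = (b - a) * (1 / b) := by field_simp
    have h4 : b / a - 1 - (b - a) * (1 / b) ≤ 3 * (1 / ((N : ℝ) - 1) - 1 / N) := by
      have e : b / a - 1 - (b - a) * (1 / b) = (b - a) ^ 2 / (a * b) := by field_simp
      rw [e]
      have hab : (1 / 3 : ℝ) ≤ a * b := by nlinarith
      calc (b - a) ^ 2 / (a * b) ≤ (1 / N) ^ 2 / (1 / 3) := by
            gcongr
        _ = 3 * (1 / ((N : ℝ) * N)) := by field_simp
        _ ≤ _ := by
            have : 1 / ((N : ℝ) - 1) - 1 / N = 1 / (((N : ℝ) - 1) * N) := by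
              have : (N : ℝ) - 1 ≠ 0 := by linarith
              field_simp; ring
            rw [this]
            gcongr
            · nlinarith
            · linarith
    push_cast
    rw [add_sub_cancel_right]
    rw [abs_le] at ih ⊢
    constructor <;> linarith [ih.1, ih.2]

/-- Partial summation with weight `1 / log n`, applied to the coefficients `log p / p` minus half
the increments of `log`, whose partial sums are bounded. The subtracted part sums to `(1/2) log log
N + O(1)` by `loglog_telescope`. -/
theorem exists_abs_recipSum_sub_le_nat :
    ∃ C : ℝ, 0 < C ∧ ∀ N : ℕ, 2 ≤ N → |recipSum N - 1 / 2 * Real.log (Real.log N)| ≤ C := by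
  obtain ⟨C, hC, hA⟩ := exists_abs_sum_log_div_sub_le
  refine ⟨2 * C * (1 / Real.log 3) + 2 + |Real.log (Real.log 2)|, ?_, fun N hN => ?_⟩
  · have : 0 < Real.log 3 := Real.log_pos (by norm_num)
    positivity
  set a : ℕ → ℝ := fun n => if n.Prime ∧ n % 4 = 3 then Real.log n / n else 0
  set c : ℕ → ℝ := fun n => a n - 1 / 2 * (Real.log n - Real.log (n - 1)) with hc
  have hlog : ∀ N : ℕ, 2 ≤ N → ∑ n ∈ Ioc 2 N, (Real.log n - Real.log ((n : ℝ) - 1))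
      = Real.log N - Real.log 2 := by
    intro N hN
    induction N, hN using Nat.le_induction with
    | base => simp
    | succ N hN ih => rw [Finset.sum_Ioc_succ_top (by omega), ih]; push_cast; ring_nf
  have hsumA : ∀ N, 2 ≤ N → ∑ n ∈ Ioc 2 N, a n = ∑ p ∈ primesThree N, Real.log p / p := by
    intro N hN
    rw [primesThree, sum_filter, ← Finset.sum_Ioc_consecutive _ (Nat.zero_le 2) hN]
    simp [Finset.sum_Ioc_succ_top, a]
  have hS : ∑ n ∈ Ioc 2 N, a n * (1 / Real.log n) = recipSum N := by
    rw [recipSum, primesThree, sum_filter, ← Finset.sum_Ioc_consecutive _ (Nat.zero_le 2) hN]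
    have : ∑ x ∈ Ioc 0 2, (if Nat.Prime x ∧ x % 4 = 3 then 1 / (x : ℝ) else 0) = 0 := by
      simp [Finset.sum_Ioc_succ_top]
    rw [this, zero_add]
    refine sum_congr rfl fun n hn => ?_
    simp only [mem_Ioc] at hn
    simp only [a]
    split_ifs with h
    · have : 0 < Real.log n := Real.log_pos (by exact_mod_cast h.1.one_lt)
      field_simp
    · simp
  have hB : ∀ N, 2 ≤ N → |∑ n ∈ Ioc 2 N, c n| ≤ 2 * C := by
    intro N hN
    have h1 := hA N (by omega)
    have h2 := hA 2 (by omega)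
    have e : ∑ p ∈ primesThree 2, Real.log p / p = 0 := by
      rw [← hsumA 2 le_rfl]; simp
    rw [hc, sum_sub_distrib, ← mul_sum, hlog N hN, hsumA N hN]
    rw [e] at h2
    push_cast at h2
    rw [abs_le] at *
    constructor <;> linarith [h1.1, h1.2, h2.1, h2.2]
  have h1 := abs_sum_mul_antitone_le c (fun n => 1 / Real.log n) 2 (2 * C) hB
    (fun n hn => by
      have : (2 : ℝ) < n := by exact_mod_cast hn
      apply one_div_le_one_div_of_le (Real.log_pos (by linarith))
      apply Real.log_le_log (by linarith); push_cast; linarith)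
    (fun n hn => by
      have : (2 : ℝ) < n := by exact_mod_cast hn
      have := Real.log_pos (show (1 : ℝ) < n by linarith)
      positivity) N hN
  have h2 := loglog_telescope N hN
  have h3 : ∑ n ∈ Ioc 2 N, c n * (1 / Real.log n) = recipSum N -
      1 / 2 * ∑ n ∈ Ioc 2 N, (Real.log n - Real.log ((n : ℝ) - 1)) * (1 / Real.log n) := by
    rw [← hS, mul_sum, ← sum_sub_distrib]
    exact sum_congr rfl fun n _ => by rw [hc]; ring
  rw [h3] at h1
  have h4 : 3 * (1 - 1 / ((N : ℝ) - 1)) ≤ 3 := by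
    have : (2 : ℝ) ≤ N := by exact_mod_cast hN
    have : 0 ≤ 1 / ((N : ℝ) - 1) := by apply one_div_nonneg.2; linarith
    linarith
  have h5 := abs_le.1 (le_refl |Real.log (Real.log 2)|)
  have e3 : ((2 + 1 : ℕ) : ℝ) = 3 := by norm_num
  simp only [e3] at h1
  rw [abs_le] at h1 h2 ⊢
  constructor <;> linarith [h1.1, h1.2, h2.1, h2.2, h5.1, h5.2]

/-- Mertens' theorem for the primes congruent to 3 mod 4. -/
theorem exists_abs_recipSum_sub_le :
    ∃ C : ℝ, 0 < C ∧ ∀ z : ℝ, 2 ≤ z → |recipSum ⌊z⌋₊ - 1 / 2 * Real.log (Real.log z)| ≤ C := by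
  obtain ⟨C, hC, h⟩ := exists_abs_recipSum_sub_le_nat
  refine ⟨C + 1, by linarith, fun z hz => ?_⟩
  have hN : 2 ≤ ⌊z⌋₊ := Nat.le_floor (by exact_mod_cast hz)
  have h1 := h _ hN
  have hN' : (2 : ℝ) ≤ (⌊z⌋₊ : ℝ) := by exact_mod_cast hN
  have hle : (⌊z⌋₊ : ℝ) ≤ z := Nat.floor_le (by linarith)
  have hlt : z < ⌊z⌋₊ + 1 := Nat.lt_floor_add_one z
  have l0 : 0 < Real.log ⌊z⌋₊ := Real.log_pos (by linarith)
  have l1 : Real.log ⌊z⌋₊ ≤ Real.log z := Real.log_le_log (by linarith) hle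
  -- `z < ⌊z⌋ + 1 ≤ ⌊z⌋²`, so passing to the integer part changes `log log` by at most `log 2`.
  have l2 : Real.log z ≤ 2 * Real.log ⌊z⌋₊ := by
    rw [← Real.log_rpow (by linarith)]
    apply Real.log_le_log (by linarith)
    norm_num
    nlinarith
  have l3 : Real.log (Real.log ⌊z⌋₊) ≤ Real.log (Real.log z) := Real.log_le_log l0 l1
  have l4 : Real.log (Real.log z) ≤ Real.log 2 + Real.log (Real.log ⌊z⌋₊) := by
    rw [← Real.log_mul (by norm_num) l0.ne']
    exact Real.log_le_log (by linarith) l2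
  have hlog2 : Real.log 2 ≤ 1 := by
    have := Real.log_le_sub_one_of_pos (show (0 : ℝ) < 2 by norm_num); linarith
  rw [abs_le] at h1 ⊢
  constructor <;> linarith [h1.1, h1.2]

end TwoSquareSieve

/-! ### Averages of periodic functions over residues and progressions -/

namespace TwoSquareSieve

open Finset

/-- The mean of `f` over the residues `0, …, m - 1`. -/
noncomputable def avg (m : ℕ) (f : ℕ → ℝ) : ℝ := (∑ n ∈ range m, f n) / m

theorem periodic_mod {f : ℕ → ℝ} {m : ℕ} (hf : Function.Periodic f m) (n : ℕ) :
    f (n % m) = f n := hf.map_mod_nat n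

theorem periodic_of_dvd {f : ℕ → ℝ} {m D : ℕ} (hf : Function.Periodic f m) (h : m ∣ D) :
    Function.Periodic f D := by
  obtain ⟨k, rfl⟩ := h
  rw [mul_comm]
  exact hf.nat_mul k

/-- Chinese remainder theorem: `n ↦ (n mod a, n mod b)` is a bijection onto pairs of residues. This
is the independence of different primes. -/
theorem sum_range_mul_of_coprime {a b : ℕ} (ha : 0 < a) (hb : 0 < b) (hab : a.Coprime b)
    {f g : ℕ → ℝ} (hf : Function.Periodic f a) (hg : Function.Periodic g b) :
    ∑ n ∈ range (a * b), f n * g n = (∑ n ∈ range a, f n) * ∑ n ∈ range b, g n := by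
  rw [sum_mul_sum, ← sum_product']
  refine sum_nbij' (fun n => (n % a, n % b)) (fun x => (Nat.chineseRemainder hab x.1 x.2 : ℕ))
    ?_ ?_ ?_ ?_ ?_
  · intro n hn
    simp only [mem_product, mem_range]
    exact ⟨Nat.mod_lt _ ha, Nat.mod_lt _ hb⟩
  · intro x hx
    simp only [mem_range]
    exact Nat.chineseRemainder_lt_mul hab _ _ ha.ne' hb.ne'
  · intro n hn
    simp only [mem_range] at hn
    have h := Nat.chineseRemainder_modEq_unique hab (a := n % a) (b := n % b) (z := n)
      (Nat.mod_modEq n a).symm (Nat.mod_modEq n b).symm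
    have h2 := Nat.chineseRemainder_lt_mul hab (n % a) (n % b) ha.ne' hb.ne'
    exact (Nat.ModEq.eq_of_lt_of_lt h hn h2).symm
  · rintro ⟨x, y⟩ hx
    simp only [mem_product, mem_range] at hx
    have h := (Nat.chineseRemainder hab x y).2
    refine Prod.ext ?_ ?_
    · exact Eq.trans (b := x % a) h.1 (Nat.mod_eq_of_lt hx.1)
    · exact Eq.trans (b := y % b) h.2 (Nat.mod_eq_of_lt hx.2)
  · intro n hn
    simp only
    rw [periodic_mod hf, periodic_mod hg]

theorem periodic_prod {α : Type*} (s : Finset α) (m : α → ℕ) (f : α → ℕ → ℝ)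
    (hf : ∀ a ∈ s, Function.Periodic (f a) (m a)) :
    Function.Periodic (fun n => ∏ a ∈ s, f a n) (∏ a ∈ s, m a) := by
  intro n
  exact prod_congr rfl fun a ha => periodic_of_dvd (hf a ha) (dvd_prod_of_mem m ha) n

theorem sum_range_prod {α : Type*} (s : Finset α) (m : α → ℕ) (f : α → ℕ → ℝ)
    (hm : ∀ a ∈ s, 0 < m a) (hco : ∀ a ∈ s, ∀ b ∈ s, a ≠ b → (m a).Coprime (m b))
    (hf : ∀ a ∈ s, Function.Periodic (f a) (m a)) :
    ∑ n ∈ range (∏ a ∈ s, m a), ∏ a ∈ s, f a n = ∏ a ∈ s, ∑ n ∈ range (m a), f a n := by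
  classical
  induction s using Finset.induction_on with
  | empty => simp
  | insert a s ha ih =>
    simp only [prod_insert ha]
    rw [sum_range_mul_of_coprime (hm a (mem_insert_self _ _))
      (prod_pos fun b hb => hm b (mem_insert_of_mem hb)) _ (hf a (mem_insert_self _ _))
      (periodic_prod s m f fun b hb => hf b (mem_insert_of_mem hb)),
      ih (fun b hb => hm b (mem_insert_of_mem hb))
        (fun b hb c hc => hco b (mem_insert_of_mem hb) c (mem_insert_of_mem hc))
        (fun b hb => hf b (mem_insert_of_mem hb))]
    refine Nat.Coprime.prod_right fun b hb => hco a (mem_insert_self _ _) b (mem_insert_of_mem hb) ?_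
    rintro rfl; exact ha hb

theorem avg_prod {α : Type*} (s : Finset α) (m : α → ℕ) (f : α → ℕ → ℝ)
    (hm : ∀ a ∈ s, 0 < m a) (hco : ∀ a ∈ s, ∀ b ∈ s, a ≠ b → (m a).Coprime (m b))
    (hf : ∀ a ∈ s, Function.Periodic (f a) (m a)) :
    avg (∏ a ∈ s, m a) (fun n => ∏ a ∈ s, f a n) = ∏ a ∈ s, avg (m a) (f a) := by
  simp only [avg]
  rw [sum_range_prod s m f hm hco hf, prod_div_distrib, Nat.cast_prod]

theorem abs_card_modEq_sub_le (u v r w : ℕ) (hr : 0 < r) (huv : u ≤ v) :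
    |(((Ioc u v).filter (fun n => n ≡ w [MOD r])).card : ℝ) - ((v : ℝ) - u) / r| ≤ 1 := by
  have h := Nat.Ioc_filter_modEq_card u v hr w
  have hr' : (0 : ℚ) < r := by exact_mod_cast hr
  have hmono : ⌊((u : ℚ) - w) / r⌋ ≤ ⌊((v : ℚ) - w) / r⌋ := by
    apply Int.floor_le_floor
    have : (u : ℚ) ≤ v := by exact_mod_cast huv
    gcongr
  rw [max_eq_left (by linarith)] at h
  have h1 := Int.floor_le (((u : ℚ) - w) / r)
  have h2 := Int.lt_floor_add_one (((u : ℚ) - w) / r)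
  have h3 := Int.floor_le (((v : ℚ) - w) / r)
  have h4 := Int.lt_floor_add_one (((v : ℚ) - w) / r)
  have h5 : (((Ioc u v).filter (fun n => n ≡ w [MOD r])).card : ℚ)
      = (⌊((v : ℚ) - w) / r⌋ : ℚ) - ⌊((u : ℚ) - w) / r⌋ := by
    have := congrArg (Int.cast : ℤ → ℚ) h
    push_cast at this
    exact this
  have h6 : |(((Ioc u v).filter (fun n => n ≡ w [MOD r])).card : ℚ) - ((v : ℚ) - u) / r| ≤ 1 := by
    rw [h5]
    have e : ((v : ℚ) - u) / r = ((v : ℚ) - w) / r - ((u : ℚ) - w) / r := by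
      rw [← sub_div]; ring
    rw [e, abs_le]
    constructor <;> linarith
  have h7 := (Rat.cast_le (K := ℝ)).2 h6
  rw [Rat.cast_abs] at h7
  push_cast at h7
  exact h7

/-- Each class mod `D` meets the progression mod `M` in one class mod `D M`, whose count in the
interval is within 1 of its expected value; the `D` classes give total error `D`. -/
theorem abs_sum_periodic_sub_le {D M : ℕ} (hD : 0 < D) (hM : 0 < M) (hDM : D.Coprime M)
    {f : ℕ → ℝ} (hf : Function.Periodic f D) (hf1 : ∀ n, |f n| ≤ 1) (u v ν : ℕ) (huv : u ≤ v) :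
    |∑ n ∈ (Ioc u v).filter (fun n => n ≡ ν [MOD M]), f n - ((v : ℝ) - u) / M * avg D f| ≤ D := by
  have h1 : ∑ n ∈ (Ioc u v).filter (fun n => n ≡ ν [MOD M]), f n =
      ∑ c ∈ range D, f c *
        (((Ioc u v).filter (fun n => n ≡ Nat.chineseRemainder hDM c ν [MOD D * M])).card : ℝ) := by
    rw [← sum_fiberwise_of_maps_to (t := range D) (g := fun n => n % D)
      (fun n _ => mem_range.2 (Nat.mod_lt n hD))]
    refine sum_congr rfl fun c hc => ?_
    have hc' := mem_range.1 hc
    have hset : ((Ioc u v).filter (fun n => n ≡ ν [MOD M])).filter (fun n => n % D = c) =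
        (Ioc u v).filter (fun n => n ≡ Nat.chineseRemainder hDM c ν [MOD D * M]) := by
      ext n
      simp only [mem_filter, and_assoc]
      have hcr := (Nat.chineseRemainder hDM c ν).2
      constructor
      · rintro ⟨h1, h2, h3⟩
        refine ⟨h1, Nat.chineseRemainder_modEq_unique hDM ?_ h2⟩
        exact (h3.trans (Nat.mod_eq_of_lt hc').symm : n % D = c % D)
      · rintro ⟨h1, h2⟩
        refine ⟨h1, (h2.of_mul_left D).trans hcr.2, ?_⟩
        have : n ≡ c [MOD D] := (h2.of_mul_right M).trans hcr.1
        exact Eq.trans (b := c % D) this (Nat.mod_eq_of_lt hc')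
    rw [hset, mul_comm (f c), ← nsmul_eq_mul, ← sum_const]
    refine sum_congr rfl fun n hn => ?_
    rw [← hset, mem_filter] at hn
    rw [← hn.2, periodic_mod hf]
  have h2 : ((v : ℝ) - u) / M * avg D f = ∑ c ∈ range D, f c * (((v : ℝ) - u) / (D * M : ℕ)) := by
    rw [← sum_mul, avg]; push_cast; field_simp
  rw [h1, h2, ← sum_sub_distrib]
  calc _ ≤ ∑ c ∈ range D, |f c * _ - f c * (((v : ℝ) - u) / (D * M : ℕ))| := abs_sum_le_sum_abs _ _
    _ ≤ ∑ c ∈ range D, (1 : ℝ) := by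
        refine sum_le_sum fun c _ => ?_
        rw [← mul_sub, abs_mul]
        exact mul_le_one₀ (hf1 c) (abs_nonneg _)
          (abs_card_modEq_sub_le u v _ _ (Nat.mul_pos hD hM) huv)
    _ = D := by simp

/-! ### Mean squares of combinations of products of periodic functions -/

theorem sum_one_div_sq_le {α : Type*} [Fintype α] (w : α → ℕ) (hw : ∀ a, 2 ≤ w a)
    (hinj : Function.Injective w) : ∑ a, 1 / (w a : ℝ) ^ 2 ≤ 1 := by
  classical
  have h1 : ∀ N : ℕ, 1 ≤ N → ∑ n ∈ Ioc 1 N, 1 / (n : ℝ) ^ 2 ≤ 1 - 1 / (N : ℝ) := by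
    intro N hN
    induction N, hN using Nat.le_induction with
    | base => simp
    | succ N hN ih =>
      rw [Finset.sum_Ioc_succ_top (by omega)]
      have hN' : (0 : ℝ) < N := by exact_mod_cast hN
      have : 1 / ((N + 1 : ℕ) : ℝ) ^ 2 ≤ 1 / N - 1 / ((N + 1 : ℕ) : ℝ) := by
        push_cast
        rw [div_sub_div _ _ hN'.ne' (by positivity), div_le_div_iff₀ (by positivity) (by positivity)]
        nlinarith
      linarith
  have h2 : ∑ a, 1 / (w a : ℝ) ^ 2 = ∑ n ∈ univ.image w, 1 / (n : ℝ) ^ 2 := by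
    rw [sum_image (fun a _ b _ h => hinj h)]
  set N := (univ.image w).sup id + 1
  have h3 : univ.image w ⊆ Ioc 1 N := by
    intro n hn
    have h4 : n ≤ (univ.image w).sup id := le_sup (f := id) hn
    simp only [mem_image, mem_univ, true_and] at hn
    obtain ⟨a, rfl⟩ := hn
    simp only [mem_Ioc]
    exact ⟨hw a, by omega⟩
  rw [h2]
  calc _ ≤ ∑ n ∈ Ioc 1 N, 1 / (n : ℝ) ^ 2 :=
        sum_le_sum_of_subset_of_nonneg h3 fun _ _ _ => by positivity
    _ ≤ _ := h1 N (by omega)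
    _ ≤ 1 := by
        have : (0 : ℝ) ≤ 1 / (N : ℝ) := by positivity
        linarith

theorem sum_sum_prod_eq {α ι : Type*} [Fintype α] [DecidableEq α] [Fintype ι]
    (g : α → ι → ι → ℝ) :
    ∑ τ : α → ι, ∑ τ' : α → ι, ∏ a, g a (τ a) (τ' a) = ∏ a, ∑ i, ∑ j, g a i j := by
  have h : ∀ a, ∑ i, ∑ j, g a i j = ∑ x : ι × ι, g a x.1 x.2 := fun a => by
    rw [Fintype.sum_prod_type]
  simp_rw [h]
  rw [Fintype.prod_sum, ← Fintype.sum_prod_type']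
  exact (Equiv.sum_comp (Equiv.arrowProdEquivProdArrow α (fun _ => ι) (fun _ => ι))
    (fun x : (α → ι) × (α → ι) => ∏ a, g a (x.1 a) (x.2 a))).symm

/-- Rankin's trick with exponent 2: each counted `τ` has weight `(Y / ∏ w)² ≥ 1`, and the sum of all
`∏ w⁻²` factors into `∏ (1 + |ι| / w²)`, at most `exp |ι|`. -/
theorem card_support_le {α ι : Type*} [Fintype α] [DecidableEq α] [Fintype ι] [DecidableEq ι]
    (i₀ : ι) (w : α → ℕ) (hw : ∀ a, 2 ≤ w a) (hinj : Function.Injective w) (Y : ℝ)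
    (s : Finset (α → ι)) (hs : ∀ τ ∈ s, ∏ a, (if τ a = i₀ then 1 else (w a : ℝ)) ≤ Y) :
    (s.card : ℝ) ≤ Real.exp (Fintype.card ι) * Y ^ 2 := by
  have hpos : ∀ τ : α → ι, 0 < ∏ a, (if τ a = i₀ then 1 else (w a : ℝ)) := by
    intro τ
    refine prod_pos fun a _ => ?_
    have := hw a
    split_ifs
    · exact one_pos
    · exact_mod_cast (by omega : 0 < w a)
  have h1 : (s.card : ℝ) ≤ ∑ τ ∈ s, Y ^ 2 * ∏ a, (if τ a = i₀ then 1 else 1 / (w a : ℝ) ^ 2) := by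
    rw [card_eq_sum_ones, Nat.cast_sum]
    refine sum_le_sum fun τ hτ => ?_
    have e : ∏ a, (if τ a = i₀ then (1 : ℝ) else 1 / (w a : ℝ) ^ 2) =
        1 / (∏ a, (if τ a = i₀ then 1 else (w a : ℝ))) ^ 2 := by
      rw [← prod_pow, one_div, ← prod_inv_distrib]
      refine prod_congr rfl fun a _ => ?_
      split_ifs <;> simp
    rw [e, mul_one_div, Nat.cast_one, le_div_iff₀ (pow_pos (hpos τ) 2), one_mul]
    exact pow_le_pow_left₀ (hpos τ).le (hs τ hτ) 2
  have h2 : ∑ τ : α → ι, ∏ a, (if τ a = i₀ then (1 : ℝ) else 1 / (w a : ℝ) ^ 2) ≤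
      Real.exp (Fintype.card ι) := by
    rw [← Fintype.prod_sum (fun (a : α) (i : ι) => if i = i₀ then (1 : ℝ) else 1 / (w a : ℝ) ^ 2)]
    have h3 : ∀ a, ∑ i : ι, (if i = i₀ then (1 : ℝ) else 1 / (w a : ℝ) ^ 2) ≤
        Real.exp (Fintype.card ι * (1 / (w a : ℝ) ^ 2)) := by
      intro a
      have : ∑ i : ι, (if i = i₀ then (1 : ℝ) else 1 / (w a : ℝ) ^ 2) ≤
          ∑ i : ι, ((if i = i₀ then (1 : ℝ) else 0) + 1 / (w a : ℝ) ^ 2) := by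
        refine sum_le_sum fun i _ => ?_
        split_ifs <;> simp
      refine this.trans ?_
      rw [sum_add_distrib, sum_ite_eq' univ i₀, if_pos (mem_univ _), sum_const, nsmul_eq_mul,
        card_univ, add_comm]
      exact Real.add_one_le_exp _
    calc _ ≤ ∏ a, Real.exp (Fintype.card ι * (1 / (w a : ℝ) ^ 2)) :=
          prod_le_prod (fun a _ => sum_nonneg fun i _ => by split_ifs <;> positivity)
            fun a _ => h3 a
      _ = Real.exp (Fintype.card ι * ∑ a, (1 / (w a : ℝ) ^ 2)) := by
          rw [← Real.exp_sum, mul_sum]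
      _ ≤ _ := by
          apply Real.exp_le_exp.2
          exact mul_le_of_le_one_right (by positivity) (sum_one_div_sq_le w hw hinj)
  rw [← mul_sum] at h1
  refine h1.trans ?_
  rw [mul_comm]
  refine mul_le_mul_of_nonneg_right (le_trans ?_ h2) (by positivity)
  exact sum_le_sum_of_subset_of_nonneg (subset_univ _)
    fun τ _ _ => prod_nonneg fun a _ => by split_ifs <;> positivity

/-- Mean square over an arithmetic progression of a linear combination of products of periodic
functions. -/
theorem sum_sq_prod_le {α ι : Type*} [Fintype α] [DecidableEq α] [Fintype ι] [DecidableEq ι]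
    (i₀ : ι) (w : α → ℕ) (hw : ∀ a, 2 ≤ w a) (hinj : Function.Injective w)
    (hco : ∀ a b, a ≠ b → (w a).Coprime (w b)) (M : ℕ) (hM : 0 < M)
    (hcM : ∀ a, (w a).Coprime M) (f : α → ι → ℕ → ℝ)
    (hper : ∀ a i, Function.Periodic (f a i) (w a ^ 2)) (hf1 : ∀ a i n, |f a i n| ≤ 1)
    (hf0 : ∀ a n, f a i₀ n = 1) (c : (α → ι) → ℝ) (hc : ∀ τ, |c τ| ≤ 1) (Y : ℝ)
    (hY : ∀ τ, c τ ≠ 0 → ∏ a, (if τ a = i₀ then 1 else (w a : ℝ)) ≤ Y)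
    (u v ν : ℕ) (huv : u ≤ v) :
    ∑ n ∈ (Ioc u v).filter (fun n => n ≡ ν [MOD M]), (∑ τ, c τ * ∏ a, f a (τ a) n) ^ 2 ≤
      ((v : ℝ) - u) / M * ∏ a, ∑ i, ∑ j, |avg (w a ^ 2) (fun n => f a i n * f a j n)| +
        Real.exp (Fintype.card ι) ^ 2 * Y ^ 8 := by
  have hX : 0 ≤ ((v : ℝ) - u) / M := by
    have : (u : ℝ) ≤ v := by exact_mod_cast huv
    exact div_nonneg (by linarith) (by positivity)
  have hw0 : ∀ a, 0 < w a := fun a => by have := hw a; omega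
  have hpos : ∀ τ : α → ι, 0 < ∏ a, (if τ a = i₀ then 1 else (w a : ℝ)) := by
    intro τ
    refine prod_pos fun a _ => ?_
    split_ifs
    · exact one_pos
    · exact_mod_cast hw0 a
  -- Only the coordinates in `S`, where `τ` or `τ'` is nontrivial, carry a nonconstant factor. The
  -- period of the product is therefore `∏_S w² ≤ Y⁴`, which is the error for one pair.
  have main : ∀ τ τ', c τ ≠ 0 → c τ' ≠ 0 →
      |∑ n ∈ (Ioc u v).filter (fun n => n ≡ ν [MOD M]), ∏ a, (f a (τ a) n * f a (τ' a) n)| ≤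
        ((v : ℝ) - u) / M * ∏ a, |avg (w a ^ 2) (fun n => f a (τ a) n * f a (τ' a) n)| + Y ^ 4 := by
    intro τ τ' h h'
    set S : Finset α := univ.filter (fun a => ¬ (τ a = i₀ ∧ τ' a = i₀)) with hS
    have hout : ∀ a, a ∉ S → τ a = i₀ ∧ τ' a = i₀ := by
      intro a ha
      simpa [hS] using ha
    have e1 : ∀ n, ∏ a, (f a (τ a) n * f a (τ' a) n) = ∏ a ∈ S, (f a (τ a) n * f a (τ' a) n) := by
      intro n
      symm
      apply prod_subset (subset_univ _)
      intro a _ ha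
      rw [(hout a ha).1, (hout a ha).2, hf0, one_mul]
    have e2 : ∏ a, |avg (w a ^ 2) (fun n => f a (τ a) n * f a (τ' a) n)| =
        ∏ a ∈ S, |avg (w a ^ 2) (fun n => f a (τ a) n * f a (τ' a) n)| := by
      symm
      apply prod_subset (subset_univ _)
      intro a _ ha
      have : (fun n => f a (τ a) n * f a (τ' a) n) = fun _ => 1 := by
        funext n
        rw [(hout a ha).1, (hout a ha).2, hf0, one_mul]
      rw [this]
      have : ((w a : ℝ) ^ 2) ≠ 0 := by have := hw0 a; positivity
      simp [avg, this]
    have hper' : ∀ a ∈ S, Function.Periodic (fun n => f a (τ a) n * f a (τ' a) n) (w a ^ 2) :=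
      fun a _ => (hper a _).mul (hper a _)
    have hsq : ∀ a ∈ S, 0 < w a ^ 2 := fun a _ => pow_pos (hw0 a) 2
    have hD := abs_sum_periodic_sub_le (prod_pos hsq) hM
      (Nat.Coprime.prod_left fun a _ => (hcM a).pow_left 2)
      (periodic_prod S (fun a => w a ^ 2) _ hper')
      (fun n => by
        rw [abs_prod]
        refine prod_le_one (fun _ _ => abs_nonneg _) fun a _ => ?_
        rw [abs_mul]
        exact mul_le_one₀ (hf1 a _ n) (abs_nonneg _) (hf1 a _ n)) u v ν huv
    rw [avg_prod S (fun a => w a ^ 2) _ hsq (fun a _ b _ hab => (hco a b hab).pow 2 2) hper'] at hD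
    have hDY : ((∏ a ∈ S, w a ^ 2 : ℕ) : ℝ) ≤ Y ^ 4 := by
      have h1 : ((∏ a ∈ S, w a : ℕ) : ℝ) ≤ (∏ a, (if τ a = i₀ then 1 else (w a : ℝ))) *
          ∏ a, (if τ' a = i₀ then 1 else (w a : ℝ)) := by
        rw [← prod_mul_distrib, hS, prod_filter]
        push_cast
        refine prod_le_prod (fun a _ => by split_ifs <;> positivity) fun a _ => ?_
        have hwa : (1 : ℝ) ≤ w a := by exact_mod_cast hw0 a
        by_cases h1 : τ a = i₀ <;> by_cases h2 : τ' a = i₀ <;> simp [h1, h2]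
        nlinarith
      have h2 : ((∏ a ∈ S, w a : ℕ) : ℝ) ≤ Y * Y :=
        h1.trans (mul_le_mul (hY τ h) (hY τ' h') (hpos τ').le ((hpos τ).le.trans (hY τ h)))
      calc ((∏ a ∈ S, w a ^ 2 : ℕ) : ℝ) = ((∏ a ∈ S, w a : ℕ) : ℝ) ^ 2 := by
            rw [prod_pow]; push_cast; ring
        _ ≤ (Y * Y) ^ 2 := pow_le_pow_left₀ (by positivity) h2 2
        _ = _ := by ring
    simp_rw [e1]
    rw [e2]
    have h3 : |((v : ℝ) - u) / M * ∏ a ∈ S, avg (w a ^ 2) (fun n => f a (τ a) n * f a (τ' a) n)|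
        = ((v : ℝ) - u) / M * ∏ a ∈ S, |avg (w a ^ 2) (fun n => f a (τ a) n * f a (τ' a) n)| := by
      rw [abs_mul, abs_of_nonneg hX, abs_prod]
    have h4 := abs_sub_abs_le_abs_sub
      (∑ n ∈ (Ioc u v).filter (fun n => n ≡ ν [MOD M]), ∏ a ∈ S, (f a (τ a) n * f a (τ' a) n))
      (((v : ℝ) - u) / M * ∏ a ∈ S, avg (w a ^ 2) (fun n => f a (τ a) n * f a (τ' a) n))
    linarith
  have expand : ∑ n ∈ (Ioc u v).filter (fun n => n ≡ ν [MOD M]), (∑ τ, c τ * ∏ a, f a (τ a) n) ^ 2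
      = ∑ τ, ∑ τ', c τ * c τ' *
        ∑ n ∈ (Ioc u v).filter (fun n => n ≡ ν [MOD M]), ∏ a, (f a (τ a) n * f a (τ' a) n) := by
    simp_rw [sq, sum_mul_sum, mul_sum]
    rw [sum_comm]
    refine sum_congr rfl fun τ _ => ?_
    rw [sum_comm]
    refine sum_congr rfl fun τ' _ => sum_congr rfl fun n _ => ?_
    rw [prod_mul_distrib]; ring
  rw [expand]
  classical
  set Z : Finset (α → ι) := univ.filter (fun τ => c τ ≠ 0) with hZ
  have hcard := card_support_le i₀ w hw hinj Y Z (fun τ hτ => hY τ (by simpa [hZ] using hτ))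
  -- Once the coefficients are bounded by 1, the main term is a nonnegative product over
  -- coordinates. It is kept even for pairs with zero coefficient, so that the sum over all pairs
  -- factors; the error is charged only to pairs in the support `Z`.
  have bound : ∀ τ τ', c τ * c τ' *
        ∑ n ∈ (Ioc u v).filter (fun n => n ≡ ν [MOD M]), ∏ a, (f a (τ a) n * f a (τ' a) n) ≤
      ((v : ℝ) - u) / M * ∏ a, |avg (w a ^ 2) (fun n => f a (τ a) n * f a (τ' a) n)| +
        (if τ ∈ Z then 1 else 0) * (if τ' ∈ Z then 1 else 0) * Y ^ 4 := by
    intro τ τ'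
    by_cases h : c τ = 0
    · rw [h]; simp only [zero_mul]
      have : 0 ≤ ∏ a, |avg (w a ^ 2) (fun n => f a (τ a) n * f a (τ' a) n)| :=
        prod_nonneg fun _ _ => abs_nonneg _
      have : (0 : ℝ) ≤ (if τ ∈ Z then 1 else 0) * (if τ' ∈ Z then 1 else 0) * Y ^ 4 := by
        split_ifs <;> positivity
      positivity
    by_cases h' : c τ' = 0
    · rw [h']; simp only [mul_zero, zero_mul]
      have : 0 ≤ ∏ a, |avg (w a ^ 2) (fun n => f a (τ a) n * f a (τ' a) n)| :=
        prod_nonneg fun _ _ => abs_nonneg _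
      have : (0 : ℝ) ≤ (if τ ∈ Z then 1 else 0) * (if τ' ∈ Z then 1 else 0) * Y ^ 4 := by
        split_ifs <;> positivity
      positivity
    have m := main τ τ' h h'
    rw [if_pos (by simpa [hZ] using h), if_pos (by simpa [hZ] using h'), one_mul, one_mul]
    refine le_trans ?_ m
    refine (le_abs_self _).trans ?_
    rw [abs_mul]
    refine mul_le_of_le_one_left (abs_nonneg _) ?_
    rw [abs_mul]
    exact mul_le_one₀ (hc τ) (abs_nonneg _) (hc τ')
  refine (sum_le_sum fun τ _ => sum_le_sum fun τ' _ => bound τ τ').trans ?_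
  simp_rw [sum_add_distrib, ← mul_sum, ← sum_mul, ← mul_sum, ← sum_mul]
  rw [sum_sum_prod_eq (fun a i j => |avg (w a ^ 2) (fun n => f a i n * f a j n)|)]
  have hcs : ∑ τ : α → ι, (if τ ∈ Z then (1 : ℝ) else 0) = Z.card := by simp
  rw [hcs]
  refine add_le_add_right ?_ _
  calc (Z.card : ℝ) * Z.card * Y ^ 4 ≤
      (Real.exp (Fintype.card ι) * Y ^ 2) * (Real.exp (Fintype.card ι) * Y ^ 2) * Y ^ 4 := by
        gcongr
    _ = _ := by ring

/-- The density ratio `g / (1 - g)` of the event `p ∥ m`, whose density is `g = (p - 1) / p²`. -/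
noncomputable def exactRatio (p : ℕ) : ℝ := ((p : ℝ) - 1) / ((p : ℝ) ^ 2 - p + 1)

/-- The normalised local function of the event `p ∥ m`. -/
noncomputable def exactLocal (p m : ℕ) : ℝ := if p ∣ m ∧ ¬ p ^ 2 ∣ m then -1 else exactRatio p

/-- The normalised local function of the event `p ∣ m`. -/
noncomputable def dvdLocal (p m : ℕ) : ℝ := if p ∣ m then -1 else 1 / ((p : ℝ) - 1)

/-! ### Means, mean squares and correlations of the local functions -/

theorem avg_le_avg {m : ℕ} {f g : ℕ → ℝ} (h : ∀ n, f n ≤ g n) : avg m f ≤ avg m g := by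
  unfold avg
  gcongr with n _
  exact h n

theorem abs_avg_le {m : ℕ} {f g : ℕ → ℝ} (h : ∀ n, |f n| ≤ g n) : |avg m f| ≤ avg m g := by
  unfold avg
  rw [abs_div, Nat.abs_cast]
  gcongr
  exact (abs_sum_le_sum_abs _ _).trans (sum_le_sum fun n _ => h n)

theorem avg_add (m : ℕ) (f g : ℕ → ℝ) : avg m (fun n => f n + g n) = avg m f + avg m g := by
  simp only [avg, sum_add_distrib, add_div]

theorem avg_mul_const (m : ℕ) (f : ℕ → ℝ) (c : ℝ) : avg m (fun n => f n * c) = avg m f * c := by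
  simp only [avg, ← sum_mul]; ring

theorem avg_const {m : ℕ} (hm : 0 < m) (c : ℝ) : avg m (fun _ => c) = c := by
  have : (m : ℝ) ≠ 0 := by positivity
  simp only [avg, sum_const, card_range, nsmul_eq_mul]
  field_simp

theorem avg_comp_affine {D A : ℕ} (hD : 0 < D) (hA : A.Coprime D) (B : ℕ) {f : ℕ → ℝ}
    (hf : Function.Periodic f D) : avg D (fun n => f (A * n + B)) = avg D f := by
  unfold avg
  congr 1
  have hinj : Set.InjOn (fun n => (A * n + B) % D) (range D : Set ℕ) := by
    intro a ha b hb hab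
    simp only [coe_range, Set.mem_Iio] at ha hb
    have h1 : A * a + B ≡ A * b + B [MOD D] := hab
    have h2 : A * a ≡ A * b [MOD D] := Nat.ModEq.add_right_cancel' B h1
    have h3 : a ≡ b [MOD D] := Nat.ModEq.cancel_left_of_coprime (hA.symm) h2
    exact Nat.ModEq.eq_of_lt_of_lt h3 ha hb
  have hmaps : Set.MapsTo (fun n => (A * n + B) % D) (range D : Set ℕ) (range D : Set ℕ) := by
    intro a _
    simp only [coe_range, Set.mem_Iio]
    exact Nat.mod_lt _ hD
  refine sum_nbij (fun n => (A * n + B) % D) hmaps hinj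
    (surjOn_of_injOn_of_card_le _ hmaps hinj le_rfl) fun n _ => ?_
  rw [periodic_mod hf]

theorem avg_dvd {p : ℕ} (hp : 0 < p) :
    avg (p ^ 2) (fun n => if p ∣ n then (1 : ℝ) else 0) = 1 / p := by
  have hs : (range (p ^ 2)).filter (fun n => p ∣ n) = (range p).image (fun k => p * k) := by
    ext n
    simp only [mem_filter, mem_range, mem_image]
    constructor
    · rintro ⟨h, k, rfl⟩
      exact ⟨k, by nlinarith, rfl⟩
    · rintro ⟨k, hk, rfl⟩
      exact ⟨by nlinarith, dvd_mul_right _ _⟩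
  have : (p : ℝ) ≠ 0 := by positivity
  rw [avg, ← sum_filter, hs, sum_image (fun a _ b _ h => Nat.eq_of_mul_eq_mul_left hp h)]
  simp
  field_simp

theorem avg_sq_dvd {p : ℕ} (hp : 0 < p) :
    avg (p ^ 2) (fun n => if p ^ 2 ∣ n then (1 : ℝ) else 0) = 1 / (p : ℝ) ^ 2 := by
  have hs : (range (p ^ 2)).filter (fun n => p ^ 2 ∣ n) = {0} := by
    ext n
    simp only [mem_filter, mem_range, mem_singleton]
    constructor
    · rintro ⟨h, h2⟩
      exact Nat.eq_zero_of_dvd_of_lt h2 h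
    · rintro rfl
      exact ⟨by positivity, dvd_zero _⟩
  rw [avg, ← sum_filter, hs]
  simp

theorem periodic_dvdLocal (p : ℕ) : Function.Periodic (dvdLocal p) (p ^ 2) := by
  intro n
  have : p ∣ n + p ^ 2 ↔ p ∣ n := Nat.dvd_add_left (dvd_pow_self p two_ne_zero)
  simp only [dvdLocal, this]

theorem periodic_exactLocal (p : ℕ) : Function.Periodic (exactLocal p) (p ^ 2) := by
  intro n
  have h1 : p ∣ n + p ^ 2 ↔ p ∣ n := Nat.dvd_add_left (dvd_pow_self p two_ne_zero)
  have h2 : p ^ 2 ∣ n + p ^ 2 ↔ p ^ 2 ∣ n := Nat.dvd_add_left dvd_rfl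
  simp only [exactLocal, h1, h2]

theorem periodic_affine {f : ℕ → ℝ} {D : ℕ} (hf : Function.Periodic f D) (A B : ℕ) :
    Function.Periodic (fun n => f (A * n + B)) D := by
  intro n
  have : A * (n + D) + B = A * n + B + A * D := by ring
  simp only [this]
  exact hf.nat_mul A _

theorem one_div_sub_one_le_one {p : ℕ} (hp : 2 ≤ p) : 1 / ((p : ℝ) - 1) ≤ 1 := by
  have : (2 : ℝ) ≤ p := by exact_mod_cast hp
  rw [div_le_one (by linarith)]; linarith

theorem exactRatio_nonneg {p : ℕ} (hp : 2 ≤ p) : 0 ≤ exactRatio p := by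
  have : (2 : ℝ) ≤ p := by exact_mod_cast hp
  exact div_nonneg (by linarith) (by nlinarith)

theorem exactRatio_le {p : ℕ} (hp : 2 ≤ p) : exactRatio p ≤ 1 / ((p : ℝ) - 1) := by
  have : (2 : ℝ) ≤ p := by exact_mod_cast hp
  rw [exactRatio, div_le_div_iff₀ (by nlinarith) (by linarith)]
  nlinarith

/-- The value `1 / (p - 1)` off the event, whose density is `1 / p`, is the one that balances -1 on
it. The mean square then equals that same value. -/
theorem avg_dvdLocal {p : ℕ} (hp : 2 ≤ p) : avg (p ^ 2) (dvdLocal p) = 0 := by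
  have h2 : (2 : ℝ) ≤ p := by exact_mod_cast hp
  have e : dvdLocal p = fun n => (if p ∣ n then (1 : ℝ) else 0) * (-1 - 1 / ((p : ℝ) - 1))
      + 1 / ((p : ℝ) - 1) := by
    funext n; simp only [dvdLocal]; split_ifs <;> ring
  rw [e, avg_add, avg_mul_const, avg_dvd (by omega), avg_const (by positivity)]
  have : (p : ℝ) - 1 ≠ 0 := by linarith
  field_simp
  ring

theorem avg_dvdLocal_sq {p : ℕ} (hp : 2 ≤ p) :
    avg (p ^ 2) (fun n => dvdLocal p n * dvdLocal p n) = 1 / ((p : ℝ) - 1) := by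
  have h2 : (2 : ℝ) ≤ p := by exact_mod_cast hp
  have e : (fun n => dvdLocal p n * dvdLocal p n) = fun n => (if p ∣ n then (1 : ℝ) else 0) *
      (1 - 1 / ((p : ℝ) - 1) ^ 2) + 1 / ((p : ℝ) - 1) ^ 2 := by
    have : (p : ℝ) - 1 ≠ 0 := by linarith
    funext n; simp only [dvdLocal]; split_ifs
    · ring
    · field_simp; ring
  rw [e, avg_add, avg_mul_const, avg_dvd (by omega), avg_const (by positivity)]
  have : (p : ℝ) - 1 ≠ 0 := by linarith
  field_simp
  ring

/-- With `g` the density of `p ∥ m` and `h` the ratio, this is `(1 + h)(1 - g) = 1`; the mean and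
mean square of `exactLocal` reduce to it. -/
theorem exactRatio_eq {p : ℕ} (hp : 2 ≤ p) :
    exactRatio p = (1 / p - 1 / (p : ℝ) ^ 2) + (1 / p - 1 / (p : ℝ) ^ 2) * exactRatio p := by
  have h2 : (2 : ℝ) ≤ p := by exact_mod_cast hp
  have hD : (p : ℝ) ^ 2 - p + 1 ≠ 0 := by nlinarith
  have h3 : exactRatio p * ((p : ℝ) ^ 2 - p + 1) = p - 1 := div_mul_cancel₀ _ hD
  field_simp
  linear_combination h3

theorem avg_exact {p : ℕ} (hp : 0 < p) :
    avg (p ^ 2) (fun n => if p ∣ n ∧ ¬ p ^ 2 ∣ n then (1 : ℝ) else 0)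
      = 1 / p - 1 / (p : ℝ) ^ 2 := by
  have e : (fun n => if p ∣ n ∧ ¬ p ^ 2 ∣ n then (1 : ℝ) else 0) = fun n =>
      (if p ∣ n then (1 : ℝ) else 0) + (if p ^ 2 ∣ n then (1 : ℝ) else 0) * (-1) := by
    funext n
    by_cases h2 : p ^ 2 ∣ n
    · have h1 : p ∣ n := (dvd_pow_self p two_ne_zero).trans h2
      simp [h1, h2]
    · simp [h2]
  rw [e, avg_add, avg_mul_const, avg_dvd hp, avg_sq_dvd hp]
  ring

theorem avg_exactLocal {p : ℕ} (hp : 2 ≤ p) : avg (p ^ 2) (exactLocal p) = 0 := by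
  have h2 : (2 : ℝ) ≤ p := by exact_mod_cast hp
  have e : exactLocal p = fun n => (if p ∣ n ∧ ¬ p ^ 2 ∣ n then (1 : ℝ) else 0) *
      (-1 - exactRatio p) + exactRatio p := by
    funext n; simp only [exactLocal]; split_ifs <;> ring
  rw [e, avg_add, avg_mul_const, avg_exact (by omega), avg_const (by positivity)]
  linear_combination exactRatio_eq hp

theorem avg_exactLocal_sq {p : ℕ} (hp : 2 ≤ p) :
    avg (p ^ 2) (fun n => exactLocal p n * exactLocal p n) = exactRatio p := by
  have h2 : (2 : ℝ) ≤ p := by exact_mod_cast hp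
  have e : (fun n => exactLocal p n * exactLocal p n) = fun n =>
      (if p ∣ n ∧ ¬ p ^ 2 ∣ n then (1 : ℝ) else 0) * (1 - exactRatio p ^ 2) + exactRatio p ^ 2 := by
    funext n; simp only [exactLocal]; split_ifs <;> ring
  rw [e, avg_add, avg_mul_const, avg_exact (by omega), avg_const (by positivity)]
  linear_combination (exactRatio p - 1) * exactRatio_eq hp

theorem abs_dvdLocal_le {p : ℕ} (hp : 2 ≤ p) (m : ℕ) : |dvdLocal p m| ≤ 1 := by
  have h2 : (2 : ℝ) ≤ p := by exact_mod_cast hp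
  unfold dvdLocal
  split_ifs
  · simp
  · rw [abs_of_nonneg (one_div_nonneg.2 (by linarith))]; exact one_div_sub_one_le_one hp

theorem abs_exactLocal_le {p : ℕ} (hp : 2 ≤ p) (m : ℕ) : |exactLocal p m| ≤ 1 := by
  unfold exactLocal
  split_ifs
  · simp
  · rw [abs_of_nonneg (exactRatio_nonneg hp)]
    exact (exactRatio_le hp).trans (one_div_sub_one_le_one hp)

/-- The local factor of a pair of a vector of linear forms and one further form. -/
def pairLocal {κ : Type*} (U : κ → ℕ → ℝ) (V : ℕ → ℝ) (i : Option κ × Bool) (n : ℕ) : ℝ :=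
  (match i.1 with | none => 1 | some a => U a n) * (match i.2 with | false => 1 | true => V n)

/-- `X` and `Y` are never large together. On either event, of density at most `1/p`, the other
factor is at most `1/(p-1)`; off both events the product is at most `1/(p-1)²`. So two different
forms correlate only to second order. -/
theorem abs_avg_disjoint_le {p : ℕ} (hp : 2 ≤ p) {X Y Z : ℕ → ℝ} {EX EY : ℕ → Prop}
    [DecidablePred EX] [DecidablePred EY]
    (hX1 : ∀ n, |X n| ≤ 1) (hX2 : ∀ n, ¬ EX n → |X n| ≤ 1 / ((p : ℝ) - 1))
    (hY1 : ∀ n, |Y n| ≤ 1) (hY2 : ∀ n, ¬ EY n → |Y n| ≤ 1 / ((p : ℝ) - 1))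
    (hZ : ∀ n, |Z n| ≤ 1) (hd : ∀ n, ¬ (EX n ∧ EY n))
    (hEX : avg (p ^ 2) (fun n => if EX n then (1 : ℝ) else 0) ≤ 1 / p)
    (hEY : avg (p ^ 2) (fun n => if EY n then (1 : ℝ) else 0) ≤ 1 / p) :
    |avg (p ^ 2) (fun n => X n * Y n * Z n)| ≤ 3 / ((p : ℝ) - 1) ^ 2 := by
  have h2 : (2 : ℝ) ≤ p := by exact_mod_cast hp
  have hq : 0 < (p : ℝ) - 1 := by linarith
  have h1 : ∀ n, |X n * Y n * Z n| ≤ ((if EX n then (1 : ℝ) else 0) * (1 / ((p : ℝ) - 1)) +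
      (if EY n then (1 : ℝ) else 0) * (1 / ((p : ℝ) - 1))) + (1 / ((p : ℝ) - 1)) ^ 2 := by
    intro n
    have hs : 0 ≤ (1 / ((p : ℝ) - 1)) ^ 2 := by positivity
    rw [abs_mul, abs_mul]
    refine (mul_le_of_le_one_right (by positivity) (hZ n)).trans ?_
    by_cases hx : EX n
    · have hy : ¬ EY n := fun hy => hd n ⟨hx, hy⟩
      simp only [hx, hy, if_true, if_false, one_mul, zero_mul, add_zero]
      calc |X n| * |Y n| ≤ 1 * (1 / ((p : ℝ) - 1)) :=
            mul_le_mul (hX1 n) (hY2 n hy) (abs_nonneg _) zero_le_one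
        _ ≤ _ := by linarith
    · by_cases hy : EY n
      · simp only [hx, hy, if_true, if_false, one_mul, zero_mul, zero_add]
        calc |X n| * |Y n| ≤ (1 / ((p : ℝ) - 1)) * 1 :=
              mul_le_mul (hX2 n hx) (hY1 n) (abs_nonneg _) (by positivity)
          _ ≤ _ := by linarith
      · simp only [hx, hy, if_false, zero_mul, add_zero, zero_add]
        rw [sq]
        exact mul_le_mul (hX2 n hx) (hY2 n hy) (abs_nonneg _) (by positivity)
  refine (abs_avg_le h1).trans ?_
  rw [avg_add, avg_add, avg_mul_const, avg_mul_const, avg_const (by positivity)]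
  have h3 : 1 / (p : ℝ) ≤ 1 / ((p : ℝ) - 1) := one_div_le_one_div_of_le hq (by linarith)
  have h4 : 0 ≤ 1 / ((p : ℝ) - 1) := by positivity
  have h5 : 3 / ((p : ℝ) - 1) ^ 2 = (1 / ((p : ℝ) - 1)) * (1 / ((p : ℝ) - 1)) +
      (1 / ((p : ℝ) - 1)) * (1 / ((p : ℝ) - 1)) + (1 / ((p : ℝ) - 1)) ^ 2 := by
    field_simp; ring
  rw [h5]
  gcongr
  · exact hEX.trans h3
  · exact hEY.trans h3

/-- A pair of indices gives the constant 1, a single function (mean 0), a square of one function (a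
diagonal main term), or a product involving two different forms, covered by `abs_avg_disjoint_le`.
The coefficient 12 is 3 times 4, from the `(2 (|κ| + 1))²` pairs of indices. -/
theorem sum_abs_avg_pairLocal_le {κ : Type*} [Fintype κ] [DecidableEq κ] {p : ℕ} (hp : 2 ≤ p)
    {U : κ → ℕ → ℝ} {V : ℕ → ℝ} {E : κ → ℕ → Prop} {EV : ℕ → Prop}
    [∀ a, DecidablePred (E a)] [DecidablePred EV] {h : ℝ}
    (hU1 : ∀ a n, |U a n| ≤ 1) (hU2 : ∀ a n, ¬ E a n → |U a n| ≤ 1 / ((p : ℝ) - 1))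
    (hV1 : ∀ n, |V n| ≤ 1) (hV2 : ∀ n, ¬ EV n → |V n| ≤ 1 / ((p : ℝ) - 1))
    (hd : ∀ a b n, a ≠ b → ¬ (E a n ∧ E b n)) (hdV : ∀ a n, ¬ (E a n ∧ EV n))
    (hE : ∀ a, avg (p ^ 2) (fun n => if E a n then (1 : ℝ) else 0) ≤ 1 / p)
    (hEV : avg (p ^ 2) (fun n => if EV n then (1 : ℝ) else 0) ≤ 1 / p)
    (hU : ∀ a, avg (p ^ 2) (U a) = 0) (hV : avg (p ^ 2) V = 0)
    (hUU : ∀ a, avg (p ^ 2) (fun n => U a n * U a n) = 1 / ((p : ℝ) - 1))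
    (hVV : avg (p ^ 2) (fun n => V n * V n) = h) :
    ∑ i, ∑ j, |avg (p ^ 2) (fun n => pairLocal U V i n * pairLocal U V j n)| ≤
      1 + Fintype.card κ * (1 / ((p : ℝ) - 1)) + h +
        12 * ((Fintype.card κ : ℝ) + 1) ^ 2 * (1 / ((p : ℝ) - 1) ^ 2) := by
  have h2 : (2 : ℝ) ≤ p := by exact_mod_cast hp
  have hq : 0 < (p : ℝ) - 1 := by linarith
  have hh : 0 ≤ h := by
    rw [← hVV, avg]
    exact div_nonneg (sum_nonneg fun n _ => mul_self_nonneg _) (by positivity)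
  have hq3 : 0 ≤ 3 / ((p : ℝ) - 1) ^ 2 := by positivity
  -- Diagonal main terms. The index with both functions present gets 0, because its square already
  -- involves two forms and falls under the second-order bound.
  set d : Option κ × Bool → ℝ := fun i => match i with
    | (none, false) => 1
    | (some _, false) => 1 / ((p : ℝ) - 1)
    | (none, true) => h
    | (some _, true) => 0 with hd'
  have m1 : ∀ (x y : ℝ), |x| ≤ 1 → |y| ≤ 1 → |x * y| ≤ 1 := fun x y hx hy => by
    rw [abs_mul]; exact mul_le_one₀ hx (abs_nonneg _) hy
  have hone : |(1 : ℝ)| ≤ 1 := by simp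
  have UU : ∀ a b (Z : ℕ → ℝ), a ≠ b → (∀ n, |Z n| ≤ 1) →
      |avg (p ^ 2) (fun n => U a n * U b n * Z n)| ≤ 3 / ((p : ℝ) - 1) ^ 2 :=
    fun a b Z hab hZ => abs_avg_disjoint_le hp (hU1 a) (hU2 a) (hU1 b) (hU2 b) hZ
      (fun n => hd a b n hab) (hE a) (hE b)
  have UV : ∀ a (Z : ℕ → ℝ), (∀ n, |Z n| ≤ 1) →
      |avg (p ^ 2) (fun n => U a n * V n * Z n)| ≤ 3 / ((p : ℝ) - 1) ^ 2 :=
    fun a Z hZ => abs_avg_disjoint_le hp (hU1 a) (hU2 a) hV1 hV2 hZ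
      (fun n => hdV a n) (hE a) hEV
  have conv : ∀ {F G : ℕ → ℝ} {B : ℝ}, (∀ n, F n = G n) → |avg (p ^ 2) G| ≤ B →
      |avg (p ^ 2) F| ≤ B := by
    intro F G B hFG hB
    rwa [show F = G from funext hFG]
  have key : ∀ i j, |avg (p ^ 2) (fun n => pairLocal U V i n * pairLocal U V j n)| ≤
      3 / ((p : ℝ) - 1) ^ 2 + if i = j then d i else 0 := by
    have hd0 : ∀ i j, 0 ≤ if i = j then d i else 0 := by
      intro i j
      split_ifs
      · rcases i with ⟨_ | a, _ | _⟩ <;> simp only [hd'] <;> positivity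
      · exact le_rfl
    have red : ∀ i j, |avg (p ^ 2) (fun n => pairLocal U V i n * pairLocal U V j n)| ≤
        3 / ((p : ℝ) - 1) ^ 2 →
        |avg (p ^ 2) (fun n => pairLocal U V i n * pairLocal U V j n)| ≤
        3 / ((p : ℝ) - 1) ^ 2 + if i = j then d i else 0 := fun i j hij => by
      linarith [hd0 i j]
    have z : |avg (p ^ 2) V| ≤ 3 / ((p : ℝ) - 1) ^ 2 := by rw [hV, abs_zero]; exact hq3
    have zU : ∀ a, |avg (p ^ 2) (U a)| ≤ 3 / ((p : ℝ) - 1) ^ 2 := fun a => by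
      rw [hU, abs_zero]; exact hq3
    rintro ⟨_ | a, _ | _⟩ ⟨_ | b, _ | _⟩
    · simp only [pairLocal, mul_one, hd', if_true]
      rw [avg_const (by positivity), abs_one]; linarith
    · exact red _ _ (conv (fun n => by simp [pairLocal]) z)
    · exact red _ _ (conv (fun n => by simp [pairLocal]) (zU b))
    · exact red _ _ (conv (G := fun n => U b n * V n * 1) (fun n => by simp [pairLocal])
        (UV b _ fun _ => hone))
    · exact red _ _ (conv (fun n => by simp [pairLocal]) z)
    · simp only [pairLocal, one_mul, hd', if_true]
      rw [hVV, abs_of_nonneg hh]; linarith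
    · exact red _ _ (conv (G := fun n => U b n * V n * 1) (fun n => by simp [pairLocal]; ring)
        (UV b _ fun _ => hone))
    · exact red _ _ (conv (G := fun n => U b n * V n * V n) (fun n => by simp [pairLocal]; ring)
        (UV b _ fun n => hV1 n))
    · exact red _ _ (conv (fun n => by simp [pairLocal]) (zU a))
    · exact red _ _ (conv (G := fun n => U a n * V n * 1) (fun n => by simp [pairLocal])
        (UV a _ fun _ => hone))
    · by_cases hab : a = b
      · subst hab
        simp only [pairLocal, mul_one, hd', if_true]
        rw [hUU, abs_of_nonneg (by positivity)]; linarith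
      · exact red _ _ (conv (G := fun n => U a n * U b n * 1) (fun n => by simp [pairLocal])
          (UU a b _ hab fun _ => hone))
    · exact red _ _ (conv (G := fun n => U a n * V n * U b n) (fun n => by simp [pairLocal]; ring)
        (UV a _ fun n => hU1 b n))
    · exact red _ _ (conv (G := fun n => U a n * V n * 1) (fun n => by simp [pairLocal])
        (UV a _ fun _ => hone))
    · exact red _ _ (conv (G := fun n => U a n * V n * V n) (fun n => by simp [pairLocal])
        (UV a _ fun n => hV1 n))
    · exact red _ _ (conv (G := fun n => U a n * V n * U b n) (fun n => by simp [pairLocal])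
        (UV a _ fun n => hU1 b n))
    · exact red _ _ (conv (G := fun n => U a n * V n * (U b n * V n))
        (fun n => by simp [pairLocal]) (UV a _ fun n => m1 _ _ (hU1 b n) (hV1 n)))
  refine (sum_le_sum fun i _ => sum_le_sum fun j _ => key i j).trans ?_
  simp only [sum_add_distrib, sum_ite_eq, mem_univ, if_true, sum_const, card_univ, nsmul_eq_mul]
  have hsum : ∑ i, d i = 1 + Fintype.card κ * (1 / ((p : ℝ) - 1)) + h := by
    rw [Fintype.sum_prod_type, Fintype.sum_option]
    simp only [Fintype.sum_bool, hd', zero_add, sum_const, card_univ, nsmul_eq_mul]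
    ring
  rw [hsum]
  simp only [Fintype.card_prod, Fintype.card_option, Fintype.card_bool]
  push_cast
  have : (3 : ℝ) / ((p : ℝ) - 1) ^ 2 = 3 * (1 / ((p : ℝ) - 1) ^ 2) := by ring
  rw [this]
  apply le_of_eq
  ring

/-- Lower bound for the truncated sum over squarefree numbers (Rankin's trick). -/
theorem half_prod_le_sum_truncated {α : Type*} [Fintype α] [DecidableEq α] (w : α → ℕ)
    (hw : ∀ a, 2 ≤ w a) (h : α → ℝ) (h0 : ∀ a, 0 ≤ h a) (h1 : ∀ a, h a ≤ 2 / w a) (z C A : ℝ)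
    (hz : 1 < z) (hwz : ∀ a, h a ≠ 0 → (w a : ℝ) ≤ z)
    (hC : ∑ a ∈ univ.filter (fun a => h a ≠ 0), Real.log (w a) / w a ≤ C * Real.log z)
    (hA : 6 * C + 1 ≤ A) :
    1 / 2 * ∏ a, (1 + h a) ≤
      ∑ σ : α → Bool, (if ∏ a, (if σ a then (w a : ℝ) else 1) ≤ z ^ A then 1 else 0) *
        ∏ a, (if σ a then h a else 1) := by
  have hlz : 0 < Real.log z := Real.log_pos hz
  have hw0 : ∀ a, (0 : ℝ) < w a := fun a => by
    have := hw a; exact_mod_cast (by omega : 0 < w a)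
  set δ := 1 / Real.log z with hδ
  have hδ0 : 0 < δ := by positivity
  have total : ∑ σ : α → Bool, ∏ a, (if σ a then h a else 1) = ∏ a, (1 + h a) := by
    rw [← Fintype.prod_sum (fun (a : α) (b : Bool) => if b then h a else 1)]
    refine prod_congr rfl fun a _ => ?_
    simp [add_comm]
  -- The truncated-away terms satisfy `∏ w > z^A`, so `e^(-A) (∏ w)^δ > 1` with `δ = 1 / log z`.
  -- Inserting this weight and extending the sum to all `σ` gives a full product.
  have htail : ∑ σ : α → Bool, (Real.exp (-A) * ∏ a, (if σ a then h a * (w a : ℝ) ^ δ else 1))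
      ≤ 1 / 2 * ∏ a, (1 + h a) := by
    rw [← mul_sum, ← Fintype.prod_sum (fun (a : α) (b : Bool) => if b then h a * (w a : ℝ) ^ δ else 1)]
    -- Since `w ≤ z` wherever `h ≠ 0`, `w^δ = e^t` with `0 ≤ t ≤ 1`, so `e^t ≤ 1 + 3t`. With `h ≤
    -- 2/w` the tilt costs a factor `exp(6 δ log w / w)`; these multiply to at most `e^(6C)`, hence
    -- the condition on `A`.
    have hfac : ∀ a, ∑ b : Bool, (if b then h a * (w a : ℝ) ^ δ else 1) ≤
        (1 + h a) * Real.exp (if h a ≠ 0 then 6 * δ * (Real.log (w a) / w a) else 0) := by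
      intro a
      simp only [Fintype.sum_bool, if_true, Bool.false_eq_true, if_false]
      by_cases ha : h a = 0
      · simp [ha]
      rw [if_pos ha]
      set t := δ * Real.log (w a) with ht
      have hlw : 0 ≤ Real.log (w a) := Real.log_nonneg (by
        have := hw a; exact_mod_cast (by omega : 1 ≤ w a))
      have ht0 : 0 ≤ t := by positivity
      have ht1 : t ≤ 1 := by
        rw [ht, hδ, one_div_mul_eq_div, div_le_one hlz]
        exact Real.log_le_log (hw0 a) (hwz a ha)
      have hpow : (w a : ℝ) ^ δ = Real.exp t := by
        rw [Real.rpow_def_of_pos (hw0 a), ht, mul_comm]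
      have hexp : Real.exp t ≤ 1 + 3 * t := by
        have e1 : 1 - t ≤ Real.exp (-t) := by have := Real.add_one_le_exp (-t); linarith
        have e2 : Real.exp t * Real.exp (-t) = 1 := by rw [← Real.exp_add]; simp
        have e3 : Real.exp t ≤ 3 := by
          have := Real.exp_le_exp.2 ht1
          have := Real.exp_one_lt_d9
          linarith
        have e4 : 0 < Real.exp t := Real.exp_pos t
        nlinarith
      have hy : 6 * δ * (Real.log (w a) / w a) = (2 / w a) * (3 * t) := by
        rw [ht]; ring
      rw [hpow, hy]
      have hy0 : 0 ≤ (2 / (w a : ℝ)) * (3 * t) := by have := hw0 a; positivity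
      have e5 := Real.add_one_le_exp ((2 / (w a : ℝ)) * (3 * t))
      have e6 : h a * Real.exp t ≤ h a + (2 / (w a : ℝ)) * (3 * t) := by
        calc h a * Real.exp t ≤ h a * (1 + 3 * t) := mul_le_mul_of_nonneg_left hexp (h0 a)
          _ = h a + h a * (3 * t) := by ring
          _ ≤ _ := by gcongr; exact h1 a
      calc h a * Real.exp t + 1 ≤ 1 + h a + (2 / (w a : ℝ)) * (3 * t) := by linarith
        _ ≤ (1 + h a) * ((2 / (w a : ℝ)) * (3 * t) + 1) := by nlinarith [h0 a]
        _ ≤ _ := mul_le_mul_of_nonneg_left e5 (by linarith [h0 a])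
    have hprod : ∏ a, ∑ b : Bool, (if b then h a * (w a : ℝ) ^ δ else 1) ≤
        (∏ a, (1 + h a)) * Real.exp (6 * C) := by
      calc _ ≤ ∏ a, ((1 + h a) * Real.exp (if h a ≠ 0 then 6 * δ * (Real.log (w a) / w a) else 0)) :=
            prod_le_prod (fun a _ => sum_nonneg fun b _ => by
              split_ifs
              · exact mul_nonneg (h0 a) (Real.rpow_nonneg (hw0 a).le _)
              · exact zero_le_one) fun a _ => hfac a
        _ = (∏ a, (1 + h a)) * Real.exp (6 * δ * ∑ a ∈ univ.filter (fun a => h a ≠ 0),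
              Real.log (w a) / w a) := by
            rw [prod_mul_distrib, ← Real.exp_sum, ← sum_filter, mul_sum]
        _ ≤ _ := by
            refine mul_le_mul_of_nonneg_left (Real.exp_le_exp.2 ?_)
              (prod_nonneg fun a _ => by linarith [h0 a])
            calc 6 * δ * _ ≤ 6 * δ * (C * Real.log z) := by gcongr
              _ = 6 * C := by rw [hδ]; field_simp
    have hP : 0 ≤ ∏ a, (1 + h a) := prod_nonneg fun a _ => by linarith [h0 a]
    calc Real.exp (-A) * _ ≤ Real.exp (-A) * ((∏ a, (1 + h a)) * Real.exp (6 * C)) := by gcongr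
      _ = Real.exp (6 * C - A) * ∏ a, (1 + h a) := by
          rw [show 6 * C - A = -A + 6 * C by ring, Real.exp_add]; ring
      _ ≤ 1 / 2 * ∏ a, (1 + h a) := by
          refine mul_le_mul_of_nonneg_right ?_ hP
          calc Real.exp (6 * C - A) ≤ Real.exp (-1) := Real.exp_le_exp.2 (by linarith)
            _ ≤ 1 / 2 := by
              rw [Real.exp_neg, inv_eq_one_div]
              apply one_div_le_one_div_of_le (by norm_num)
              have := Real.add_one_le_exp (1 : ℝ); linarith
  have hpt : ∀ σ : α → Bool, ∏ a, (if σ a then h a else 1) -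
      (if ∏ a, (if σ a then (w a : ℝ) else 1) ≤ z ^ A then 1 else 0) *
        ∏ a, (if σ a then h a else 1) ≤
      Real.exp (-A) * ∏ a, (if σ a then h a * (w a : ℝ) ^ δ else 1) := by
    intro σ
    have e1 : ∏ a, (if σ a then h a * (w a : ℝ) ^ δ else 1) =
        (∏ a, (if σ a then h a else 1)) * (∏ a, (if σ a then (w a : ℝ) else 1)) ^ δ := by
      rw [← Real.finsetProd_rpow _ _ (fun a _ => by split_ifs <;> positivity),
        ← prod_mul_distrib]
      refine prod_congr rfl fun a _ => ?_
      split_ifs <;> simp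
    have hn : 0 ≤ ∏ a, (if σ a then h a else 1) :=
      prod_nonneg fun a _ => by split_ifs; exacts [h0 a, zero_le_one]
    rw [e1]
    split_ifs with hc
    · rw [one_mul, sub_self]
      refine mul_nonneg (Real.exp_pos _).le (mul_nonneg hn (Real.rpow_nonneg ?_ _))
      exact prod_nonneg fun a _ => by split_ifs <;> positivity
    · rw [zero_mul, sub_zero]
      push Not at hc
      have hz0 : 0 < z := by linarith
      have : Real.exp A ≤ (∏ a, (if σ a then (w a : ℝ) else 1)) ^ δ := by
        calc Real.exp A = (z ^ A) ^ δ := by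
              rw [← Real.rpow_mul hz0.le, Real.rpow_def_of_pos hz0, hδ]
              congr 1; field_simp
          _ ≤ _ := Real.rpow_le_rpow (Real.rpow_nonneg hz0.le _) hc.le hδ0.le
      calc _ = Real.exp (-A) * ((∏ a, (if σ a then h a else 1)) * Real.exp A) := by
            rw [Real.exp_neg]; field_simp
        _ ≤ _ := by gcongr
  have hsum := sum_le_sum fun σ (_ : σ ∈ univ) => hpt σ
  rw [sum_sub_distrib, total] at hsum
  linarith

/-- The exponent in the level `z ^ sieveExp` of the upper bound sieve. -/
noncomputable def sieveExp : ℝ := 6 * (1 + (Real.log 4 + 4) / Real.log 2) + 1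

theorem one_le_sieveExp : 1 ≤ sieveExp := by
  have : 0 < Real.log 2 := Real.log_pos (by norm_num)
  have : 0 < Real.log 4 := Real.log_pos (by norm_num)
  unfold sieveExp
  have : 0 ≤ (Real.log 4 + 4) / Real.log 2 := by positivity
  linarith

/-- The combination of local divisibility functions of a vector of linear forms `A n + B i`. -/
noncomputable def formSum {κ : Type*} [Fintype κ] [DecidableEq κ] (P : Finset ℕ)
    (y : (P → Option κ) → ℝ) (A : ℕ) (B : κ → ℕ) (n : ℕ) : ℝ :=
  ∑ τ : P → Option κ, y τ *
    ∏ a : P, (match τ a with | none => 1 | some i => dvdLocal a (A * n + B i))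

/-! ### The upper bound sieve -/

/-- For `p ∈ Q`, `1 + h = 1/(1 - g) ≥ e^g` with `g = 1/p - 1/p²`; the squares sum to at most 1,
which is the loss in the exponent. -/
theorem prod_one_add_exactRatio_ge {P Q : Finset ℕ} (hP : ∀ p ∈ P, p.Prime) (hQ : Q ⊆ P) :
    Real.exp (∑ p ∈ Q, 1 / (p : ℝ) - 1) ≤ ∏ a : P, (1 + if (a : ℕ) ∈ Q then exactRatio a else 0) := by
  have h1 : ∏ a : P, (1 + if (a : ℕ) ∈ Q then exactRatio a else 0) =
      ∏ p ∈ Q, (1 + exactRatio p) := by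
    rw [prod_coe_sort P
      (fun p => 1 + if p ∈ Q then exactRatio p else 0)]
    rw [← prod_subset hQ (fun p _ hp => by simp [hp])]
    exact prod_congr rfl fun p hp => by simp [hp]
  have hsq : ∑ p ∈ Q, 1 / (p : ℝ) ^ 2 ≤ 1 := by
    have := sum_one_div_sq_le (fun a : Q => (a : ℕ)) (fun a => (hP a (hQ a.2)).two_le)
      Subtype.val_injective
    rwa [sum_coe_sort Q (fun p : ℕ => 1 / (p : ℝ) ^ 2)] at this
  rw [h1]
  calc _ ≤ Real.exp (∑ p ∈ Q, (1 / (p : ℝ) - 1 / (p : ℝ) ^ 2)) := by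
        rw [sum_sub_distrib]; exact Real.exp_le_exp.2 (by linarith)
    _ = ∏ p ∈ Q, Real.exp (1 / (p : ℝ) - 1 / (p : ℝ) ^ 2) := Real.exp_sum _ _
    _ ≤ _ := by
        refine prod_le_prod (fun _ _ => (Real.exp_pos _).le) fun p hp => ?_
        have h2 := (hP p (hQ hp)).two_le
        have h2' : (2 : ℝ) ≤ p := by exact_mod_cast h2
        have hx := exactRatio_eq h2
        set g := 1 / (p : ℝ) - 1 / (p : ℝ) ^ 2 with hg
        have e1 : 1 - g ≤ Real.exp (-g) := by have := Real.add_one_le_exp (-g); linarith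
        have e2 : Real.exp g * Real.exp (-g) = 1 := by rw [← Real.exp_add]; simp
        have e3 : (1 + exactRatio p) * (1 - g) = 1 := by linear_combination hx
        have e4 := exactRatio_nonneg h2
        have e5 := Real.exp_pos g
        have e6 : 0 < 1 - g := by
          by_contra h
          push Not at h
          nlinarith
        have e7 : Real.exp g * (1 - g) ≤ (1 + exactRatio p) * (1 - g) := by
          rw [e3]; exact (mul_le_mul_of_nonneg_left e1 e5.le).trans e2.le
        exact le_of_mul_le_mul_right e7 e6

/-- Use `1 + u ≤ e^u` after replacing `1/(p-1)` by `1/p + 2/p²` and `1/(p-1)²` by `4/p²`. The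
second-order coefficients are `48 (k+1)²` and `2k + 2`, together at most `50 (k+1)²`. -/
theorem prod_local_le {P Q : Finset ℕ} (hP : ∀ p ∈ P, p.Prime) (hQ : Q ⊆ P) (k : ℕ) :
    ∏ a : P, (1 + k * (1 / ((a : ℝ) - 1)) + (if (a : ℕ) ∈ Q then exactRatio a else 0) +
        12 * ((k : ℝ) + 1) ^ 2 * (1 / ((a : ℝ) - 1) ^ 2)) ≤
      Real.exp (k * ∑ p ∈ P, 1 / (p : ℝ) + ∑ p ∈ Q, 1 / (p : ℝ) + 50 * ((k : ℝ) + 1) ^ 2) := by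
  have hsq : ∑ a : P, 1 / ((a : ℕ) : ℝ) ^ 2 ≤ 1 :=
    sum_one_div_sq_le (fun a : P => (a : ℕ)) (fun a => (hP a a.2).two_le) Subtype.val_injective
  have hfac : ∀ a : P, 1 + k * (1 / (((a : ℕ) : ℝ) - 1)) +
      (if (a : ℕ) ∈ Q then exactRatio a else 0) +
        12 * ((k : ℝ) + 1) ^ 2 * (1 / (((a : ℕ) : ℝ) - 1) ^ 2) ≤
      Real.exp (k * (1 / ((a : ℕ) : ℝ)) + (if (a : ℕ) ∈ Q then 1 / ((a : ℕ) : ℝ) else 0) +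
        50 * ((k : ℝ) + 1) ^ 2 * (1 / ((a : ℕ) : ℝ) ^ 2)) := by
    rintro ⟨p, hp⟩
    have h2 := (hP p hp).two_le
    have h2' : (2 : ℝ) ≤ p := by exact_mod_cast h2
    have hp1 : (0 : ℝ) < p - 1 := by linarith
    have e1 : 1 / ((p : ℝ) - 1) ≤ 1 / p + 2 * (1 / (p : ℝ) ^ 2) := by
      rw [show 1 / (p : ℝ) + 2 * (1 / (p : ℝ) ^ 2) = (p + 2) / (p : ℝ) ^ 2 by field_simp,
        div_le_div_iff₀ hp1 (by positivity)]
      nlinarith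
    have e2 : 1 / ((p : ℝ) - 1) ^ 2 ≤ 4 * (1 / (p : ℝ) ^ 2) := by
      rw [mul_one_div, div_le_div_iff₀ (by positivity) (by positivity)]
      nlinarith
    have e3 := exactRatio_le h2
    have hq : 0 ≤ 1 / (p : ℝ) ^ 2 := by positivity
    have e4 : (if p ∈ Q then exactRatio p else 0) ≤ (if p ∈ Q then 1 / (p : ℝ) else 0) +
        2 * (1 / (p : ℝ) ^ 2) := by
      split_ifs <;> linarith
    have hk : (0 : ℝ) ≤ k := by positivity
    have e5 : k * (1 / ((p : ℝ) - 1)) ≤ k * (1 / (p : ℝ) + 2 * (1 / (p : ℝ) ^ 2)) := by gcongr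
    have e6 : 12 * ((k : ℝ) + 1) ^ 2 * (1 / ((p : ℝ) - 1) ^ 2) ≤
        12 * ((k : ℝ) + 1) ^ 2 * (4 * (1 / (p : ℝ) ^ 2)) := by gcongr
    have e7 : (2 * (k : ℝ) + 2) * (1 / (p : ℝ) ^ 2) ≤ 2 * ((k : ℝ) + 1) ^ 2 * (1 / (p : ℝ) ^ 2) := by
      gcongr; nlinarith
    refine le_trans ?_ (Real.add_one_le_exp _)
    simp only
    linarith
  calc _ ≤ ∏ a : P, Real.exp (k * (1 / ((a : ℕ) : ℝ)) +
          (if (a : ℕ) ∈ Q then 1 / ((a : ℕ) : ℝ) else 0) +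
          50 * ((k : ℝ) + 1) ^ 2 * (1 / ((a : ℕ) : ℝ) ^ 2)) := by
        refine prod_le_prod (fun a _ => ?_) fun a _ => hfac a
        have h2 := (hP a a.2).two_le
        have h2' : (2 : ℝ) ≤ (a : ℕ) := by exact_mod_cast h2
        have hp1 : (0 : ℝ) < ((a : ℕ) : ℝ) - 1 := by linarith
        have := exactRatio_nonneg h2
        have : 0 ≤ (if (a : ℕ) ∈ Q then exactRatio a else 0) := by split_ifs <;> linarith
        positivity
    _ ≤ _ := by
        rw [← Real.exp_sum, Real.exp_le_exp, sum_add_distrib, sum_add_distrib, ← mul_sum, ← mul_sum,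
          sum_coe_sort P (fun p : ℕ => 1 / (p : ℝ)),
          sum_coe_sort P (fun p : ℕ => if p ∈ Q then 1 / (p : ℝ) else 0), ← sum_filter,
          filter_mem_eq_inter, inter_eq_right.2 hQ]
        have : 50 * ((k : ℝ) + 1) ^ 2 * ∑ a : P, 1 / ((a : ℕ) : ℝ) ^ 2 ≤ 50 * ((k : ℝ) + 1) ^ 2 :=
          mul_le_of_le_one_right (by positivity) hsq
        linarith

theorem sum_fun_prod {α ι κ : Type*} [Fintype α] [DecidableEq α] [Fintype ι] [Fintype κ]
    (F : (α → ι) → ℝ) (G : (α → κ) → ℝ) :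
    (∑ τ, F τ) * ∑ σ, G σ =
      ∑ φ : α → ι × κ, F (fun a => (φ a).1) * G (fun a => (φ a).2) := by
  rw [sum_mul_sum, ← Fintype.sum_prod_type']
  exact (Equiv.sum_comp (Equiv.arrowProdEquivProdArrow α (fun _ => ι) (fun _ => κ))
    (fun x : (α → ι) × (α → κ) => F x.1 * G x.2)).symm

/-- Dividing by `G² ≥ e^(2s-4)` turns the exponent `k t + s` into `k t - s`: the sieve enters once
as a cost and twice as a gain. All numerical constants fit into `60 (k+1)²`. -/
theorem sifted_bound_aux {S G X t s k E8 : ℝ} (hk0 : 0 ≤ k) (hs0 : 0 ≤ s) (hX : 0 ≤ X)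
    (hE80 : 0 ≤ E8) (hS0 : 0 ≤ S) (hGlow : 1 / 2 * Real.exp (s - 1) ≤ G)
    (hfin : G ^ 2 * S ≤ X * Real.exp (k * t + s + 50 * (k + 1) ^ 2) +
      Real.exp (2 * (k + 1)) ^ 2 * E8) :
    S ≤ Real.exp (60 * (k + 1) ^ 2) * (X * Real.exp (k * t - s) + E8) := by
  have hG2 : Real.exp (2 * s) * Real.exp (-4) ≤ G ^ 2 := by
    calc Real.exp (2 * s) * Real.exp (-4) = Real.exp (-2) * Real.exp (s - 1) ^ 2 := by
          rw [← Real.exp_nat_mul, ← Real.exp_add, ← Real.exp_add]; congr 1; push_cast; ring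
      _ ≤ (1 / 2) ^ 2 * Real.exp (s - 1) ^ 2 := by
          gcongr
          have e1 : Real.exp (-2) = Real.exp (-1) ^ 2 := by
            rw [← Real.exp_nat_mul]; congr 1; push_cast; ring
          rw [e1]
          gcongr
          rw [Real.exp_neg, inv_eq_one_div]
          apply one_div_le_one_div_of_le (by norm_num)
          have := Real.add_one_le_exp (1 : ℝ); linarith
      _ = (1 / 2 * Real.exp (s - 1)) ^ 2 := by ring
      _ ≤ _ := by gcongr
  have h1 : Real.exp (2 * s) * Real.exp (-4) * S ≤
      X * Real.exp (k * t + s + 50 * (k + 1) ^ 2) + Real.exp (2 * (k + 1)) ^ 2 * E8 :=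
    (mul_le_mul_of_nonneg_right hG2 hS0).trans hfin
  have h2 : S = Real.exp (4 - 2 * s) * (Real.exp (2 * s) * Real.exp (-4) * S) := by
    rw [← mul_assoc, ← mul_assoc, ← Real.exp_add, ← Real.exp_add]; ring_nf; simp
  rw [h2]
  calc _ ≤ Real.exp (4 - 2 * s) * (X * Real.exp (k * t + s + 50 * (k + 1) ^ 2)
        + Real.exp (2 * (k + 1)) ^ 2 * E8) := by gcongr
    _ = Real.exp (50 * (k + 1) ^ 2 + 4) * (X * Real.exp (k * t - s)) +
        Real.exp (4 - 2 * s + 4 * (k + 1)) * E8 := by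
        have e1 : Real.exp (4 - 2 * s) * Real.exp (k * t + s + 50 * (k + 1) ^ 2) =
            Real.exp (50 * (k + 1) ^ 2 + 4) * Real.exp (k * t - s) := by
          rw [← Real.exp_add, ← Real.exp_add]; congr 1; ring
        have e2 : Real.exp (4 - 2 * s + 4 * (k + 1)) =
            Real.exp (4 - 2 * s) * Real.exp (2 * (k + 1)) ^ 2 := by
          rw [← Real.exp_nat_mul, ← Real.exp_add]; congr 1; push_cast; ring
        rw [e2]
        linear_combination X * e1
    _ ≤ Real.exp (60 * (k + 1) ^ 2) * (X * Real.exp (k * t - s)) +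
        Real.exp (60 * (k + 1) ^ 2) * E8 := by
        gcongr
        · nlinarith
        · nlinarith
    _ = _ := by ring

/-- Upper bound sieve for the mean square of a `formSum` over the `n` in an arithmetic progression
for which no prime `p ∈ Q` divides `A n + B'` exactly once. -/
theorem sum_formSum_sq_sifted_le {κ : Type*} [Fintype κ] [DecidableEq κ] (P Q : Finset ℕ)
    (hP : ∀ p ∈ P, p.Prime) (hQP : Q ⊆ P) (z : ℝ) (hz : 2 ≤ z) (hQ : Q ⊆ primesThree ⌊z⌋₊)
    (y : (P → Option κ) → ℝ) (hy : ∀ τ, |y τ| ≤ 1) (Y : ℝ) (hY0 : 0 ≤ Y)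
    (hY : ∀ τ, y τ ≠ 0 → ∏ a : P, (if τ a = none then 1 else ((a : ℕ) : ℝ)) ≤ Y)
    (A : ℕ) (B : κ → ℕ) (B' : ℕ) (hA : ∀ p ∈ P, A.Coprime p)
    (hd : ∀ p ∈ P, ∀ i j, i ≠ j → ∀ n, ¬ (p ∣ A * n + B i ∧ p ∣ A * n + B j))
    (hd' : ∀ p ∈ Q, ∀ i n, ¬ (p ∣ A * n + B i ∧ p ∣ A * n + B'))
    (M : ℕ) (hM : 0 < M) (hPM : ∀ p ∈ P, p.Coprime M) (u v ν : ℕ) (huv : u ≤ v) :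
    ∑ n ∈ (Ioc u v).filter (fun n => n ≡ ν [MOD M] ∧
        ∀ p ∈ Q, ¬ (p ∣ A * n + B' ∧ ¬ p ^ 2 ∣ A * n + B')), formSum P y A B n ^ 2 ≤
      Real.exp (60 * ((Fintype.card κ : ℝ) + 1) ^ 2) *
        (((v : ℝ) - u) / M *
          Real.exp (Fintype.card κ * ∑ p ∈ P, 1 / (p : ℝ) - ∑ p ∈ Q, 1 / (p : ℝ)) +
        (Y * z ^ sieveExp) ^ 8) := by
  -- Both `h` and `V` are set to zero at primes outside `Q`, so a choice `σ` contributes only if it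
  -- selects a subset of `Q`, though it is indexed by all of `P`.
  set h : P → ℝ := fun a => if (a : ℕ) ∈ Q then exactRatio a else 0 with hh
  set V : P → ℕ → ℝ := fun a n => if (a : ℕ) ∈ Q then exactLocal a (A * n + B') else 0 with hV
  set U : P → κ → ℕ → ℝ := fun a i n => dvdLocal a (A * n + B i) with hU
  set zc : (P → Bool) → ℝ :=
    fun σ => if ∏ a : P, (if σ a then ((a : ℕ) : ℝ) else 1) ≤ z ^ sieveExp then 1 else 0 with hzc
  set G : ℝ := ∑ σ : P → Bool, zc σ * ∏ a, (if σ a then h a else 1) with hG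
  have hp2 : ∀ a : P, 2 ≤ (a : ℕ) := fun a => (hP a a.2).two_le
  have h0 : ∀ a, 0 ≤ h a := fun a => by
    simp only [hh]; split_ifs; exacts [exactRatio_nonneg (hp2 a), le_rfl]
  have hlz : Real.log 2 ≤ Real.log z := Real.log_le_log (by norm_num) hz
  have hl2 : 0 < Real.log 2 := Real.log_pos (by norm_num)
  have hl4 : 0 < Real.log 4 := Real.log_pos (by norm_num)
  have hGlow : 1 / 2 * Real.exp (∑ p ∈ Q, 1 / (p : ℝ) - 1) ≤ G := by
    refine le_trans ?_ (half_prod_le_sum_truncated (fun a : P => (a : ℕ)) hp2 h h0 ?_ z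
      (1 + (Real.log 4 + 4) / Real.log 2) sieveExp (by linarith) ?_ ?_ le_rfl)
    · exact mul_le_mul_of_nonneg_left (prod_one_add_exactRatio_ge hP hQP) (by norm_num)
    · intro a
      have h2' : (2 : ℝ) ≤ (a : ℕ) := by exact_mod_cast hp2 a
      have : exactRatio a ≤ 2 / (a : ℕ) := by
        refine (exactRatio_le (hp2 a)).trans ?_
        rw [div_le_div_iff₀ (by linarith) (by linarith)]; linarith
      simp only [hh]; split_ifs
      · exact this
      · positivity
    · intro a ha
      have ha' : (a : ℕ) ∈ Q := by by_contra hc; exact ha (by simp [hh, hc])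
      exact (Nat.cast_le.2 (mem_primesThree.1 (hQ ha')).1).trans (Nat.floor_le (by linarith))
    · have hfl : 1 ≤ ⌊z⌋₊ := Nat.le_floor (by simpa using (by linarith : (1 : ℝ) ≤ z))
      have hsub : ∑ a ∈ univ.filter (fun a : P => h a ≠ 0), Real.log (a : ℕ) / (a : ℕ) ≤
          ∑ p ∈ primesThree ⌊z⌋₊, Real.log p / p := by
        rw [← sum_image (f := fun p : ℕ => Real.log p / p) (g := fun a : P => (a : ℕ))
          (fun a _ b _ hab => Subtype.ext hab)]
        refine sum_le_sum_of_subset_of_nonneg ?_ fun p hp _ => ?_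
        · intro p hp
          simp only [mem_image, mem_filter, mem_univ, true_and] at hp
          obtain ⟨a, ha, rfl⟩ := hp
          have ha' : (a : ℕ) ∈ Q := by by_contra hc; exact ha (by simp [hh, hc])
          exact hQ ha'
        · have := (mem_primesThree.1 hp).2.1.one_le
          exact div_nonneg (Real.log_nonneg (by exact_mod_cast this)) (by positivity)
      refine hsub.trans ((sum_log_div_prime_le _ hfl).trans ?_)
      have e1 : Real.log ⌊z⌋₊ ≤ Real.log z :=
        Real.log_le_log (by exact_mod_cast hfl) (Nat.floor_le (by linarith))
      -- The constant in `sieveExp` is chosen here: as `z ≥ 2`, the bounded term of the Mertens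
      -- estimate is a fixed multiple of `log z`.
      have e2 : Real.log 4 + 4 ≤ (Real.log 4 + 4) / Real.log 2 * Real.log z := by
        rw [div_mul_eq_mul_div, le_div_iff₀ hl2]; gcongr
      linarith
  -- Selberg's auxiliary sum. When no `p ∈ Q` exactly divides `A n + B'`, every `V a n` equals `h
  -- a`, so `T n = G`.
  set T : ℕ → ℝ := fun n => ∑ σ : P → Bool, zc σ * ∏ a, (if σ a then V a n else 1) with hT
  have hTG : ∀ n, (∀ p ∈ Q, ¬ (p ∣ A * n + B' ∧ ¬ p ^ 2 ∣ A * n + B')) → T n = G := by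
    intro n hn
    refine sum_congr rfl fun σ _ => ?_
    congr 1
    refine prod_congr rfl fun a _ => ?_
    have : V a n = h a := by
      simp only [hV, hh]
      split_ifs with haQ
      · rw [exactLocal, if_neg (hn a haQ)]
      · rfl
    rw [this]
  set c : (P → Option κ × Bool) → ℝ := fun φ => y (fun a => (φ a).1) * zc (fun a => (φ a).2) with hc
  have hprod : ∀ n, formSum P y A B n * T n =
      ∑ φ, c φ * ∏ a, pairLocal (U a) (V a) (φ a) n := by
    intro n
    rw [formSum, hT, sum_fun_prod]
    refine sum_congr rfl fun φ _ => ?_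
    have : ∏ a, pairLocal (U a) (V a) (φ a) n =
        (∏ a : P, (match (φ a).1 with | none => 1 | some i => dvdLocal a (A * n + B i))) *
          ∏ a, (if (φ a).2 then V a n else 1) := by
      rw [← prod_mul_distrib]
      refine prod_congr rfl fun a _ => ?_
      rcases hφ : φ a with ⟨_ | i, _ | _⟩ <;> simp [pairLocal, hU]
    rw [this, hc]; ring
  have hUper : ∀ a i, Function.Periodic (U a i) ((a : ℕ) ^ 2) := fun a i =>
    periodic_affine (periodic_dvdLocal a) A (B i)
  have hVper : ∀ a, Function.Periodic (V a) ((a : ℕ) ^ 2) := fun a => by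
    intro n
    simp only [hV]
    split_ifs
    · exact periodic_affine (periodic_exactLocal a) A B' n
    · rfl
  have hU1 : ∀ a i n, |U a i n| ≤ 1 := fun a i n => abs_dvdLocal_le (hp2 a) _
  have hV1 : ∀ a n, |V a n| ≤ 1 := fun a n => by
    simp only [hV]; split_ifs
    · exact abs_exactLocal_le (hp2 a) _
    · simp
  have hAp : ∀ a : P, A.Coprime ((a : ℕ) ^ 2) := fun a => (hA a a.2).pow_right 2
  have hpos2 : ∀ a : P, 0 < (a : ℕ) ^ 2 := fun a => by have := hp2 a; positivity
  have hlocal : ∀ a : P, ∑ i, ∑ j, |avg ((a : ℕ) ^ 2)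
      (fun n => pairLocal (U a) (V a) i n * pairLocal (U a) (V a) j n)| ≤
      1 + Fintype.card κ * (1 / (((a : ℕ) : ℝ) - 1)) + (if (a : ℕ) ∈ Q then exactRatio a else 0) +
        12 * ((Fintype.card κ : ℝ) + 1) ^ 2 * (1 / (((a : ℕ) : ℝ) - 1) ^ 2) := by
    intro a
    have hpdvd : ∀ b : ℕ, avg ((a : ℕ) ^ 2) (fun n => if (a : ℕ) ∣ A * n + b then (1 : ℝ) else 0)
        = 1 / (a : ℕ) := fun b => by
      rw [avg_comp_affine (hpos2 a) (hAp a) b (f := fun m => if (a : ℕ) ∣ m then (1 : ℝ) else 0),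
        avg_dvd (by have := hp2 a; omega)]
      intro m
      have : (a : ℕ) ∣ m + (a : ℕ) ^ 2 ↔ (a : ℕ) ∣ m := Nat.dvd_add_left (dvd_pow_self _ two_ne_zero)
      simp only [this]
    have h2' : (2 : ℝ) ≤ (a : ℕ) := by exact_mod_cast hp2 a
    -- The event for the sifted form includes `a ∈ Q`, since disjointness from the other forms is
    -- assumed only at primes of `Q`.
    refine sum_abs_avg_pairLocal_le (hp2 a) (E := fun i n => (a : ℕ) ∣ A * n + B i)
      (EV := fun n => (a : ℕ) ∈ Q ∧ (a : ℕ) ∣ A * n + B') (hU1 a) ?_ (hV1 a) ?_ ?_ ?_ ?_ ?_ ?_ ?_ ?_ ?_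
    · intro i n hn
      simp only [hU, dvdLocal, if_neg hn]
      rw [abs_of_nonneg (one_div_nonneg.2 (by linarith))]
    · intro n hn
      simp only [hV]
      split_ifs with haQ
      · have hn' : ¬ (a : ℕ) ∣ A * n + B' := fun hx => hn ⟨haQ, hx⟩
        rw [exactLocal, if_neg (fun hx => hn' hx.1), abs_of_nonneg (exactRatio_nonneg (hp2 a))]
        exact exactRatio_le (hp2 a)
      · rw [abs_zero]; exact one_div_nonneg.2 (by linarith)
    · intro i j n hij
      exact hd a a.2 i j hij n
    · rintro i n ⟨h1, h2, h3⟩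
      exact hd' a h2 i n ⟨h1, h3⟩
    · intro i; exact (hpdvd (B i)).le
    · refine (avg_le_avg fun n => ?_).trans (hpdvd B').le
      split_ifs with h1 h2 h2
      · exact le_rfl
      · exact absurd h1.2 h2
      · exact zero_le_one
      · exact le_rfl
    · intro i
      exact (avg_comp_affine (hpos2 a) (hAp a) (B i) (periodic_dvdLocal a)).trans
        (avg_dvdLocal (hp2 a))
    · simp only [hV]
      split_ifs
      · exact (avg_comp_affine (hpos2 a) (hAp a) B' (periodic_exactLocal a)).trans
          (avg_exactLocal (hp2 a))
      · exact avg_const (hpos2 a) 0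
    · intro i
      exact (avg_comp_affine (hpos2 a) (hAp a) (B i)
        ((periodic_dvdLocal a).mul (periodic_dvdLocal a))).trans (avg_dvdLocal_sq (hp2 a))
    · simp only [hV]
      split_ifs
      · exact (avg_comp_affine (hpos2 a) (hAp a) B'
          ((periodic_exactLocal a).mul (periodic_exactLocal a))).trans (avg_exactLocal_sq (hp2 a))
      · simp only [mul_zero]; exact avg_const (hpos2 a) 0
  have hzA : 0 ≤ z ^ sieveExp := Real.rpow_nonneg (by linarith) _
  have hmain := sum_sq_prod_le ((none, false) : Option κ × Bool) (fun a : P => (a : ℕ)) hp2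
    Subtype.val_injective
    (fun a b hab => (Nat.coprime_primes (hP a a.2) (hP b b.2)).2 fun he => hab (Subtype.ext he))
    M hM (fun a => hPM a a.2) (fun a i n => pairLocal (U a) (V a) i n)
    (fun a i n => by
      rcases i with ⟨_ | i, _ | _⟩ <;> simp only [pairLocal, (hVper a) n]
      · simp only [(hUper a i) n]
      · simp only [(hUper a i) n])
    (fun a i n => by
      rcases i with ⟨_ | i, _ | _⟩ <;> simp only [pairLocal, mul_one, one_mul, abs_one, le_refl, hV1, hU1]
      rw [abs_mul]; exact mul_le_one₀ (hU1 _ _ _) (abs_nonneg _) (hV1 _ _))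
    (fun a n => by simp [pairLocal]) c
    (fun φ => by
      simp only [hc, abs_mul]
      refine mul_le_one₀ (hy _) (abs_nonneg _) ?_
      simp only [hzc]; split_ifs <;> simp)
    (Y * z ^ sieveExp)
    (fun φ hφ => by
      simp only [hc] at hφ
      have hφ1 := left_ne_zero_of_mul hφ
      have hφ2 := right_ne_zero_of_mul hφ
      have hφ3 : ∏ a : P, (if (φ a).2 then ((a : ℕ) : ℝ) else 1) ≤ z ^ sieveExp := by
        by_contra hcon
        exact hφ2 (by simp only [hzc, if_neg hcon])
      refine le_trans ?_ (mul_le_mul (hY _ hφ1) hφ3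
        (prod_nonneg fun a _ => by split_ifs <;> positivity) hY0)
      rw [← prod_mul_distrib]
      refine prod_le_prod (fun a _ => by split_ifs <;> positivity) fun a _ => ?_
      have h1 : (1 : ℝ) ≤ (a : ℕ) := by exact_mod_cast (by have := hp2 a; omega : 1 ≤ (a : ℕ))
      rcases hφa : φ a with ⟨_ | i, _ | _⟩ <;> simp
      nlinarith) u v ν huv
  have hX : 0 ≤ ((v : ℝ) - u) / M := by
    have : (u : ℝ) ≤ v := by exact_mod_cast huv
    exact div_nonneg (by linarith) (by positivity)
  have hprodle : ∏ a : P, ∑ i, ∑ j, |avg ((a : ℕ) ^ 2)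
      (fun n => pairLocal (U a) (V a) i n * pairLocal (U a) (V a) j n)| ≤
      Real.exp (Fintype.card κ * ∑ p ∈ P, 1 / (p : ℝ) + ∑ p ∈ Q, 1 / (p : ℝ)
        + 50 * ((Fintype.card κ : ℝ) + 1) ^ 2) :=
    (prod_le_prod (fun a _ => sum_nonneg fun _ _ => sum_nonneg fun _ _ => abs_nonneg _)
      fun a _ => hlocal a).trans (prod_local_le hP hQP _)
  -- On sifted `n` the factor `G²` is `T(n)²`; by positivity the sum may then run over the whole
  -- progression.
  have hsift : G ^ 2 * ∑ n ∈ (Ioc u v).filter (fun n => n ≡ ν [MOD M] ∧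
        ∀ p ∈ Q, ¬ (p ∣ A * n + B' ∧ ¬ p ^ 2 ∣ A * n + B')), formSum P y A B n ^ 2 ≤
      ∑ n ∈ (Ioc u v).filter (fun n => n ≡ ν [MOD M]),
        (∑ φ, c φ * ∏ a, pairLocal (U a) (V a) (φ a) n) ^ 2 := by
    rw [mul_sum]
    calc _ = ∑ n ∈ (Ioc u v).filter (fun n => n ≡ ν [MOD M] ∧
        ∀ p ∈ Q, ¬ (p ∣ A * n + B' ∧ ¬ p ^ 2 ∣ A * n + B')),
          (∑ φ, c φ * ∏ a, pairLocal (U a) (V a) (φ a) n) ^ 2 := by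
          refine sum_congr rfl fun n hn => ?_
          rw [← hprod, hTG n (mem_filter.1 hn).2.2]; ring
      _ ≤ _ := sum_le_sum_of_subset_of_nonneg
          (fun n hn => by
            simp only [mem_filter] at hn ⊢; exact ⟨hn.1, hn.2.1⟩) fun _ _ _ => sq_nonneg _
  have hcard : (Fintype.card (Option κ × Bool) : ℝ) = 2 * ((Fintype.card κ : ℝ) + 1) := by
    simp; ring
  rw [hcard] at hmain
  refine sifted_bound_aux (by positivity) (sum_nonneg fun _ _ => by positivity) hX (by positivity)
    (sum_nonneg fun _ _ => sq_nonneg _) hGlow (hsift.trans (hmain.trans ?_))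
  gcongr

end TwoSquareSieve

/-! ### Sieve weights in diagonal form -/

namespace TwoSquareSieve

open Finset

open scoped Classical

section Tuples

variable {K : ℕ} {P : Finset ℕ}

/-- The tuple of squarefree numbers that a choice function on primes encodes. -/
def tupleOf (τ : P → Option (Fin K)) (i : Fin K) : ℕ :=
  ∏ a : P, if τ a = some i then (a : ℕ) else 1

theorem dvd_tupleOf_iff (hP : ∀ p ∈ P, p.Prime) (τ : P → Option (Fin K)) (i : Fin K) {p : ℕ}
    (hp : p.Prime) : p ∣ tupleOf τ i ↔ ∃ a : P, (a : ℕ) = p ∧ τ a = some i := by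
  rw [tupleOf, hp.prime.dvd_finsetProd_iff]
  constructor
  · rintro ⟨a, _, ha⟩
    split_ifs at ha with h
    · exact ⟨a, ((Nat.prime_dvd_prime_iff_eq hp (hP a a.2)).1 ha).symm, h⟩
    · exact absurd (Nat.dvd_one.1 ha) hp.one_lt.ne'
  · rintro ⟨a, rfl, ha⟩
    exact ⟨a, mem_univ _, by rw [if_pos ha]⟩

theorem coe_dvd_tupleOf_iff (hP : ∀ p ∈ P, p.Prime) (τ : P → Option (Fin K)) (i : Fin K) (a : P) :
    (a : ℕ) ∣ tupleOf τ i ↔ τ a = some i := by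
  rw [dvd_tupleOf_iff hP τ i (hP a a.2)]
  exact ⟨fun ⟨b, hb, h⟩ => Subtype.ext hb ▸ h, fun h => ⟨a, rfl, h⟩⟩

theorem tupleOf_injective (hP : ∀ p ∈ P, p.Prime) :
    Function.Injective (tupleOf : (P → Option (Fin K)) → Fin K → ℕ) := by
  intro τ τ' h
  funext a
  have key : ∀ i, τ a = some i ↔ τ' a = some i := fun i => by
    rw [← coe_dvd_tupleOf_iff hP, ← coe_dvd_tupleOf_iff hP, h]
  exact Option.ext key

theorem tupleOf_pos (hP : ∀ p ∈ P, p.Prime) (τ : P → Option (Fin K)) (i : Fin K) :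
    0 < tupleOf τ i := by
  refine prod_pos fun a _ => ?_
  split_ifs
  · exact (hP a a.2).pos
  · exact one_pos

theorem prod_tupleOf (τ : P → Option (Fin K)) :
    ∏ i, tupleOf τ i = ∏ a : P, if τ a = none then 1 else (a : ℕ) := by
  simp only [tupleOf]
  rw [prod_comm]
  refine prod_congr rfl fun a _ => ?_
  rcases h : τ a with _ | j
  · simp
  · simp [prod_ite_eq]

theorem squarefree_prod_tupleOf (hP : ∀ p ∈ P, p.Prime) (τ : P → Option (Fin K)) :
    Squarefree (∏ i, tupleOf τ i) := by
  rw [prod_tupleOf]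
  refine Finset.squarefree_prod_of_pairwise_isCoprime ?_ ?_
  · intro a _ b _ hab
    have := (Nat.coprime_primes (hP a a.2) (hP b b.2)).2 fun he => hab (Subtype.ext he)
    have h : Nat.Coprime (if τ a = none then 1 else (a : ℕ)) (if τ b = none then 1 else (b : ℕ)) := by
      split_ifs <;> first | exact this | simp
    exact Nat.coprime_iff_isRelPrime.1 h
  · intro a _
    split_ifs
    · exact squarefree_one
    · exact (hP a a.2).squarefree

theorem prod_primeFactors_tupleOf (hP : ∀ p ∈ P, p.Prime) (τ : P → Option (Fin K)) (i : Fin K)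
    (g : ℕ → ℝ) :
    ∏ p ∈ (tupleOf τ i).primeFactors, g p = ∏ a : P, if τ a = some i then g a else 1 := by
  rw [← prod_filter]
  have : (tupleOf τ i).primeFactors = (univ.filter (fun a : P => τ a = some i)).image
      (fun a : P => (a : ℕ)) := by
    ext p
    simp only [Nat.mem_primeFactors, mem_image, mem_filter, mem_univ, true_and]
    constructor
    · rintro ⟨hp, hd, _⟩
      obtain ⟨a, ha, h⟩ := (dvd_tupleOf_iff hP τ i hp).1 hd
      exact ⟨a, h, ha⟩
    · rintro ⟨a, h, rfl⟩
      exact ⟨hP a a.2, (coe_dvd_tupleOf_iff hP τ i a).2 h, (tupleOf_pos hP τ i).ne'⟩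
  rw [this, prod_image (fun a _ b _ h => Subtype.ext h)]

theorem isSieveTuple_tupleOf {Q : ℕ} (hP : ∀ p ∈ P, p.Prime ∧ p % 4 = 3 ∧ ¬ p ∣ Q)
    (τ : P → Option (Fin K)) : IsSieveTuple Q (tupleOf τ) := by
  have hP' : ∀ p ∈ P, p.Prime := fun p hp => (hP p hp).1
  refine ⟨fun i => ⟨tupleOf_pos hP' τ i, ?_, fun p hp hd => ?_⟩, fun i j hij => ?_⟩
  · refine Nat.Coprime.prod_left fun a _ => ?_
    split_ifs
    · exact (Nat.Prime.coprime_iff_not_dvd (hP' a a.2)).2 (hP a a.2).2.2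
    · exact Nat.coprime_one_left _
  · obtain ⟨a, rfl, _⟩ := (dvd_tupleOf_iff hP' τ i hp).1 hd
    exact (hP a a.2).2.1
  · refine Nat.Coprime.prod_left fun a _ => Nat.Coprime.prod_right fun b _ => ?_
    split_ifs with h1 h2
    · refine (Nat.coprime_primes (hP' a a.2) (hP' b b.2)).2 fun he => ?_
      have := Subtype.ext he
      subst this
      rw [h1] at h2
      exact hij (Option.some.inj h2)
    all_goals simp

/-- By pairwise coprimality each prime divides at most one entry; sending it to that entry, or to
`none`, recovers the tuple because the entries are squarefree. -/
theorem exists_tupleOf_eq {Q N : ℕ}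
    (hPN : ∀ p : ℕ, p.Prime → p % 4 = 3 → ¬ p ∣ Q → p ≤ N → p ∈ P) (hP : ∀ p ∈ P, p.Prime)
    {r : Fin K → ℕ} (hr : IsSieveTuple Q r) (hsq : Squarefree (∏ i, r i)) (hN : ∀ i, r i ≤ N) :
    ∃ τ : P → Option (Fin K), tupleOf τ = r := by
  have huniq : ∀ (a : P) (i j : Fin K), (a : ℕ) ∣ r i → (a : ℕ) ∣ r j → i = j := by
    intro a i j hi hj
    by_contra hij
    exact Nat.Prime.not_coprime_iff_dvd.2 ⟨a, hP a a.2, hi, hj⟩ (hr.2 i j hij)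
  set τ : P → Option (Fin K) := fun a => if h : ∃ i, (a : ℕ) ∣ r i then some h.choose else none
    with hτ
  have hτi : ∀ a i, τ a = some i ↔ (a : ℕ) ∣ r i := by
    intro a i
    simp only [hτ]
    constructor
    · intro h
      split_ifs at h with h1
      rw [← Option.some.inj h]
      exact h1.choose_spec
    · intro h
      have h1 : ∃ i, (a : ℕ) ∣ r i := ⟨i, h⟩
      rw [dif_pos h1, huniq a _ i h1.choose_spec h]
  refine ⟨τ, ?_⟩
  funext i
  have hsqi : Squarefree (r i) := hsq.squarefree_of_dvd (dvd_prod_of_mem r (mem_univ i))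
  rw [← Nat.prod_primeFactors_of_squarefree hsqi, tupleOf]
  simp_rw [hτi]
  rw [← prod_filter]
  have : (r i).primeFactors = (univ.filter (fun a : P => (a : ℕ) ∣ r i)).image
      (fun a : P => (a : ℕ)) := by
    ext p
    simp only [Nat.mem_primeFactors, mem_image, mem_filter, mem_univ, true_and]
    constructor
    · rintro ⟨hp, hd, _⟩
      have hpQ : ¬ p ∣ Q := fun hpQ =>
        Nat.Prime.not_coprime_iff_dvd.2 ⟨p, hp, hd, hpQ⟩ (hr.1 i).2.1
      exact ⟨⟨p, hPN p hp ((hr.1 i).2.2 p hp hd) hpQ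
        ((Nat.le_of_dvd (hr.1 i).1 hd).trans (hN i))⟩, hd, rfl⟩
    · rintro ⟨a, h, rfl⟩
      exact ⟨hP a a.2, h, (hr.1 i).1.ne'⟩
  rw [this, prod_image (fun a _ b _ h => Subtype.ext h)]

end Tuples

theorem IsSieveTuple.of_dvd {K Q : ℕ} {d r : Fin K → ℕ} (hr : IsSieveTuple Q r)
    (h : ∀ i, d i ∣ r i) : IsSieveTuple Q d :=
  ⟨fun i => ⟨Nat.pos_of_dvd_of_pos (h i) (hr.1 i).1, (hr.1 i).2.1.coprime_dvd_left (h i),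
    fun p hp hd => (hr.1 i).2.2 p hp (hd.trans (h i))⟩,
    fun i j hij => (hr.2 i j hij).coprime_dvd_left (h i) |>.coprime_dvd_right (h j)⟩

/-- The `d` involved are the divisors of the squarefree number `gcd(l, r)`, over which `μ(d) d` sums
to an Euler product. -/
theorem sum_moebius_mul_gcd {l r : ℕ} (hl : 0 < l) (hr : Squarefree r) :
    ∑ d ∈ l.divisors.filter (fun d => d ∣ r), ((ArithmeticFunction.moebius d : ℤ) : ℝ) * (d : ℝ) =
      ∏ p ∈ r.primeFactors, (if p ∣ l then 1 - (p : ℝ) else 1) := by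
  have h1 : l.divisors.filter (fun d => d ∣ r) = (Nat.gcd l r).divisors := by
    ext d
    simp only [mem_filter, Nat.mem_divisors, Nat.dvd_gcd_iff]
    have : Nat.gcd l r ≠ 0 := (Nat.gcd_pos_of_pos_left r hl).ne'
    have : l ≠ 0 := hl.ne'
    tauto
  have hsq : Squarefree (Nat.gcd l r) := hr.squarefree_of_dvd (Nat.gcd_dvd_right l r)
  have h2 := ArithmeticFunction.IsMultiplicative.prodPrimeFactors_one_sub_of_squarefree
    (R := ℝ) ((ArithmeticFunction.id : ArithmeticFunction ℕ) : ArithmeticFunction ℝ)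
    ArithmeticFunction.isMultiplicative_id.natCast hsq
  simp only [ArithmeticFunction.natCoe_apply, ArithmeticFunction.id_apply] at h2
  rw [h1, ← h2, ← prod_filter]
  refine prod_congr ?_ fun _ _ => rfl
  ext p
  simp only [Nat.mem_primeFactors, mem_filter, Nat.dvd_gcd_iff]
  have : Nat.gcd l r ≠ 0 := (Nat.gcd_pos_of_pos_left r hl).ne'
  have : r ≠ 0 := hr.ne_zero
  tauto

theorem totient_prod_tupleOf {K : ℕ} {P : Finset ℕ} (hP : ∀ p ∈ P, p.Prime)
    (τ : P → Option (Fin K)) :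
    (Nat.totient (∏ i, tupleOf τ i) : ℝ) = ∏ a : P, if τ a = none then 1 else ((a : ℕ) : ℝ) - 1 := by
  rw [prod_tupleOf]
  have : ∀ s : Finset P, (Nat.totient (∏ a ∈ s, if τ a = none then 1 else (a : ℕ)) : ℝ) =
      ∏ a ∈ s, if τ a = none then 1 else ((a : ℕ) : ℝ) - 1 := by
    intro s
    induction s using Finset.induction_on with
    | empty => simp
    | insert a s ha ih =>
      rw [prod_insert ha, prod_insert ha, Nat.totient_mul, Nat.cast_mul, ih]
      · congr 1
        split_ifs
        · simp
        · rw [Nat.totient_prime (hP a a.2), Nat.cast_sub (hP a a.2).one_le, Nat.cast_one]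
      · refine Nat.Coprime.prod_right fun b hb => ?_
        have := (Nat.coprime_primes (hP a a.2) (hP b b.2)).2 fun he =>
          ha ((Subtype.ext he : a = b) ▸ hb)
        split_ifs <;> first | exact this | simp
  exact this univ

theorem gFun_nonneg {t : ℝ} (ht : 0 ≤ t) : 0 ≤ gFun t := by
  unfold gFun; split_ifs <;> positivity

theorem gFun_le_one {t : ℝ} (ht : 0 ≤ t) : gFun t ≤ 1 := by
  unfold gFun
  split_ifs
  · rw [div_le_one (by linarith)]; linarith
  · exact zero_le_one

theorem FFun_eq_zero_of_lt {K : ℕ} {R : ℝ} (hR : 1 < R) {r : Fin K → ℕ} {i : Fin K}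
    (h : R < r i) : FFun (fun i => Real.log (r i) / Real.log R) = 0 := by
  rw [FFun]
  refine prod_eq_zero (mem_univ i) ?_
  rw [gFun, if_neg]
  have hl : 0 < Real.log R := Real.log_pos hR
  have h1 : 1 < Real.log (r i) / Real.log R := by
    rw [lt_div_iff₀ hl, one_mul]
    exact Real.log_lt_log (by linarith) h
  have hK : (1 : ℝ) ≤ K := by exact_mod_cast (Nat.succ_le_of_lt (i.pos))
  nlinarith

/-- The sum that is squared in the sieve weights, in diagonal form. -/
theorem sum_sieveCoeff_eq {K Q : ℕ} {R : ℝ} (hR : 1 < R) {P : Finset ℕ}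
    (hP : ∀ p, p ∈ P ↔ p.Prime ∧ p % 4 = 3 ∧ ¬ p ∣ Q ∧ p ≤ ⌊R⌋₊) {l : Fin K → ℕ}
    (hl : ∀ i, 0 < l i) :
    ∑ d ∈ (Fintype.piFinset (fun i : Fin K => (l i).divisors)).filter (IsSieveTuple Q),
      sieveCoeff Q R d =
    ∑ τ : P → Option (Fin K), FFun (fun i => Real.log (tupleOf τ i) / Real.log R) *
      ∏ a : P, (match τ a with | none => 1 | some i => dvdLocal a (l i)) := by
  have hPp : ∀ p ∈ P, p.Prime := fun p hp => ((hP p).1 hp).1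
  have hPQ : ∀ p ∈ P, p.Prime ∧ p % 4 = 3 ∧ ¬ p ∣ Q := fun p hp =>
    ⟨((hP p).1 hp).1, ((hP p).1 hp).2.1, ((hP p).1 hp).2.2.1⟩
  set m : (Fin K → ℕ) → ℝ := fun r =>
    ((ArithmeticFunction.moebius (∏ i, r i) : ℤ) : ℝ) ^ 2 / (Nat.totient (∏ i, r i) : ℝ) *
      FFun (fun i => Real.log (r i) / Real.log R) with hm
  set box := Fintype.piFinset (fun _ : Fin K => Finset.Icc 1 ⌊R⌋₊) with hbox
  set D := (Fintype.piFinset (fun i : Fin K => (l i).divisors)).filter (IsSieveTuple Q) with hD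
  -- After the interchange the sum over `d` splits over coordinates: the condition `d ∈ 𝓓_K` is
  -- automatic, since entrywise divisors of a sieve tuple form a sieve tuple.
  have step1 : ∑ d ∈ D, sieveCoeff Q R d = ∑ r ∈ box.filter (IsSieveTuple Q),
      m r * ∏ i, ∑ d ∈ (l i).divisors.filter (fun d => d ∣ r i),
        ((ArithmeticFunction.moebius d : ℤ) : ℝ) * (d : ℝ) := by
    have e1 : ∀ d, sieveCoeff Q R d = ∑ r ∈ box.filter (IsSieveTuple Q),
        (if ∀ i, d i ∣ r i then
          m r * ∏ i, ((ArithmeticFunction.moebius (d i) : ℤ) : ℝ) * (d i : ℝ) else 0) := by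
      intro d
      rw [sieveCoeff, mul_sum, ← filter_filter, sum_filter]
      refine sum_congr rfl fun r _ => ?_
      split_ifs
      · rw [mul_comm]
      · rfl
    simp_rw [e1]
    rw [sum_comm]
    refine sum_congr rfl fun r hr => ?_
    rw [← sum_filter, ← mul_sum, prod_univ_sum]
    congr 1
    refine sum_congr ?_ fun _ _ => rfl
    ext d
    simp only [hD, mem_filter, Fintype.mem_piFinset]
    constructor
    · rintro ⟨⟨h1, h2⟩, h3⟩ i
      exact ⟨h1 i, h3 i⟩
    · intro h
      exact ⟨⟨fun i => (h i).1, (mem_filter.1 hr).2.of_dvd fun i => (h i).2⟩, fun i => (h i).2⟩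
  rw [step1]
  set f : (Fin K → ℕ) → ℝ := fun r => m r * ∏ i, ∑ d ∈ (l i).divisors.filter (fun d => d ∣ r i),
        ((ArithmeticFunction.moebius d : ℤ) : ℝ) * (d : ℝ) with hf
  have step2 : ∀ τ : P → Option (Fin K), f (tupleOf τ) =
      FFun (fun i => Real.log (tupleOf τ i) / Real.log R) *
      ∏ a : P, (match τ a with | none => 1 | some i => dvdLocal a (l i)) := by
    intro τ
    have hsq := squarefree_prod_tupleOf hPp τ
    have hmu : ((ArithmeticFunction.moebius (∏ i, tupleOf τ i) : ℤ) : ℝ) ^ 2 = 1 := by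
      exact_mod_cast ArithmeticFunction.moebius_sq_eq_one_of_squarefree hsq
    simp only [hf, hm]
    rw [hmu, totient_prod_tupleOf hPp τ]
    have e1 : ∀ i, ∑ d ∈ (l i).divisors.filter (fun d => d ∣ tupleOf τ i),
        ((ArithmeticFunction.moebius d : ℤ) : ℝ) * (d : ℝ) =
        ∏ a : P, if τ a = some i then (if (a : ℕ) ∣ l i then 1 - ((a : ℕ) : ℝ) else 1) else 1 := by
      intro i
      rw [sum_moebius_mul_gcd (hl i) (hsq.squarefree_of_dvd (dvd_prod_of_mem _ (mem_univ i)))]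
      exact prod_primeFactors_tupleOf hPp τ i (fun p => if p ∣ l i then 1 - (p : ℝ) else 1)
    simp_rw [e1]
    rw [prod_comm]
    -- A prime of `r_i` carries `1 / (p - 1)` from the totient, times `1 - p` if `p ∣ ℓ_i` and 1
    -- otherwise, which is `dvdLocal`.
    have e2 : (∏ a : P, ∏ i, if τ a = some i then
          (if (a : ℕ) ∣ l i then 1 - ((a : ℕ) : ℝ) else 1) else 1) *
        (1 / ∏ a : P, if τ a = none then 1 else ((a : ℕ) : ℝ) - 1) =
        ∏ a : P, (match τ a with | none => 1 | some i => dvdLocal a (l i)) := by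
      rw [one_div, ← prod_inv_distrib, ← prod_mul_distrib]
      refine prod_congr rfl fun a _ => ?_
      have h2 : (2 : ℝ) ≤ (a : ℕ) := by exact_mod_cast (hPp a a.2).two_le
      have h3 : ((a : ℕ) : ℝ) - 1 ≠ 0 := by linarith
      rcases h : τ a with _ | j
      · simp
      · simp only [Option.some.injEq, prod_ite_eq, mem_univ, if_true, reduceCtorEq, if_false,
          dvdLocal]
        split_ifs
        · field_simp; ring
        · simp
    rw [← e2]; ring
  simp_rw [← step2]
  rw [← sum_image (f := f) (s := (univ : Finset (P → Option (Fin K))))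
    (g := fun τ => (tupleOf τ : Fin K → ℕ)) (fun τ _ τ' _ h => tupleOf_injective hPp h)]
  -- The two index sets differ harmlessly: nonsquarefree `r` are killed by `μ²`, and encoded tuples
  -- with some entry above `R` by `F`.
  have hsub : (box.filter (IsSieveTuple Q)).filter (fun r => Squarefree (∏ i, r i)) ⊆
      univ.image (fun τ : P → Option (Fin K) => (tupleOf τ : Fin K → ℕ)) := by
    intro r hr
    simp only [mem_filter, hbox, Fintype.mem_piFinset, mem_Icc] at hr
    obtain ⟨τ, hτ⟩ := exists_tupleOf_eq (P := P) (Q := Q) (N := ⌊R⌋₊)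
      (fun p h1 h2 h3 h4 => (hP p).2 ⟨h1, h2, h3, h4⟩) hPp hr.1.2 hr.2 (fun i => (hr.1.1 i).2)
    exact mem_image.2 ⟨τ, mem_univ _, hτ⟩
  rw [← sum_subset hsub]
  · symm
    refine sum_subset (filter_subset _ _) fun r hr hr' => ?_
    have : ¬ Squarefree (∏ i, r i) := fun h => hr' (mem_filter.2 ⟨hr, h⟩)
    change m r * _ = 0
    simp only [hm]
    rw [ArithmeticFunction.moebius_eq_zero_of_not_squarefree this]
    simp
  · intro r hr hr'
    obtain ⟨τ, _, rfl⟩ := mem_image.1 hr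
    simp only [mem_filter, hbox, Fintype.mem_piFinset, mem_Icc, not_and] at hr'
    have h1 : ¬ ∀ i, 1 ≤ tupleOf τ i ∧ tupleOf τ i ≤ ⌊R⌋₊ := fun h =>
      hr' ⟨h, isSieveTuple_tupleOf hPQ τ⟩ (squarefree_prod_tupleOf hPp τ)
    push Not at h1
    obtain ⟨i, hi⟩ := h1
    have h2 := hi (tupleOf_pos hPp τ i)
    have h3 : R < tupleOf τ i := (Nat.floor_lt (by linarith)).1 h2
    simp only [hf, hm]
    rw [FFun_eq_zero_of_lt hR h3]; ring

theorem abs_FFun_tupleOf_le {K : ℕ} {P : Finset ℕ} {R : ℝ} (hR : 1 < R)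
    (τ : P → Option (Fin K)) : |FFun (fun i => Real.log (tupleOf τ i) / Real.log R)| ≤ 1 := by
  have hl : 0 < Real.log R := Real.log_pos hR
  rw [FFun, abs_prod]
  refine prod_le_one (fun _ _ => abs_nonneg _) fun i _ => ?_
  have : 0 ≤ (K : ℝ) * (Real.log (tupleOf τ i) / Real.log R) := by
    have := Real.log_natCast_nonneg (tupleOf τ i)
    positivity
  rw [abs_of_nonneg (gFun_nonneg this)]
  exact gFun_le_one this

/-- The scaling `g(K t_i)` forces each entry to be at most `R^(1/K)`, so the product of the entries
is at most `R`. -/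
theorem prod_le_of_FFun_ne_zero {K : ℕ} {P : Finset ℕ} (hP : ∀ p ∈ P, p.Prime) {R : ℝ} (hR : 1 < R)
    (τ : P → Option (Fin K)) (h : FFun (fun i => Real.log (tupleOf τ i) / Real.log R) ≠ 0) :
    ∏ a : P, (if τ a = none then 1 else ((a : ℕ) : ℝ)) ≤ R := by
  have hl : 0 < Real.log R := Real.log_pos hR
  have h1 : ∀ i, (K : ℝ) * Real.log (tupleOf τ i) ≤ Real.log R := by
    intro i
    by_contra hcon
    push Not at hcon
    apply h
    rw [FFun]
    refine prod_eq_zero (mem_univ i) ?_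
    rw [gFun, if_neg]
    rw [not_le, ← mul_div_assoc, lt_div_iff₀ hl, one_mul]
    exact hcon
  have h2 : ∏ a : P, (if τ a = none then 1 else ((a : ℕ) : ℝ)) = ∏ i, (tupleOf τ i : ℝ) := by
    have := prod_tupleOf τ
    rw [← Nat.cast_prod, this, Nat.cast_prod]
    exact prod_congr rfl fun a _ => by split_ifs <;> simp
  have hpos : ∀ i, (0 : ℝ) < tupleOf τ i := fun i => by exact_mod_cast tupleOf_pos hP τ i
  rw [h2]
  rcases Nat.eq_zero_or_pos K with rfl | hK
  · simpa using hR.le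
  rw [← Real.log_le_log_iff (prod_pos fun i _ => hpos i) (by linarith),
    Real.log_prod (fun i _ => (hpos i).ne')]
  have hK' : (0 : ℝ) < K := by exact_mod_cast hK
  calc ∑ i, Real.log (tupleOf τ i) ≤ ∑ i : Fin K, Real.log R / K :=
        sum_le_sum fun i _ => by rw [le_div_iff₀ hK', mul_comm]; exact h1 i
    _ = Real.log R := by simp; field_simp

/-! ### The linear forms, and a uniform bound for `S6` -/

theorem leastRep_spec {q : ℕ} (hq : Odd q) (a : ZMod q) :
    0 < leastRep q a ∧ leastRep q a % 4 = 1 ∧ leastRep q a ≤ 4 * q := by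
  have hq0 : 0 < q := hq.pos
  have : NeZero q := ⟨hq0.ne'⟩
  have hco : q.Coprime 4 := by
    have : q.Coprime (2 ^ 2) := (Nat.coprime_two_right.2 hq).pow_right 2
    simpa using this
  set m := Nat.chineseRemainder hco a.val 1 with hm
  have hm1 : (m : ℕ) % 4 = 1 := m.2.2
  have hmem : (m : ℕ) ∈ {m : ℕ | 0 < m ∧ (m : ZMod q) = a ∧ m % 4 = 1} := by
    refine ⟨by omega, ?_, hm1⟩
    have := (ZMod.natCast_eq_natCast_iff _ _ _).2 m.2.1
    rw [this, ZMod.natCast_val, ZMod.cast_id]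
  have h1 := Nat.sInf_mem ⟨_, hmem⟩
  have h2 : leastRep q a ≤ m := Nat.sInf_le hmem
  have h3 : (m : ℕ) < q * 4 := Nat.chineseRemainder_lt_mul hco _ _ hq0.ne' (by norm_num)
  exact ⟨h1.1, h1.2.2, by omega⟩

theorem offset_spec {K q N : ℕ} (hq : Odd q) (α₁ α₂ : ZMod q) (i : Fin K) :
    0 < offset q N α₁ α₂ i ∧ offset q N α₁ α₂ i % 4 = 1 ∧ offset q N α₁ α₂ i ≤ 8 * q := by
  have h1 := leastRep_spec hq α₁
  have h2 := leastRep_spec hq α₂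
  unfold offset
  split_ifs <;> omega

theorem mem_shiftTuples {K q N : ℕ} {η x : ℝ} {b : Fin K → ℕ} (hb : b ∈ shiftTuples K q N η x) :
    IsShiftTuple q N η x b ∧ ∀ i, 3 ≤ b i ∧ b i ≤ max 3 ⌊η / q * Real.sqrt (Real.log x)⌋₊ := by
  simp only [shiftTuples, mem_filter, Fintype.mem_piFinset, mem_Icc] at hb
  exact ⟨hb.2, hb.1⟩

theorem dvd_q3_iff {q p : ℕ} (hq : q ≠ 0) (hp : p.Prime) (h3 : p % 4 = 3) : p ∣ q3 q ↔ p ∣ q := by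
  rw [q3, hp.prime.dvd_finsetProd_iff]
  constructor
  · rintro ⟨r, hr, hpr⟩
    exact hpr.trans (Nat.dvd_of_mem_primeFactors (mem_filter.1 hr).1)
  · intro h
    exact ⟨p, mem_filter.2 ⟨Nat.mem_primeFactors.2 ⟨hp, h, hq⟩, h3⟩, dvd_rfl⟩

theorem dvd_W_iff {q p : ℕ} {η x : ℝ} (hp : p.Prime) (h3 : p % 4 = 3) :
    p ∣ W q η x ↔ p ≤ ⌊D0 η x⌋₊ ∧ ¬ p ∣ q := by
  rw [W, hp.prime.dvd_finsetProd_iff]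
  constructor
  · rintro ⟨r, hr, hpr⟩
    simp only [mem_filter, mem_range] at hr
    have := (Nat.prime_dvd_prime_iff_eq hp hr.2.1).1 hpr
    subst this
    exact ⟨by omega, hr.2.2.2⟩
  · rintro ⟨h1, h2⟩
    exact ⟨p, mem_filter.2 ⟨mem_range.2 (by omega), hp, h3, h2⟩, dvd_rfl⟩

theorem mod_four_of_dvd_q3_mul_W {q p : ℕ} {η x : ℝ} (hp : p.Prime) (h : p ∣ q3 q * W q η x) :
    p % 4 = 3 := by
  rcases (hp.dvd_mul).1 h with h | h
  · rw [q3, hp.prime.dvd_finsetProd_iff] at h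
    obtain ⟨r, hr, hpr⟩ := h
    rw [(Nat.prime_dvd_prime_iff_eq hp (Nat.prime_of_mem_primeFactors (mem_filter.1 hr).1)).1 hpr]
    exact (mem_filter.1 hr).2
  · rw [W, hp.prime.dvd_finsetProd_iff] at h
    obtain ⟨r, hr, hpr⟩ := h
    simp only [mem_filter, mem_range] at hr
    rw [(Nat.prime_dvd_prime_iff_eq hp hr.2.1).1 hpr]
    exact hr.2.2.1

/-- For `q ≤ D₀` each small prime 3 mod 4 divides `q`, hence `q₃`, or else divides `W`. So the
primes left to the sieve weights are those above `D₀`. -/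
theorem dvd_q3_mul_W_iff {q p : ℕ} {η x : ℝ} (hq : q ≠ 0) (hqD : q ≤ ⌊D0 η x⌋₊) (hp : p.Prime)
    (h3 : p % 4 = 3) : p ∣ q3 q * W q η x ↔ p ≤ ⌊D0 η x⌋₊ := by
  rw [hp.dvd_mul, dvd_q3_iff hq hp h3, dvd_W_iff hp h3]
  constructor
  · rintro (h | h)
    · exact (Nat.le_of_dvd (Nat.pos_of_ne_zero hq) h).trans hqD
    · exact h.1
  · intro h
    by_cases hd : p ∣ q
    · exact Or.inl hd
    · exact Or.inr ⟨h, hd⟩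

theorem q3_pos (q : ℕ) : 0 < q3 q :=
  prod_pos fun _ hp => (Nat.prime_of_mem_primeFactors (mem_filter.1 hp).1).pos

theorem W_pos (q : ℕ) (η x : ℝ) : 0 < W q η x :=
  prod_pos fun _ hp => (mem_filter.1 hp).2.1.pos

theorem card_prime_dvd_le_one {s : Finset ℕ} {d : ℕ} {D : ℝ} (hs : ∀ p ∈ s, p.Prime ∧ D < p ∧ p ∣ d)
    (hd : 0 < d) (hD : 0 ≤ D) (hdD : (d : ℝ) ≤ D ^ 2) : s.card ≤ 1 := by
  rw [card_le_one]
  intro a ha b hb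
  by_contra hab
  obtain ⟨ha1, ha2, ha3⟩ := hs a ha
  obtain ⟨hb1, hb2, hb3⟩ := hs b hb
  have h1 := ((Nat.coprime_primes ha1 hb1).2 hab).mul_dvd_of_dvd_of_dvd ha3 hb3
  have h2 : ((a * b : ℕ) : ℝ) ≤ d := by exact_mod_cast Nat.le_of_dvd hd h1
  push_cast at h2
  nlinarith

theorem sum_biUnion_le {ι : Type*} (s : Finset ι) (t : ι → Finset ℕ) {f : ℕ → ℝ}
    (hf : ∀ n, 0 ≤ f n) : ∑ n ∈ s.biUnion t, f n ≤ ∑ i ∈ s, ∑ n ∈ t i, f n := by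
  induction s using Finset.induction_on with
  | empty => simp
  | insert a s ha ih =>
    rw [biUnion_insert, sum_insert ha]
    have h1 := sum_union_inter (s₁ := t a) (s₂ := s.biUnion t) (f := f)
    have h2 : 0 ≤ ∑ n ∈ t a ∩ s.biUnion t, f n := sum_nonneg fun n _ => hf n
    linarith

/-- The offset is at most `8q` and `q b_i ≤ 3q + D₀`; the total `11q + D₀` is what the hypothesis on
`q` is set for. -/
theorem offset_add_lt {K q N : ℕ} {η x : ℝ} (hq : Odd q) {α₁ α₂ : ZMod q} {b : Fin K → ℕ}
    (hb : b ∈ shiftTuples K q N η x) (hqD : 11 * (q : ℝ) < D0 η x) (i : Fin K) :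
    ((offset q N α₁ α₂ i + q * b i : ℕ) : ℝ) < 2 * D0 η x := by
  have h1 : ((offset q N α₁ α₂ i : ℕ) : ℝ) ≤ 8 * q := by
    exact_mod_cast (offset_spec hq α₁ α₂ i).2.2
  have hq0 : (0 : ℝ) < q := by exact_mod_cast hq.pos
  have h2 : (q : ℝ) * b i ≤ 3 * q + D0 η x := by
    have hbi := ((mem_shiftTuples hb).2 i).2
    rcases le_max_iff.1 hbi with h | h
    · have : (b i : ℝ) ≤ 3 := by exact_mod_cast h
      nlinarith
    · have h3 : 0 ≤ η / q * Real.sqrt (Real.log x) := by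
        have e : η / q * Real.sqrt (Real.log x) = D0 η x / q := by rw [D0]; ring
        rw [e]; exact div_nonneg (by linarith) hq0.le
      have h4 : (b i : ℝ) ≤ η / q * Real.sqrt (Real.log x) :=
        (Nat.cast_le.2 h).trans (Nat.floor_le h3)
      have e : (q : ℝ) * (η / q * Real.sqrt (Real.log x)) = D0 η x := by rw [D0]; field_simp
      nlinarith
  push_cast
  linarith

/-- The constant terms all agree mod 4, so their differences are multiples of 4. This factor 4
excludes common prime divisors above `D₀`. -/
theorem offset_add_mod_four {K q N : ℕ} {η x : ℝ} (hq : Odd q) {α₁ α₂ : ZMod q} {b : Fin K → ℕ}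
    (hb : b ∈ shiftTuples K q N η x) (i : Fin K) :
    (offset q N α₁ α₂ i + q * b i) % 4 = (1 + q * 3) % 4 := by
  have h1 := (offset_spec (N := N) hq α₁ α₂ i).2.1
  have h2 := ((mem_shiftTuples hb).1 i).1
  rw [Nat.add_mod, Nat.mul_mod, h1, h2]
  simp [Nat.add_mod, Nat.mul_mod]

/-- Uniform upper bound for the sums `S₆`. -/
theorem S6_le {K q N : ℕ} {η θ₂ ξ x z : ℝ} (hq : Odd q) (α₁ α₂ : ZMod q)
    (hx : 1 ≤ x) (hqD : 11 * (q : ℝ) < D0 η x) (hDz : D0 η x ≤ z) (hzR : z ≤ level θ₂ x)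
    (hzξ : z < x ^ ξ) {b : Fin K → ℕ} (hb : b ∈ shiftTuples K q N η x)
    (hadm : IsAdmissible (form q (offset q N α₁ α₂) b)) {c : ℕ} (hcD : c ≤ ⌊D0 η x⌋₊)
    (hc : ∀ i, (fun n : ℕ => q * n + c) ≠ form q (offset q N α₁ α₂) b i) (ν : ℕ) :
    S6 q (form q (offset q N α₁ α₂) b) η θ₂ ξ x c ν ≤
      Real.exp (60 * ((K : ℝ) + 1) ^ 2 + K) *
        (x / ((q3 q : ℝ) ^ 2 * (W q η x : ℝ) ^ 2) *
          Real.exp (K * (recipSum ⌊level θ₂ x⌋₊ - recipSum ⌊D0 η x⌋₊)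
            - (recipSum ⌊z⌋₊ - recipSum ⌊D0 η x⌋₊)) +
        (level θ₂ x * z ^ sieveExp) ^ 8) := by
  set R := level θ₂ x with hR
  set D := D0 η x with hD
  set w := W q η x with hw
  set B : Fin K → ℕ := fun i => offset q N α₁ α₂ i + q * b i with hB
  have hq1 : (1 : ℝ) ≤ q := by exact_mod_cast hq.pos
  have hq0 : q ≠ 0 := hq.pos.ne'
  have hD11 : 11 < D := by linarith
  have hqD' : q ≤ ⌊D⌋₊ := Nat.le_floor (by linarith)
  have hz2 : 2 ≤ z := by linarith
  have hR1 : 1 < R := by linarith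
  have hform : ∀ i n, form q (offset q N α₁ α₂) b i n = q * n + B i := fun i n => by
    simp only [form, hB]; ring
  have hBlt : ∀ i, (B i : ℝ) < 2 * D := fun i => offset_add_lt hq hb hqD i
  have hBne : ∀ i j, i ≠ j → B i ≠ B j := by
    intro i j hij h
    exact hij (hadm.1 (funext fun n => by rw [hform, hform, h]))
  have hBc : ∀ i, B i ≠ c := by
    intro i h
    exact hc i (funext fun n => by rw [hform, h])
  have hQ0 : 0 < q3 q * w := Nat.mul_pos (q3_pos q) (W_pos q η x)
  set P : Finset ℕ := (primesThree ⌊R⌋₊).filter (fun p => ¬ p ∣ q3 q * w) with hPdef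
  have hPmem : ∀ p, p ∈ P ↔ p.Prime ∧ p % 4 = 3 ∧ ¬ p ∣ q3 q * w ∧ p ≤ ⌊R⌋₊ := fun p => by
    rw [hPdef, mem_filter, mem_primesThree]; tauto
  have hPp : ∀ p ∈ P, p.Prime := fun p hp => ((hPmem p).1 hp).1
  have hPD : ∀ p ∈ P, D < p := by
    intro p hp
    obtain ⟨h1, h2, h3, h4⟩ := (hPmem p).1 hp
    rw [dvd_q3_mul_W_iff hq0 hqD' h1 h2, not_le] at h3
    exact (Nat.floor_lt (by linarith)).1 h3
  -- `T` consists of the primes 3 mod 4 in `(D₀, z]`; `S` drops those at which `ℓ^(c)` and some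
  -- `ℓ_i` can be divisible together.
  set T : Finset ℕ := (primesThree ⌊z⌋₊).filter (fun p => ¬ p ∣ q3 q * w) with hT
  set bad : Fin K → Finset ℕ :=
    fun i => T.filter (fun p => p ∣ ((B i : ℤ) - c).natAbs) with hbad
  set S : Finset ℕ := T.filter (fun p => ∀ i, ¬ p ∣ ((B i : ℤ) - c).natAbs) with hS
  have hTP : T ⊆ P := by
    intro p hp
    rw [hT, mem_filter, mem_primesThree] at hp
    exact (hPmem p).2 ⟨hp.1.2.1, hp.1.2.2, hp.2, hp.1.1.trans (Nat.floor_le_floor hzR)⟩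
  have hSP : S ⊆ P := (filter_subset _ _).trans hTP
  -- A common prime divisor of two forms gives `4p ∣ B j - B i`, impossible because `4p > 4 D₀`
  -- while the difference is below `2 D₀`.
  have hdiff : ∀ p ∈ P, ∀ i j, i ≠ j → ∀ n, ¬ (p ∣ q * n + B i ∧ p ∣ q * n + B j) := by
    have main : ∀ p ∈ P, ∀ i j, B i < B j → ∀ n, ¬ (p ∣ q * n + B i ∧ p ∣ q * n + B j) := by
      rintro p hp i j hij n ⟨h1, h2⟩
      obtain ⟨hp1, hp3, _⟩ := (hPmem p).1 hp
      have h3 : p ∣ B j - B i := by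
        have := Nat.dvd_sub h2 h1
        rwa [Nat.add_sub_add_left] at this
      have h4 : 4 ∣ B j - B i := by
        have e1 := offset_add_mod_four (α₁ := α₁) (α₂ := α₂) hq hb i
        have e2 := offset_add_mod_four (α₁ := α₁) (α₂ := α₂) hq hb j
        exact (Nat.modEq_iff_dvd' hij.le).1 (e1.trans e2.symm)
      have hco : Nat.Coprime 4 p := by
        have : Nat.Coprime 2 p := (Nat.coprime_primes Nat.prime_two hp1).2 (by rintro rfl; omega)
        simpa using this.pow_left 2
      have h5 := Nat.le_of_dvd (by omega) (hco.mul_dvd_of_dvd_of_dvd h4 h3)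
      have h6 : (4 : ℝ) * p ≤ B j := by exact_mod_cast (h5.trans (Nat.sub_le _ _))
      have := hBlt j
      have := hPD p hp
      linarith
    intro p hp i j hij n h
    rcases lt_or_gt_of_ne (hBne i j hij) with hlt | hlt
    · exact main p hp i j hlt n h
    · exact main p hp j i hlt n h.symm
  have hdiff' : ∀ p ∈ S, ∀ i n, ¬ (p ∣ q * n + B i ∧ p ∣ q * n + c) := by
    rintro p hp i n ⟨h1, h2⟩
    refine (mem_filter.1 hp).2 i ?_
    rw [← Int.natCast_dvd]
    have h3 := dvd_sub (Int.natCast_dvd_natCast.2 h1) (Int.natCast_dvd_natCast.2 h2)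
    push_cast at h3
    rwa [add_sub_add_left_eq_sub] at h3
  have hPq : ∀ p ∈ P, q.Coprime p := by
    intro p hp
    obtain ⟨h1, h2, h3, _⟩ := (hPmem p).1 hp
    rw [Nat.coprime_comm, Nat.Prime.coprime_iff_not_dvd h1]
    exact fun h => h3 (((dvd_q3_iff hq0 h1 h2).2 h).mul_right _)
  set M := q3 q ^ 2 * w ^ 2 with hM
  have hM0 : 0 < M := Nat.mul_pos (pow_pos (q3_pos q) 2) (pow_pos (W_pos q η x) 2)
  have hoddM : Nat.Coprime 4 M := by
    have h2 : Nat.Coprime 2 (q3 q * w) := by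
      rw [Nat.Prime.coprime_iff_not_dvd Nat.prime_two]
      intro h
      have := mod_four_of_dvd_q3_mul_W Nat.prime_two h
      omega
    have h3 : Nat.Coprime (2 ^ 2) ((q3 q * w) ^ 2) := h2.pow 2 2
    rw [mul_pow] at h3
    exact h3
  have hPM : ∀ p ∈ P, p.Coprime (4 * M) := by
    intro p hp
    obtain ⟨h1, h2, h3, _⟩ := (hPmem p).1 hp
    refine Nat.Coprime.mul_right ?_ ?_
    · have : Nat.Coprime p 2 := (Nat.coprime_primes h1 Nat.prime_two).2 (by rintro rfl; omega)
      simpa using this.pow_right 2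
    · rw [hM, ← mul_pow]
      exact ((Nat.Prime.coprime_iff_not_dvd h1).2 h3).pow_right 2
  set y : (P → Option (Fin K)) → ℝ := fun τ => FFun (fun i => Real.log (tupleOf τ i) / Real.log R)
    with hy
  have huv : ⌊x⌋₊ ≤ ⌊2 * x⌋₊ := Nat.floor_le_floor (by linarith)
  -- The conditions `n ≡ 1 (mod 4)` and `n ≡ ν (mod M)` form one class mod `4M`. Sifting only up to
  -- `z < x^ξ` enlarges the set of `n`, which suffices for an upper bound.
  have hmain := sum_formSum_sq_sifted_le P S hPp hSP z hz2
    ((filter_subset _ _).trans (filter_subset _ _)) y (abs_FFun_tupleOf_le hR1) R (by linarith)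
    (fun τ hτ => prod_le_of_FFun_ne_zero hPp hR1 τ hτ) q B c hPq hdiff hdiff' (4 * M) (by omega)
    hPM ⌊x⌋₊ ⌊2 * x⌋₊ (Nat.chineseRemainder hoddM 1 ν) huv
  have hS6 : S6 q (form q (offset q N α₁ α₂) b) η θ₂ ξ x c ν ≤
      ∑ n ∈ (Ioc ⌊x⌋₊ ⌊2 * x⌋₊).filter (fun n => n ≡ (Nat.chineseRemainder hoddM 1 ν : ℕ) [MOD 4 * M] ∧
        ∀ p ∈ S, ¬ (p ∣ q * n + c ∧ ¬ p ^ 2 ∣ q * n + c)), formSum P y q B n ^ 2 := by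
    rw [S6]
    have hweight : ∀ n, sieveWeight (q3 q * w) R (form q (offset q N α₁ α₂) b) n =
        formSum P y q B n ^ 2 := by
      intro n
      have hpos : ∀ i, 0 < form q (offset q N α₁ α₂) b i n := fun i => by
        rw [hform]; have := (offset_spec (N := N) hq α₁ α₂ i).1; simp only [hB]; omega
      rw [sieveWeight, sum_sieveCoeff_eq hR1 hPmem hpos, formSum]
      congr 1
      refine sum_congr rfl fun τ _ => ?_
      congr 1
      refine prod_congr rfl fun a _ => ?_
      rcases τ a with _ | i
      · rfl
      · simp only [hform]
    have hweight' : ∀ n, sieveWeight (q3 q * W q η x) (level θ₂ x)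
        (form q (offset q N α₁ α₂) b) n = formSum P y q B n ^ 2 := hweight
    simp only [hweight']
    have hind : ∀ n, (sievedSet ξ x).indicator (fun _ => (1 : ℝ)) (q * n + c) * formSum P y q B n ^ 2 =
        if q * n + c ∈ sievedSet ξ x then formSum P y q B n ^ 2 else 0 := by
      intro n
      rw [Set.indicator_apply]; split_ifs <;> simp
    simp_rw [hind]
    rw [← sum_filter]
    refine sum_le_sum_of_subset_of_nonneg ?_ fun _ _ _ => sq_nonneg _
    intro n hn
    simp only [mem_filter] at hn ⊢
    obtain ⟨⟨h1, h2, h3⟩, h4⟩ := hn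
    refine ⟨h1, Nat.chineseRemainder_modEq_unique hoddM h2 h3, fun p hp => ?_⟩
    have hpT := (mem_filter.1 hp).1
    rw [hT, mem_filter, mem_primesThree] at hpT
    have hpz : (p : ℝ) < x ^ ξ :=
      ((Nat.cast_le.2 hpT.1.1).trans (Nat.floor_le (by linarith))).trans_lt hzξ
    rintro ⟨h5, h6⟩
    rcases h4 p hpT.1.2.1 hpT.1.2.2 hpz with h | h
    · exact h h5
    · exact h6 h
  have hsumP : ∑ p ∈ P, 1 / (p : ℝ) ≤ recipSum ⌊R⌋₊ - recipSum ⌊D⌋₊ := by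
    rw [le_sub_iff_add_le, recipSum, recipSum, ← sum_union]
    · refine sum_le_sum_of_subset_of_nonneg (union_subset (filter_subset _ _) ?_)
        fun _ _ _ => by positivity
      intro p hp
      rw [mem_primesThree] at hp ⊢
      exact ⟨hp.1.trans (Nat.floor_le_floor (hDz.trans hzR)), hp.2⟩
    · rw [disjoint_left]
      intro p hp hp'
      rw [mem_primesThree] at hp'
      exact (hPmem p).1 hp |>.2.2.1 ((dvd_q3_mul_W_iff hq0 hqD' hp'.2.1 hp'.2.2).2 hp'.1)
  have hsumT : recipSum ⌊z⌋₊ - recipSum ⌊D⌋₊ ≤ ∑ p ∈ T, 1 / (p : ℝ) := by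
    rw [sub_le_iff_le_add, recipSum, recipSum]
    calc _ ≤ ∑ p ∈ T ∪ primesThree ⌊D⌋₊, 1 / (p : ℝ) := by
          refine sum_le_sum_of_subset_of_nonneg ?_ fun _ _ _ => by positivity
          intro p hp
          rw [mem_union, hT, mem_filter]
          by_cases h : p ∣ q3 q * w
          · right
            rw [mem_primesThree] at hp ⊢
            exact ⟨(dvd_q3_mul_W_iff hq0 hqD' hp.2.1 hp.2.2).1 h, hp.2⟩
          · exact Or.inl ⟨hp, h⟩
      _ ≤ _ := by
          rw [← sum_union_inter]
          have : 0 ≤ ∑ p ∈ T ∩ primesThree ⌊D⌋₊, 1 / (p : ℝ) := sum_nonneg fun _ _ => by positivity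
          linarith
  -- For each form `0 < |B i - c| ≤ 2 D₀ ≤ D₀²`, so at most one prime above `D₀` is dropped on its
  -- account; in all this costs at most `K` in the exponent.
  have hsumS : ∑ p ∈ T, 1 / (p : ℝ) - K ≤ ∑ p ∈ S, 1 / (p : ℝ) := by
    have h1 : ∑ p ∈ T, 1 / (p : ℝ) ≤ ∑ p ∈ S, 1 / (p : ℝ) + ∑ i, ∑ p ∈ bad i, 1 / (p : ℝ) := by
      have hcov : T ⊆ S ∪ univ.biUnion bad := by
        intro p hp
        rw [mem_union, hS, mem_filter]
        by_cases h : ∀ i, ¬ p ∣ ((B i : ℤ) - c).natAbs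
        · exact Or.inl ⟨hp, h⟩
        · push Not at h
          obtain ⟨i, hi⟩ := h
          exact Or.inr (mem_biUnion.2 ⟨i, mem_univ _, mem_filter.2 ⟨hp, hi⟩⟩)
      calc _ ≤ ∑ p ∈ S ∪ univ.biUnion bad, 1 / (p : ℝ) :=
            sum_le_sum_of_subset_of_nonneg hcov fun _ _ _ => by positivity
        _ ≤ ∑ p ∈ S, 1 / (p : ℝ) + ∑ p ∈ univ.biUnion bad, 1 / (p : ℝ) := by
            rw [← sum_union_inter]
            have : 0 ≤ ∑ p ∈ S ∩ univ.biUnion bad, 1 / (p : ℝ) :=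
              sum_nonneg fun _ _ => by positivity
            linarith
        _ ≤ _ := by
            gcongr
            exact sum_biUnion_le _ _ fun _ => by positivity
    have h2 : ∀ i, ∑ p ∈ bad i, 1 / (p : ℝ) ≤ 1 := by
      intro i
      have hcard : (bad i).card ≤ 1 := by
        refine card_prime_dvd_le_one (d := ((B i : ℤ) - c).natAbs) (D := D) ?_ ?_ (by linarith) ?_
        · intro p hp
          rw [hbad, mem_filter] at hp
          exact ⟨hPp p (hTP hp.1), hPD p (hTP hp.1), hp.2⟩
        · rw [Int.natAbs_pos, sub_ne_zero]
          exact_mod_cast hBc i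
        · have hcD' : (c : ℝ) ≤ D := (Nat.cast_le.2 hcD).trans (Nat.floor_le (by linarith))
          rw [Nat.cast_natAbs, Int.cast_abs]
          push_cast
          have := hBlt i
          have h0 : (0 : ℝ) ≤ B i := by positivity
          have h0' : (0 : ℝ) ≤ c := by positivity
          rw [abs_le]
          constructor <;> nlinarith
      calc ∑ p ∈ bad i, 1 / (p : ℝ) ≤ ∑ p ∈ bad i, 1 := by
            refine sum_le_sum fun p hp => ?_
            have := (hPp p (hTP (mem_filter.1 hp).1)).one_le
            rw [div_le_one (by exact_mod_cast this)]
            exact_mod_cast this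
        _ ≤ 1 := by simpa using hcard
    have h3 := sum_le_sum fun i (_ : i ∈ (univ : Finset (Fin K))) => h2 i
    simp only [sum_const, card_univ, Fintype.card_fin, nsmul_eq_mul, mul_one] at h3
    linarith
  refine hS6.trans (hmain.trans ?_)
  rw [Fintype.card_fin, Real.exp_add (60 * _), mul_assoc]
  refine mul_le_mul_of_nonneg_left ?_ (Real.exp_pos _).le
  rw [mul_add]
  have hK0 : (0 : ℝ) ≤ K := by positivity
  refine add_le_add ?_ ?_
  · have hX : ((⌊2 * x⌋₊ : ℝ) - ⌊x⌋₊) / ((4 * M : ℕ) : ℝ) ≤ x / ((q3 q : ℝ) ^ 2 * (w : ℝ) ^ 2) := by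
      have e1 : (⌊2 * x⌋₊ : ℝ) ≤ 2 * x := Nat.floor_le (by linarith)
      have e2 : x < ⌊x⌋₊ + 1 := Nat.lt_floor_add_one x
      have e3 : ((4 * M : ℕ) : ℝ) = 4 * ((q3 q : ℝ) ^ 2 * (w : ℝ) ^ 2) := by rw [hM]; push_cast; ring
      have e4 : 0 < (q3 q : ℝ) ^ 2 * (w : ℝ) ^ 2 := by
        have : ((M : ℕ) : ℝ) = (q3 q : ℝ) ^ 2 * (w : ℝ) ^ 2 := by rw [hM]; push_cast; ring
        rw [← this]; exact_mod_cast hM0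
      rw [e3, div_le_div_iff₀ (by positivity) e4]
      nlinarith
    have e5 : K * ∑ p ∈ P, 1 / (p : ℝ) - ∑ p ∈ S, 1 / (p : ℝ) ≤
        K + (K * (recipSum ⌊R⌋₊ - recipSum ⌊D⌋₊) - (recipSum ⌊z⌋₊ - recipSum ⌊D⌋₊)) := by
      have := mul_le_mul_of_nonneg_left hsumP hK0
      linarith
    calc _ ≤ x / ((q3 q : ℝ) ^ 2 * (w : ℝ) ^ 2) *
        Real.exp (K + (K * (recipSum ⌊R⌋₊ - recipSum ⌊D⌋₊) - (recipSum ⌊z⌋₊ - recipSum ⌊D⌋₊))) := by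
          gcongr
      _ = _ := by rw [Real.exp_add]; ring
  · refine le_mul_of_one_le_left (by positivity) (Real.one_le_exp hK0)

/-! ### Counting residue classes, shift tuples and shifts -/

/-- The sieve with an empty family of forms, for which the squared sum is 1, and modulus 1. -/
theorem card_sifted_le (S : Finset ℕ) (z : ℝ) (hz : 2 ≤ z) (hS : S ⊆ primesThree ⌊z⌋₊) (A B : ℕ)
    (hA : ∀ p ∈ S, A.Coprime p) (v : ℕ) :
    (((Ioc 0 v).filter (fun n => ∀ p ∈ S, ¬ (p ∣ A * n + B ∧ ¬ p ^ 2 ∣ A * n + B))).card : ℝ) ≤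
      Real.exp 60 * (v * Real.exp (- ∑ p ∈ S, 1 / (p : ℝ)) + (z ^ sieveExp) ^ 8) := by
  have h := sum_formSum_sq_sifted_le (κ := Empty) S S
    (fun p hp => (mem_primesThree.1 (hS hp)).2.1) subset_rfl z hz hS (fun _ => 1) (by simp) 1
    zero_le_one (fun τ _ => le_of_eq (prod_eq_one fun a _ => by
      rw [if_pos]; exact Subsingleton.elim _ _)) A Empty.elim B hA (by simp) (by simp) 1 one_pos
    (by simp) 0 v 0 (Nat.zero_le v)
  have hone : ∀ n, formSum S (fun _ => 1) A Empty.elim n = 1 := by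
    intro n
    rw [formSum, Fintype.sum_unique, one_mul]
    refine prod_eq_one fun a _ => ?_
    split
    · rfl
    · exact Empty.elim ‹_›
  simp only [hone, one_pow, sum_const, nsmul_eq_mul, mul_one, Nat.modEq_one, true_and,
    Fintype.card_empty, Nat.cast_zero, zero_add, sub_zero, Nat.cast_one, div_one, zero_mul,
    zero_sub, one_mul] at h
  convert h using 3

theorem totient_prod_primes {s : Finset ℕ} (hs : ∀ p ∈ s, p.Prime) :
    (Nat.totient (∏ p ∈ s, p) : ℝ) = ∏ p ∈ s, ((p : ℝ) - 1) := by
  induction s using Finset.induction_on with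
  | empty => simp
  | insert a s ha ih =>
    have hap := hs a (mem_insert_self _ _)
    rw [prod_insert ha, prod_insert ha, Nat.totient_mul, Nat.cast_mul,
      ih fun p hp => hs p (mem_insert_of_mem hp), Nat.totient_prime hap, Nat.cast_sub hap.one_le,
      Nat.cast_one]
    refine Nat.Coprime.prod_right fun b hb => ?_
    exact (Nat.coprime_primes hap (hs b (mem_insert_of_mem hb))).2 fun he => ha (he ▸ hb)

/-- The factor `q₃ / φ(q₃)`. -/
theorem exp_sum_le_q3_div_totient (q : ℕ) {s : Finset ℕ}
    (hs : s ⊆ q.primeFactors.filter (fun p => p % 4 = 3)) :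
    Real.exp (∑ p ∈ s, 1 / (p : ℝ)) ≤ (q3 q : ℝ) / (Nat.totient (q3 q) : ℝ) := by
  set t := q.primeFactors.filter (fun p => p % 4 = 3) with ht
  have htp : ∀ p ∈ t, p.Prime := fun p hp => Nat.prime_of_mem_primeFactors (mem_filter.1 hp).1
  have h1 : ∑ p ∈ s, 1 / (p : ℝ) ≤ ∑ p ∈ t, 1 / (p : ℝ) :=
    sum_le_sum_of_subset_of_nonneg hs fun _ _ _ => by positivity
  refine (Real.exp_le_exp.2 h1).trans ?_
  rw [Real.exp_sum, q3, totient_prod_primes htp, Nat.cast_prod, ← prod_div_distrib]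
  refine prod_le_prod (fun _ _ => (Real.exp_pos _).le) fun p hp => ?_
  have h2 : (2 : ℝ) ≤ p := by exact_mod_cast (htp p hp).two_le
  have e1 : 1 - 1 / (p : ℝ) ≤ Real.exp (-(1 / (p : ℝ))) := by
    have := Real.add_one_le_exp (-(1 / (p : ℝ))); linarith
  rw [le_div_iff₀ (by linarith)]
  have e2 : Real.exp (1 / (p : ℝ)) * Real.exp (-(1 / (p : ℝ))) = 1 := by
    rw [← Real.exp_add]; simp
  calc Real.exp (1 / (p : ℝ)) * (p - 1) = Real.exp (1 / (p : ℝ)) * (1 - 1 / (p : ℝ)) * p := by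
        field_simp
    _ ≤ Real.exp (1 / (p : ℝ)) * Real.exp (-(1 / (p : ℝ))) * p := by gcongr
    _ = p := by rw [e2, one_mul]

theorem one_le_q3_div_totient (q : ℕ) : 1 ≤ (q3 q : ℝ) / (Nat.totient (q3 q) : ℝ) := by
  simpa using exp_sum_le_q3_div_totient q (empty_subset _)

theorem recipSum_filter_le (q N : ℕ) (hq : q ≠ 0) :
    recipSum N ≤ ∑ p ∈ (primesThree N).filter (fun p => ¬ p ∣ q), 1 / (p : ℝ) +
      ∑ p ∈ (primesThree N).filter (fun p => p ∣ q), 1 / (p : ℝ) ∧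
    (primesThree N).filter (fun p => p ∣ q) ⊆ q.primeFactors.filter (fun p => p % 4 = 3) := by
  constructor
  · rw [recipSum, add_comm, sum_filter_add_sum_filter_not]
  · intro p hp
    rw [mem_filter, mem_primesThree] at hp
    exact mem_filter.2 ⟨Nat.mem_primeFactors.2 ⟨hp.1.2.1, hp.2, hq⟩, hp.1.2.2⟩

/-- The primes dividing `q` cannot be sifted by; restoring them to the exponent costs at most `∏ (1
- 1/p)⁻¹ = q₃/φ(q₃)`. -/
theorem exp_neg_sum_le (q N : ℕ) (hq : q ≠ 0) :
    Real.exp (- ∑ p ∈ (primesThree N).filter (fun p => ¬ p ∣ q), 1 / (p : ℝ)) ≤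
      (q3 q : ℝ) / (Nat.totient (q3 q) : ℝ) * Real.exp (- recipSum N) := by
  obtain ⟨h1, h2⟩ := recipSum_filter_le q N hq
  calc _ ≤ Real.exp (∑ p ∈ (primesThree N).filter (fun p => p ∣ q), 1 / (p : ℝ) + - recipSum N) :=
        Real.exp_le_exp.2 (by linarith)
    _ ≤ _ := by
        rw [Real.exp_add]
        exact mul_le_mul_of_nonneg_right (exp_sum_le_q3_div_totient q h2) (Real.exp_pos _).le

theorem W_eq_prod {q : ℕ} {η x : ℝ} :
    W q η x = ∏ p ∈ (primesThree ⌊D0 η x⌋₊).filter (fun p => ¬ p ∣ q), p := by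
  rw [W]
  refine prod_congr ?_ fun _ _ => rfl
  ext p
  simp only [mem_filter, mem_range, mem_primesThree, Nat.lt_succ_iff]
  tauto

/-- The two conditions live on the coprime moduli `q₃²` and `W²`: the first leaves at most one
class, the second a proportion `∏_{p ∣ W} (1 - 1/p)`, estimated by `exp_neg_sum_le`. -/
theorem card_residues_le {q : ℕ} (hq : q ≠ 0) (η x : ℝ) (B r : ℕ) :
    (((range (q3 q ^ 2 * W q η x ^ 2)).filter
      (fun ν => ν ≡ r [MOD q3 q ^ 2] ∧ Nat.Coprime (q * ν + B) (W q η x))).card : ℝ) ≤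
      (W q η x : ℝ) ^ 2 * ((q3 q : ℝ) / (Nat.totient (q3 q) : ℝ) *
        Real.exp (- recipSum ⌊D0 η x⌋₊)) := by
  set s := (primesThree ⌊D0 η x⌋₊).filter (fun p => ¬ p ∣ q) with hs
  have hsp : ∀ p ∈ s, p.Prime := fun p hp => (mem_primesThree.1 (mem_filter.1 hp).1).2.1
  have hW : W q η x = ∏ p ∈ s, p := W_eq_prod
  have hW0 := W_pos q η x
  set w := W q η x with hw
  have hco : Nat.Coprime (q3 q ^ 2) (w ^ 2) := by
    refine Nat.Coprime.pow 2 2 ?_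
    rw [hW]
    refine Nat.Coprime.prod_right fun p hp => ?_
    rw [Nat.coprime_comm, Nat.Prime.coprime_iff_not_dvd (hsp p hp),
      dvd_q3_iff hq (hsp p hp) (mem_primesThree.1 (mem_filter.1 hp).1).2.2]
    exact (mem_filter.1 hp).2
  have hcop : ∀ m, Nat.Coprime m w ↔ ∀ p ∈ s, ¬ p ∣ m := by
    intro m
    rw [hW, Nat.coprime_prod_right_iff]
    refine forall₂_congr fun p hp => ?_
    rw [Nat.coprime_comm, Nat.Prime.coprime_iff_not_dvd (hsp p hp)]
  set f : ℕ → ℝ := fun n => if n ≡ r [MOD q3 q ^ 2] then 1 else 0 with hf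
  set g : ℕ → ℝ := fun n => ∏ p ∈ s, if p ∣ q * n + B then 0 else 1 with hg
  have hfper : Function.Periodic f (q3 q ^ 2) := by
    intro n
    have : n + q3 q ^ 2 ≡ r [MOD q3 q ^ 2] ↔ n ≡ r [MOD q3 q ^ 2] := by
      simp [Nat.ModEq]
    simp only [hf, this]
  have hgper' : ∀ p ∈ s, Function.Periodic
      (fun n => if p ∣ q * n + B then (0 : ℝ) else 1) (p ^ 2) := by
    intro p _
    refine periodic_affine (f := fun m => if p ∣ m then (0 : ℝ) else 1) ?_ q B
    intro m
    have : p ∣ m + p ^ 2 ↔ p ∣ m := Nat.dvd_add_left (dvd_pow_self _ two_ne_zero)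
    simp only [this]
  have hw2 : w ^ 2 = ∏ p ∈ s, p ^ 2 := by rw [hW, prod_pow]
  have hgper : Function.Periodic g (w ^ 2) := by
    rw [hw2]; exact periodic_prod s _ _ hgper'
  have hcount : (((range (q3 q ^ 2 * w ^ 2)).filter
      (fun ν => ν ≡ r [MOD q3 q ^ 2] ∧ Nat.Coprime (q * ν + B) w)).card : ℝ) =
      ∑ n ∈ range (q3 q ^ 2 * w ^ 2), f n * g n := by
    rw [card_filter, Nat.cast_sum]
    refine sum_congr rfl fun n _ => ?_
    have hgn : g n = if Nat.Coprime (q * n + B) w then 1 else 0 := by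
      simp only [hg]
      split_ifs with h
      · exact prod_eq_one fun p hp => if_neg ((hcop _).1 h p hp)
      · rw [hcop] at h
        push Not at h
        obtain ⟨p, hp, hd⟩ := h
        exact prod_eq_zero hp (if_pos hd)
    rw [hgn]
    by_cases h1 : n ≡ r [MOD q3 q ^ 2] <;> by_cases h2 : Nat.Coprime (q * n + B) w <;>
      simp [hf, h1, h2]
  rw [hcount, sum_range_mul_of_coprime (pow_pos (q3_pos q) 2) (pow_pos hW0 2) hco hfper hgper]
  have hfsum : ∑ n ∈ range (q3 q ^ 2), f n ≤ 1 := by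
    simp only [hf]
    rw [← sum_filter, sum_const, nsmul_eq_mul, mul_one]
    have : ((range (q3 q ^ 2)).filter (fun n => n ≡ r [MOD q3 q ^ 2])).card ≤ 1 := by
      rw [card_le_one]
      intro a ha b hb
      rw [mem_filter, mem_range] at ha hb
      exact Nat.ModEq.eq_of_lt_of_lt (ha.2.trans hb.2.symm) ha.1 hb.1
    exact_mod_cast this
  have hgsum : ∑ n ∈ range (w ^ 2), g n = (w : ℝ) ^ 2 * ∏ p ∈ s, (1 - 1 / (p : ℝ)) := by
    have h1 := avg_prod s (fun p => p ^ 2) (fun p n => if p ∣ q * n + B then (0 : ℝ) else 1)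
      (fun p hp => pow_pos (hsp p hp).pos 2)
      (fun p hp p' hp' hne => ((Nat.coprime_primes (hsp p hp) (hsp p' hp')).2 hne).pow 2 2) hgper'
    rw [← hw2] at h1
    have h2 : ∀ p ∈ s, avg (p ^ 2) (fun n => if p ∣ q * n + B then (0 : ℝ) else 1) = 1 - 1 / p := by
      intro p hp
      have hpp := hsp p hp
      rw [avg_comp_affine (f := fun m => if p ∣ m then (0 : ℝ) else 1) (pow_pos hpp.pos 2)]
      · have e : (fun m => if p ∣ m then (0 : ℝ) else 1) =
            fun m => (if p ∣ m then (1 : ℝ) else 0) * (-1) + 1 := by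
          funext m; split_ifs <;> ring
        rw [e, avg_add, avg_mul_const, avg_dvd hpp.pos, avg_const (pow_pos hpp.pos 2)]
        ring
      · refine Nat.Coprime.pow_right 2 ?_
        rw [Nat.coprime_comm, Nat.Prime.coprime_iff_not_dvd hpp]
        exact (mem_filter.1 hp).2
      · intro m
        have : p ∣ m + p ^ 2 ↔ p ∣ m := Nat.dvd_add_left (dvd_pow_self _ two_ne_zero)
        simp only [this]
    rw [prod_congr rfl h2, avg] at h1
    have hw' : ((w ^ 2 : ℕ) : ℝ) ≠ 0 := by
      have := pow_pos hW0 2; exact_mod_cast this.ne'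
    rw [div_eq_iff hw'] at h1
    rw [h1]; push_cast; ring
  have hprod : ∏ p ∈ s, (1 - 1 / (p : ℝ)) ≤ Real.exp (- ∑ p ∈ s, 1 / (p : ℝ)) := by
    rw [← sum_neg_distrib, Real.exp_sum]
    refine prod_le_prod (fun p hp => ?_) fun p _ => ?_
    · have : (1 : ℝ) ≤ p := by exact_mod_cast (hsp p hp).one_le
      rw [sub_nonneg, div_le_one (by linarith)]; exact this
    · have := Real.add_one_le_exp (-(1 / (p : ℝ))); linarith
  have hg0 : 0 ≤ ∑ n ∈ range (w ^ 2), g n :=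
    sum_nonneg fun n _ => prod_nonneg fun p _ => by split_ifs <;> norm_num
  refine (mul_le_of_le_one_left hg0 hfsum).trans ?_
  rw [hgsum]
  gcongr
  exact hprod.trans (exp_neg_sum_le q _ hq)

theorem exists_exp_neg_recipSum_le :
    ∃ C : ℝ, 0 < C ∧ ∀ z : ℝ, 2 ≤ z → Real.exp (- recipSum ⌊z⌋₊) ≤ C / Real.sqrt (Real.log z) ∧
      Real.exp (recipSum ⌊z⌋₊) ≤ C * Real.sqrt (Real.log z) := by
  obtain ⟨C, hC, h⟩ := exists_abs_recipSum_sub_le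
  refine ⟨Real.exp C, Real.exp_pos _, fun z hz => ?_⟩
  have hl : 0 < Real.log z := Real.log_pos (by linarith)
  have hs : Real.exp (1 / 2 * Real.log (Real.log z)) = Real.sqrt (Real.log z) := by
    rw [Real.sqrt_eq_rpow, Real.rpow_def_of_pos hl, mul_comm]
  have h1 := abs_le.1 (h z hz)
  rw [← hs, ← Real.exp_sub, ← Real.exp_add]
  exact ⟨Real.exp_le_exp.2 (by linarith [h1.1]), Real.exp_le_exp.2 (by linarith [h1.2])⟩

theorem exists_card_sifted_interval_le :
    ∃ C : ℝ, 0 < C ∧ ∀ q : ℕ, q ≠ 0 → ∀ᶠ D : ℝ in Filter.atTop,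
      (∀ B : ℕ, (((Ioc 0 ⌊D / q⌋₊).filter (fun t => ∀ p ∈ primesThree ⌊D⌋₊, ¬ p ∣ q →
          ¬ p ∣ q * t + B)).card : ℝ) ≤
        C * (D / q) * ((q3 q : ℝ) / (Nat.totient (q3 q) : ℝ)) / Real.sqrt (Real.log D)) ∧
      (∀ B : ℕ, (((Ioc 0 ⌊D⌋₊).filter (fun t => ∀ p ∈ primesThree ⌊D⌋₊,
          ¬ (p ∣ t + B ∧ ¬ p ^ 2 ∣ t + B))).card : ℝ) ≤ C * D / Real.sqrt (Real.log D)) := by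
  obtain ⟨C, hC, hM⟩ := exists_exp_neg_recipSum_le
  have hA1 := one_le_sieveExp
  -- With `z = D^e` the sieve error `(z^sieveExp)^8` is exactly `√D`, negligible against `D / (q
  -- √(log D))`.
  set e := 1 / (16 * sieveExp) with he
  have he0 : 0 < e := by positivity
  have he1 : e ≤ 1 := by rw [he, div_le_one (by positivity)]; linarith
  refine ⟨Real.exp 60 * (C / Real.sqrt e + 1), by positivity, fun q hq => ?_⟩
  have hq1 : (1 : ℝ) ≤ q := by exact_mod_cast Nat.one_le_iff_ne_zero.2 hq
  have hz2 : ∀ᶠ D : ℝ in Filter.atTop, 2 ≤ D ^ e :=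
    (tendsto_rpow_atTop he0).eventually_ge_atTop 2
  have hlog : ∀ᶠ D : ℝ in Filter.atTop, (q : ℝ) ^ 2 * Real.log D ≤ D := by
    have := Real.isLittleO_log_id_atTop.bound (c := 1 / (q : ℝ) ^ 2) (by positivity)
    filter_upwards [this, Filter.eventually_ge_atTop 1] with D h1 h2
    rw [Real.norm_eq_abs, Real.norm_eq_abs, abs_of_nonneg (Real.log_nonneg h2), id,
      abs_of_nonneg (by linarith), one_div_mul_eq_div, le_div_iff₀ (by positivity)] at h1
    linarith
  filter_upwards [hz2, hlog, Filter.eventually_ge_atTop 2] with D hz hlog hD2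
  set z := D ^ e with hzdef
  have hzD : z ≤ D := by
    calc z ≤ D ^ (1 : ℝ) := Real.rpow_le_rpow_of_exponent_le (by linarith) he1
      _ = D := Real.rpow_one D
  have hD0 : 0 < D := by linarith
  have hlD : 0 < Real.log D := Real.log_pos (by linarith)
  have hlz : Real.log z = e * Real.log D := Real.log_rpow hD0 e
  have hmert := (hM z hz).1
  rw [hlz, Real.sqrt_mul he0.le] at hmert
  set L := Real.sqrt (Real.log D) with hL
  have hL0 : 0 < L := Real.sqrt_pos.2 hlD
  have hse : 0 < Real.sqrt e := Real.sqrt_pos.2 he0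
  have hmert' : Real.exp (- recipSum ⌊z⌋₊) ≤ (C / Real.sqrt e) / L := by
    rwa [div_div]
  have hz8 : (z ^ sieveExp) ^ 8 = Real.sqrt D := by
    rw [← Real.rpow_natCast, ← Real.rpow_mul (by positivity), hzdef, ← Real.rpow_mul hD0.le,
      Real.sqrt_eq_rpow]
    congr 1
    rw [he]; push_cast; field_simp; norm_num
  have hsqrt : Real.sqrt D ≤ D / q / L := by
    rw [div_div, le_div_iff₀ (by positivity)]
    have h1 : (q : ℝ) * L ≤ Real.sqrt D := by
      apply Real.le_sqrt_of_sq_le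
      rw [mul_pow, hL, Real.sq_sqrt hlD.le]
      exact hlog
    calc Real.sqrt D * (q * L) ≤ Real.sqrt D * Real.sqrt D := by gcongr
      _ = D := Real.mul_self_sqrt hD0.le
  have hsub : primesThree ⌊z⌋₊ ⊆ primesThree ⌊D⌋₊ := by
    intro p hp
    rw [mem_primesThree] at hp ⊢
    exact ⟨hp.1.trans (Nat.floor_le_floor hzD), hp.2⟩
  have hρ := one_le_q3_div_totient q
  set ρ := (q3 q : ℝ) / (Nat.totient (q3 q) : ℝ) with hρdef
  constructor
  · intro B
    set S := (primesThree ⌊z⌋₊).filter (fun p => ¬ p ∣ q) with hS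
    have h1 := card_sifted_le S z hz (filter_subset _ _) q B (fun p hp => by
      rw [Nat.coprime_comm, Nat.Prime.coprime_iff_not_dvd
        (mem_primesThree.1 (mem_filter.1 hp).1).2.1]
      exact (mem_filter.1 hp).2) ⌊D / q⌋₊
    have h2 : ((Ioc 0 ⌊D / q⌋₊).filter (fun t => ∀ p ∈ primesThree ⌊D⌋₊, ¬ p ∣ q →
          ¬ p ∣ q * t + B)).card ≤ ((Ioc 0 ⌊D / q⌋₊).filter
          (fun n => ∀ p ∈ S, ¬ (p ∣ q * n + B ∧ ¬ p ^ 2 ∣ q * n + B))).card := by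
      refine card_le_card fun t ht => ?_
      rw [mem_filter] at ht ⊢
      -- Avoiding divisibility is stronger than avoiding exact divisibility, so the same sieve
      -- applies.
      exact ⟨ht.1, fun p hp h => ht.2 p (hsub (mem_filter.1 hp).1) (mem_filter.1 hp).2 h.1⟩
    have h3 : Real.exp (- ∑ p ∈ S, 1 / (p : ℝ)) ≤ ρ * ((C / Real.sqrt e) / L) :=
      (exp_neg_sum_le q ⌊z⌋₊ hq).trans (by gcongr)
    have h4 : (⌊D / q⌋₊ : ℝ) ≤ D / q := Nat.floor_le (by positivity)
    rw [hz8] at h1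
    calc _ ≤ _ := (Nat.cast_le.2 h2).trans h1
      _ ≤ Real.exp 60 * ((D / q) * (ρ * ((C / Real.sqrt e) / L)) + D / q / L * ρ) := by
          gcongr
          calc Real.sqrt D ≤ D / q / L * 1 := by rw [mul_one]; exact hsqrt
            _ ≤ _ := by gcongr
      _ = _ := by ring
  · intro B
    have h1 := card_sifted_le (primesThree ⌊z⌋₊) z hz subset_rfl 1 B (by simp) ⌊D⌋₊
    simp only [one_mul] at h1
    have h2 : ((Ioc 0 ⌊D⌋₊).filter (fun t => ∀ p ∈ primesThree ⌊D⌋₊,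
          ¬ (p ∣ t + B ∧ ¬ p ^ 2 ∣ t + B))).card ≤ ((Ioc 0 ⌊D⌋₊).filter
          (fun n => ∀ p ∈ primesThree ⌊z⌋₊, ¬ (p ∣ n + B ∧ ¬ p ^ 2 ∣ n + B))).card := by
      refine card_le_card fun t ht => ?_
      rw [mem_filter] at ht ⊢
      exact ⟨ht.1, fun p hp => ht.2 p (hsub hp)⟩
    have h4 : (⌊D⌋₊ : ℝ) ≤ D := Nat.floor_le (by positivity)
    have h5 : D / q / L ≤ D / L := by
      gcongr
      exact div_le_self hD0.le hq1
    rw [hz8] at h1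
    calc _ ≤ _ := (Nat.cast_le.2 h2).trans h1
      _ ≤ Real.exp 60 * (D * ((C / Real.sqrt e) / L) + D / L) := by
          gcongr
          · exact hmert'
          · exact hsqrt.trans h5
      _ = _ := by ring

/-! ### Positivity of the integral -/

/-- The integral factors into `K` equal one-variable integrals. The singularity `s^(-1/2)` is
integrable, and the integrand is positive on `(0, 1/K]`. Positivity lets the final constant be
divided by `LK K`. -/
theorem LK_pos {K : ℕ} (hK : 1 ≤ K) : 0 < LK K := by
  have hK0 : (0 : ℝ) < K := by exact_mod_cast hK
  set h : ℝ → ℝ := fun s => gFun (K * s) ^ 2 * (1 / Real.sqrt s) with hh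
  have e1 : LK K = (∫ s in Set.Icc (0 : ℝ) 1, h s) ^ K := by
    have e2 : ∀ t : Fin K → ℝ, FFun t ^ 2 * ∏ i, (1 / Real.sqrt (t i)) = ∏ i, h (t i) := by
      intro t
      rw [FFun, ← prod_pow, ← prod_mul_distrib]
    rw [LK]
    simp only [e2]
    rw [← Set.pi_univ_Icc, MeasureTheory.volume_pi, MeasureTheory.Measure.restrict_pi_pi]
    simp only [Pi.zero_apply, Pi.one_apply]
    rw [MeasureTheory.integral_fintype_prod_eq_pow, Fintype.card_fin]
  rw [e1]
  apply pow_pos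
  have hmeas : Measurable h := by
    have : Measurable gFun := by
      unfold gFun
      exact Measurable.ite measurableSet_Iic (by fun_prop) measurable_const
    exact ((this.comp (measurable_const.mul measurable_id)).pow_const 2).mul (by fun_prop)
  have h0 : ∀ s, 0 ≤ h s := fun s => by positivity
  have hint : MeasureTheory.IntegrableOn h (Set.Icc (0 : ℝ) 1) := by
    rw [integrableOn_Icc_iff_integrableOn_Ioc]
    have h1 : MeasureTheory.IntegrableOn (fun s : ℝ => s ^ (-(1 / 2) : ℝ)) (Set.Ioc (0 : ℝ) 1) := by
      rw [← intervalIntegrable_iff_integrableOn_Ioc_of_le zero_le_one]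
      exact intervalIntegral.intervalIntegrable_rpow' (by norm_num)
    refine MeasureTheory.Integrable.mono' h1 hmeas.aestronglyMeasurable ?_
    refine (MeasureTheory.ae_restrict_iff' measurableSet_Ioc).2 (.of_forall fun s hs => ?_)
    rw [Real.norm_of_nonneg (h0 s), hh, Real.rpow_neg hs.1.le, ← Real.sqrt_eq_rpow, ← one_div]
    refine mul_le_of_le_one_left (by positivity) ?_
    have hs0 : 0 ≤ K * s := mul_nonneg hK0.le hs.1.le
    have : 0 ≤ gFun (K * s) ∧ gFun (K * s) ≤ 1 := by
      unfold gFun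
      split_ifs
      · refine ⟨by positivity, ?_⟩
        rw [div_le_one (by positivity)]; linarith
      · norm_num
    exact pow_le_one₀ this.1 this.2
  rw [MeasureTheory.setIntegral_pos_iff_support_of_nonneg_ae (.of_forall h0) hint]
  have hsub : Set.Ioc 0 (1 / (K : ℝ)) ⊆ Function.support h ∩ Set.Icc 0 1 := by
    intro s hs
    have hs1 : K * s ≤ 1 := by
      have := hs.2
      rw [le_div_iff₀ hK0] at this; linarith
    have hs0 : 0 < s := hs.1
    refine ⟨?_, hs0.le, hs.2.trans ?_⟩
    · rw [Function.mem_support, hh]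
      simp only [gFun, if_pos hs1]
      positivity
    · rw [div_le_one hK0]; exact_mod_cast hK
  refine lt_of_lt_of_le ?_ (MeasureTheory.measure_mono hsub)
  rw [Real.volume_Ioc]
  simp [hK0]

/-! ### Assembling the triple sum -/

/-- For fixed `ν` the coprimality conditions are independent across entries. The first entry is
forced to be 3, and each of the other `K - 1` lies in a sifted interval. -/
theorem card_shiftTuples_coprime_le {K q N : ℕ} {η x : ℝ} (hK : 1 ≤ K) (hη : 0 ≤ η)
    (a : Fin K → ℕ) (ν : ℕ) {m : ℝ}
    (hm : ∀ B : ℕ, (((Ioc 0 ⌊D0 η x / q⌋₊).filter (fun t => ∀ p ∈ primesThree ⌊D0 η x⌋₊, ¬ p ∣ q →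
          ¬ p ∣ q * t + B)).card : ℝ) ≤ m) :
    (((shiftTuples K q N η x).filter
      (fun b => ∀ i, Nat.Coprime (form q a b i ν) (W q η x))).card : ℝ) ≤ m ^ (K - 1) := by
  obtain ⟨n, rfl⟩ : ∃ n, K = n + 1 := ⟨K - 1, by omega⟩
  set c : Fin (n + 1) → Finset ℕ := fun i => (Ioc 0 ⌊D0 η x / q⌋₊).filter
    (fun t => ∀ p ∈ primesThree ⌊D0 η x⌋₊, ¬ p ∣ q → ¬ p ∣ q * t + (q * ν + a i)) with hc
  have hsub : (shiftTuples (n + 1) q N η x).filter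
      (fun b => ∀ i, Nat.Coprime (form q a b i ν) (W q η x)) ⊆
      Fintype.piFinset (fun i : Fin (n + 1) => if (i : ℕ) = 0 then {3} else c i) := by
    intro b hb
    rw [mem_filter, shiftTuples, mem_filter] at hb
    rw [Fintype.mem_piFinset]
    intro i
    obtain ⟨h4, h0, h1, h2⟩ := hb.1.2 i
    split_ifs with hi
    · exact mem_singleton.2 (h0 hi)
    · rw [hc, mem_filter, mem_Ioc]
      refine ⟨⟨by omega, ?_⟩, ?_⟩
      · apply Nat.le_floor
        have e : D0 η x / q = η / q * Real.sqrt (Real.log x) := by rw [D0]; ring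
        rw [e]
        rcases lt_or_ge (i : ℕ) N with hlt | hge
        · refine (h1 hi hlt).2.trans ?_
          have : η / (2 * q) ≤ η / q := by
            rw [mul_comm, ← div_div]
            exact half_le_self (by positivity)
          gcongr
        · exact (h2 hge).2
      · intro p hp hpq hd
        rw [mem_primesThree] at hp
        have hpW : p ∣ W q η x := (dvd_W_iff hp.2.1 hp.2.2).2 ⟨hp.1, hpq⟩
        refine Nat.not_coprime_of_dvd_of_dvd hp.2.1.one_lt ?_ hpW (hb.2 i)
        rw [form]
        convert hd using 1
        ring
  calc _ ≤ ((Fintype.piFinset (fun i : Fin (n + 1) => if (i : ℕ) = 0 then {3} else c i)).card : ℝ) :=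
        Nat.cast_le.2 (card_le_card hsub)
    _ = ∏ i : Fin n, ((c i.succ).card : ℝ) := by
        rw [Fintype.card_piFinset, Nat.cast_prod, Fin.prod_univ_succ]
        simp
    _ ≤ ∏ i : Fin n, m := prod_le_prod (fun _ _ => by positivity) fun i _ => hm _
    _ = _ := by simp

/-- A prime dividing a square gcd divides its root, so its square divides the gcd and hence the
form. Thus no prime 3 mod 4 up to `D₀` divides the form exactly once. -/
theorem card_square_gcd_le {q : ℕ} {η x : ℝ} (hq : q ≠ 0) (hqD : q ≤ ⌊D0 η x⌋₊) (B : ℕ) (P : ℕ → Prop) :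
    ((Icc 1 ⌊D0 η x⌋₊).filter
      (fun c => P c ∧ IsSquare (Nat.gcd (B + c) (q3 q ^ 2 * W q η x ^ 2)))).card ≤
    ((Ioc 0 ⌊D0 η x⌋₊).filter (fun t => ∀ p ∈ primesThree ⌊D0 η x⌋₊,
          ¬ (p ∣ t + B ∧ ¬ p ^ 2 ∣ t + B))).card := by
  refine card_le_card fun c hc => ?_
  rw [mem_filter, mem_Icc] at hc
  rw [mem_filter, mem_Ioc]
  refine ⟨⟨by omega, hc.1.2⟩, fun p hp hdvd => ?_⟩
  rw [mem_primesThree] at hp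
  have hpQ : p ∣ q3 q * W q η x := (dvd_q3_mul_W_iff hq hqD hp.2.1 hp.2.2).2 hp.1
  have hp2 : p ∣ q3 q ^ 2 * W q η x ^ 2 := by
    rw [← mul_pow]; exact hpQ.trans (dvd_pow_self _ two_ne_zero)
  obtain ⟨s, hs⟩ := hc.2.2
  have h1 : p ∣ Nat.gcd (B + c) (q3 q ^ 2 * W q η x ^ 2) :=
    Nat.dvd_gcd (by rw [add_comm]; exact hdvd.1) hp2
  rw [hs, hp.2.1.dvd_mul, or_self] at h1
  apply hdvd.2
  rw [add_comm c B, pow_two]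
  exact (mul_dvd_mul h1 h1).trans (hs ▸ Nat.gcd_dvd_left _ _)

theorem exclusionSum_le {K q N : ℕ} {η θ₂ ξ x : ℝ} (hK : 1 ≤ K) (hη : 0 ≤ η)
    (hq : q ≠ 0) (hqD : q ≤ ⌊D0 η x⌋₊) (α₁ α₂ : ZMod q) {Ξ m m' : ℝ} (hΞ : 0 ≤ Ξ)
    (hS : ∀ b ∈ shiftTuples K q N η x, IsAdmissible (form q (offset q N α₁ α₂) b) →
      ∀ c ≤ ⌊D0 η x⌋₊, (∀ i, (fun n : ℕ => q * n + c) ≠ form q (offset q N α₁ α₂) b i) →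
      ∀ ν, S6 q (form q (offset q N α₁ α₂) b) η θ₂ ξ x c ν ≤ Ξ)
    (hm : ∀ B : ℕ, (((Ioc 0 ⌊D0 η x / q⌋₊).filter (fun t => ∀ p ∈ primesThree ⌊D0 η x⌋₊, ¬ p ∣ q →
          ¬ p ∣ q * t + B)).card : ℝ) ≤ m)
    (hm' : ∀ B : ℕ, (((Ioc 0 ⌊D0 η x⌋₊).filter (fun t => ∀ p ∈ primesThree ⌊D0 η x⌋₊,
          ¬ (p ∣ t + B ∧ ¬ p ^ 2 ∣ t + B))).card : ℝ) ≤ m') (r : ℕ) :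
    exclusionSum K q N α₁ α₂ η θ₂ ξ x
        ((range (q3 q ^ 2 * W q η x ^ 2)).filter (fun ν => ν ≡ r [MOD q3 q ^ 2])) ≤
      (W q η x : ℝ) ^ 2 * ((q3 q : ℝ) / (Nat.totient (q3 q) : ℝ) * Real.exp (- recipSum ⌊D0 η x⌋₊)) *
        m ^ (K - 1) * (m' * Ξ) := by
  set a := offset (K := K) q N α₁ α₂ with ha
  set w := W q η x with hw
  set T := (range (q3 q ^ 2 * w ^ 2)).filter (fun ν => ν ≡ r [MOD q3 q ^ 2]) with hT
  have hm0 : 0 ≤ m := (Nat.cast_nonneg _).trans (hm 0)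
  have hm0' : 0 ≤ m' := (Nat.cast_nonneg _).trans (hm' 0)
  set i₀ : Fin K := ⟨0, hK⟩ with hi₀
  have hstep : ∀ b ∈ shiftTuples K q N η x, IsAdmissible (form q a b) → ∀ ν,
      ∑ c ∈ (Icc 1 ⌊D0 η x⌋₊).filter (fun c => (∀ i, (fun n : ℕ => q * n + c) ≠ form q a b i) ∧
        IsSquare (Nat.gcd (q * ν + c) (q3 q ^ 2 * w ^ 2))), S6 q (form q a b) η θ₂ ξ x c ν ≤
      m' * Ξ := by
    intro b hb hadm ν
    calc _ ≤ ∑ c ∈ (Icc 1 ⌊D0 η x⌋₊).filter (fun c => (∀ i, (fun n : ℕ => q * n + c) ≠ form q a b i) ∧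
        IsSquare (Nat.gcd (q * ν + c) (q3 q ^ 2 * w ^ 2))), Ξ := by
          refine sum_le_sum fun c hc => ?_
          rw [mem_filter, mem_Icc] at hc
          exact hS b hb hadm c hc.1.2 hc.2.1 ν
      _ ≤ m' * Ξ := by
          rw [sum_const, nsmul_eq_mul]
          gcongr
          refine le_trans (Nat.cast_le.2 ?_) (hm' (q * ν))
          convert card_square_gcd_le hq hqD (q * ν)
            (fun c => ∀ i, (fun n : ℕ => q * n + c) ≠ form q a b i)
  calc exclusionSum K q N α₁ α₂ η θ₂ ξ x T
      ≤ ∑ b ∈ (shiftTuples K q N η x).filter (fun b => IsAdmissible (form q a b)),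
        ∑ ν ∈ T.filter (fun ν => ∀ i, Nat.Coprime (form q a b i ν) w), m' * Ξ := by
        refine sum_le_sum fun b hb => sum_le_sum fun ν _ => ?_
        rw [mem_filter] at hb
        exact hstep b hb.1 hb.2 ν
    _ ≤ ∑ b ∈ shiftTuples K q N η x,
        ∑ ν ∈ T.filter (fun ν => ∀ i, Nat.Coprime (form q a b i ν) w), m' * Ξ :=
        sum_le_sum_of_subset_of_nonneg (filter_subset _ _) fun _ _ _ =>
          sum_nonneg fun _ _ => by positivity
    -- Since `b_1 = 3`, the first form is the same for every tuple. Its coprimality to `W` is a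
    -- condition on `ν` alone, and the sums over `b` and `ν` can be interchanged while keeping the
    -- saving in each.
    _ ≤ ∑ b ∈ shiftTuples K q N η x,
        ∑ ν ∈ T.filter (fun ν => Nat.Coprime (q * ν + (a i₀ + q * 3)) w),
          if ∀ i, Nat.Coprime (form q a b i ν) w then m' * Ξ else 0 := by
        refine sum_le_sum fun b hb => ?_
        rw [← sum_filter]
        refine sum_le_sum_of_subset_of_nonneg ?_ fun _ _ _ => by positivity
        intro ν hν
        rw [mem_filter] at hν
        rw [mem_filter, mem_filter]
        refine ⟨⟨hν.1, ?_⟩, hν.2⟩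
        have h := hν.2 i₀
        rw [shiftTuples, mem_filter] at hb
        rwa [form, (hb.2 i₀).2.1 rfl, add_assoc] at h
    _ = ∑ ν ∈ T.filter (fun ν => Nat.Coprime (q * ν + (a i₀ + q * 3)) w),
        (((shiftTuples K q N η x).filter
          (fun b => ∀ i, Nat.Coprime (form q a b i ν) w)).card : ℝ) * (m' * Ξ) := by
        rw [sum_comm]
        refine sum_congr rfl fun ν _ => ?_
        rw [← sum_filter, sum_const, nsmul_eq_mul]
    _ ≤ ∑ ν ∈ T.filter (fun ν => Nat.Coprime (q * ν + (a i₀ + q * 3)) w),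
        m ^ (K - 1) * (m' * Ξ) := by
        refine sum_le_sum fun ν _ => ?_
        gcongr
        exact card_shiftTuples_coprime_le hK hη a ν hm
    _ ≤ _ := by
        rw [sum_const, nsmul_eq_mul, hT, filter_filter, ← mul_assoc]
        gcongr
        exact card_residues_le hq η x _ r

theorem exclusionSum_range_eq (K q N : ℕ) (α₁ α₂ : ZMod q) (η θ₂ ξ x : ℝ) :
    exclusionSum K q N α₁ α₂ η θ₂ ξ x (range (q3 q ^ 2 * W q η x ^ 2)) =
      ∑ r ∈ range (q3 q ^ 2), exclusionSum K q N α₁ α₂ η θ₂ ξ x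
        ((range (q3 q ^ 2 * W q η x ^ 2)).filter (fun ν => ν ≡ r [MOD q3 q ^ 2])) := by
  simp only [exclusionSum]
  rw [sum_comm]
  refine sum_congr rfl fun b _ => ?_
  have hq3 := pow_pos (q3_pos q) 2
  rw [← sum_fiberwise_of_maps_to (g := fun ν => ν % q3 q ^ 2) (t := range (q3 q ^ 2))
    fun ν _ => mem_range.2 (Nat.mod_lt _ hq3)]
  refine sum_congr rfl fun r hr => sum_congr ?_ fun _ _ => rfl
  ext ν
  simp only [mem_filter, mem_range, Nat.ModEq, Nat.mod_eq_of_lt (mem_range.1 hr)]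
  tauto

/-! ### Choice of parameters and conclusion -/

theorem recipSum_mono {m n : ℕ} (h : m ≤ n) : recipSum m ≤ recipSum n := by
  refine sum_le_sum_of_subset_of_nonneg ?_ fun _ _ _ => by positivity
  intro p hp
  rw [mem_primesThree] at hp ⊢
  exact ⟨hp.1.trans h, hp.2⟩

theorem W_le_four_pow (q : ℕ) (η x : ℝ) : W q η x ≤ 4 ^ ⌊D0 η x⌋₊ := by
  refine le_trans ?_ (primorial_le_four_pow ⌊D0 η x⌋₊)
  rw [W, primorial]
  refine Nat.le_of_dvd (prod_pos fun p hp => (mem_filter.1 hp).2.pos) (prod_dvd_prod_of_subset _ _ _ ?_)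
  intro p hp
  rw [mem_filter] at hp ⊢
  exact ⟨hp.1, hp.2.1⟩

theorem tendsto_sqrt_log : Filter.Tendsto (fun x => Real.sqrt (Real.log x)) Filter.atTop Filter.atTop :=
  Real.tendsto_sqrt_atTop.comp Real.tendsto_log_atTop

theorem tendsto_D0 {η : ℝ} (hη : 0 < η) : Filter.Tendsto (D0 η) Filter.atTop Filter.atTop :=
  tendsto_sqrt_log.const_mul_atTop hη

theorem eventually_D0_le_rpow {η e : ℝ} (hη : 0 < η) (he : 0 < e) :
    ∀ᶠ x : ℝ in Filter.atTop, D0 η x ≤ x ^ e := by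
  have h := (isLittleO_log_rpow_atTop (r := 2 * e) (by positivity)).bound
    (c := 1 / η ^ 2) (by positivity)
  filter_upwards [h, Filter.eventually_ge_atTop 1] with x hx h1
  have hx0 : 0 < x := by linarith
  rw [Real.norm_of_nonneg (Real.log_nonneg h1), Real.norm_of_nonneg (by positivity),
    one_div_mul_eq_div, le_div_iff₀ (by positivity)] at hx
  refine (sq_le_sq₀ (mul_nonneg hη.le (Real.sqrt_nonneg _)) (by positivity)).1 ?_
  rw [mul_pow, Real.sq_sqrt (Real.log_nonneg h1), ← Real.rpow_natCast (x ^ e), ← Real.rpow_mul hx0.le]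
  push_cast
  rw [mul_comm e 2]
  linarith

/-- `log W = O(D₀) = O(√(log x))`, so the modulus is smaller than any fixed power of `x`. The
exponent 5/9 complements the 4/9 allowed for the sieve error. -/
theorem eventually_modulus_le {q : ℕ} {η : ℝ} (hη : 0 < η) :
    ∀ᶠ x : ℝ in Filter.atTop, (q3 q : ℝ) ^ 2 * (W q η x : ℝ) ^ 2 ≤ x ^ (5 / 9 : ℝ) := by
  have hq3 : (1 : ℝ) ≤ q3 q := by exact_mod_cast q3_pos q
  filter_upwards [tendsto_sqrt_log.eventually_ge_atTop
    (9 / 5 * (2 * η * Real.log 4 + 2 * Real.log (q3 q)) + 1), Filter.eventually_ge_atTop 1]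
    with x hx h1
  set s := Real.sqrt (Real.log x) with hs
  have hl4 : 0 ≤ Real.log 4 := Real.log_nonneg (by norm_num)
  have hlq : 0 ≤ Real.log (q3 q) := Real.log_nonneg hq3
  have hs1 : 1 ≤ s := by
    have : 0 ≤ 9 / 5 * (2 * η * Real.log 4 + 2 * Real.log (q3 q)) := by positivity
    linarith
  have hss : s ^ 2 = Real.log x := Real.sq_sqrt (Real.log_nonneg h1)
  have hD : D0 η x = η * s := rfl
  have hW : (W q η x : ℝ) ≤ Real.exp (η * s * Real.log 4) := by
    calc (W q η x : ℝ) ≤ ((4 ^ ⌊D0 η x⌋₊ : ℕ) : ℝ) := Nat.cast_le.2 (W_le_four_pow q η x)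
      _ = Real.exp (⌊D0 η x⌋₊ * Real.log 4) := by
          rw [mul_comm, Real.exp_mul, Real.exp_log (by norm_num)]; norm_num
      _ ≤ _ := by
          apply Real.exp_le_exp.2
          gcongr
          exact Nat.floor_le (by rw [hD]; positivity)
  have hq' : (q3 q : ℝ) = Real.exp (Real.log (q3 q)) := (Real.exp_log (by linarith)).symm
  calc (q3 q : ℝ) ^ 2 * (W q η x : ℝ) ^ 2
      ≤ Real.exp (Real.log (q3 q)) ^ 2 * Real.exp (η * s * Real.log 4) ^ 2 := by
        rw [← hq']; gcongr
    _ = Real.exp (2 * Real.log (q3 q) + 2 * η * s * Real.log 4) := by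
        rw [← Real.exp_nat_mul, ← Real.exp_nat_mul, ← Real.exp_add]; congr 1; push_cast; ring
    _ ≤ Real.exp (Real.log x * (5 / 9)) := by
        apply Real.exp_le_exp.2
        rw [← hss]
        have e1 : 2 * Real.log (q3 q) + 2 * η * s * Real.log 4 ≤
            (2 * η * Real.log 4 + 2 * Real.log (q3 q)) * s := by nlinarith
        nlinarith
    _ = _ := by rw [Real.rpow_def_of_pos (by linarith)]

/-- Bookkeeping of the counts and Mertens factors, with `s = √(log x)`, `t = √(log D₀)`, `u = √ξ`,
`v = √θ₂`, `a = √sieveExp`; `Y` is the Mertens factor from counting `ν` and `X` the one from `S6`.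
-/
theorem main_term_le {K : ℕ} (hK : 1 ≤ K) {E C₁ C₂ a u v θ ρ η q₃ q s t x w D Y X : ℝ} (hE : 0 ≤ E)
    (hC₁ : 0 < C₁) (ha : 0 < a) (hu : 0 < u) (hv : 0 < v) (hθ : 0 < θ) (hρ : 1 ≤ ρ)
    (hη : 0 < η) (hq₃ : 0 < q₃) (hq : 0 < q) (hs : 0 < s) (ht : 0 < t) (hx : 0 < x) (hw : 0 < w)
    (hD : D = η * s)
    (hX : Y * X ≤ (C₂ * (v * s)) ^ K * (C₂ / t) ^ K * (C₂ / (u * θ / a * s))) :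
    w ^ 2 * (ρ * Y) * (C₁ * (D / q) * ρ / t) ^ (K - 1) *
      (C₁ * D / t * (E * (2 * (x / (q₃ ^ 2 * w ^ 2) * X)))) ≤
    2 * E * C₁ ^ K * C₂ ^ (2 * K + 1) * a *
      (1 / u * (v ^ K / θ) * ρ ^ K * (η ^ K / (q₃ ^ 2 * q ^ (K - 1))) *
        (s ^ (2 * K) / s / t ^ (2 * K)) * x) := by
  have hρ0 : 0 < ρ := by linarith
  have hD0 : 0 < D := by rw [hD]; positivity
  calc _ = 2 * E * (C₁ * (D / q) * ρ / t) ^ (K - 1) * (C₁ * D / t) * ρ * x / q₃ ^ 2 * (Y * X) := by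
        generalize (C₁ * (D / q) * ρ / t) ^ (K - 1) = m
        field_simp
    _ ≤ 2 * E * (C₁ * (D / q) * ρ / t) ^ (K - 1) * (C₁ * D / t) * ρ * x / q₃ ^ 2 *
        ((C₂ * (v * s)) ^ K * (C₂ / t) ^ K * (C₂ / (u * θ / a * s))) := by
        gcongr
    _ = _ := by
        obtain ⟨n, rfl⟩ : ∃ n, K = n + 1 := ⟨K - 1, by omega⟩
        rw [hD, Nat.add_sub_cancel]
        simp only [mul_pow, div_pow]
        field_simp
        ring

/-- The bound for the sum over one class modulo `q₃²`, in terms of `√(log x)`. -/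
theorem exists_exclusionSum_le (K : ℕ) (hK : 1 ≤ K) :
    ∃ C : ℝ, 0 < C ∧ ∀ (N q : ℕ), Odd q → ∀ (α₁ α₂ : ZMod q) (η θ₂ ξ : ℝ), 0 < η → 0 < θ₂ →
      θ₂ < 1 / 18 → 0 < ξ → ξ < 1 / 4 → ∀ᶠ x : ℝ in Filter.atTop, ∀ r : ℕ,
        exclusionSum K q N α₁ α₂ η θ₂ ξ x
          ((range (q3 q ^ 2 * W q η x ^ 2)).filter (fun ν => ν ≡ r [MOD q3 q ^ 2])) ≤
        C * (ξ ^ (-(1 / 2) : ℝ) * θ₂ ^ ((K : ℝ) / 2 - 1) *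
          ((q3 q : ℝ) / (Nat.totient (q3 q) : ℝ)) ^ K *
          (η ^ K / ((q3 q : ℝ) ^ 2 * (q : ℝ) ^ (K - 1))) *
          (Real.log x ^ ((K : ℝ) - 1 / 2) / Real.log (D0 η x) ^ K) * x) := by
  obtain ⟨C₁, hC₁, hcard⟩ := exists_card_sifted_interval_le
  obtain ⟨C₂, hC₂, hM⟩ := exists_exp_neg_recipSum_le
  have hA := one_le_sieveExp
  set A := sieveExp
  set E := Real.exp (60 * ((K : ℝ) + 1) ^ 2 + K) with hE
  refine ⟨2 * E * C₁ ^ K * C₂ ^ (2 * K + 1) * Real.sqrt A, by positivity, ?_⟩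
  intro N q hq α₁ α₂ η θ₂ ξ hη hθ hθ' hξ hξ'
  have hq0 : q ≠ 0 := by rintro rfl; simp at hq
  -- For `z = x^e`, `√(log z)` is `√ξ θ₂ √(log x)` up to a constant. The square on `θ₂` produces the
  -- `-1` in the exponent `K/2 - 1`, and division by `A` makes `z^A = x^(ξ θ₂²)`.
  set e := ξ * θ₂ ^ 2 / A with he
  have he0 : 0 < e := by positivity
  have hθ2 : θ₂ ^ 2 ≤ θ₂ / 18 := by nlinarith
  have heA : e * A = ξ * θ₂ ^ 2 := by rw [he]; field_simp
  have heξ : e ≤ ξ * θ₂ ^ 2 := div_le_self (by positivity) hA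
  have heR : e ≤ θ₂ / 2 := by nlinarith
  have heξ' : e < ξ := by nlinarith
  -- The sieve error is `(R z^A)^8`; here `4 θ₂ < 2/9` and `8 ξ θ₂²` is tiny.
  have hexp : (θ₂ / 2 + ξ * θ₂ ^ 2) * ((8 : ℕ) : ℝ) ≤ 4 / 9 := by
    push_cast
    nlinarith
  filter_upwards [(tendsto_D0 hη).eventually (hcard q hq0),
    (tendsto_D0 hη).eventually_gt_atTop (11 * (q : ℝ)), (tendsto_D0 hη).eventually_ge_atTop 2,
    eventually_D0_le_rpow hη he0, eventually_modulus_le (q := q) hη,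
    Filter.eventually_gt_atTop 1] with x hx hqD hD2 hDz hmod hx1 r
  set D := D0 η x with hD
  have hx0 : 0 < x := by linarith
  have hL0 : 0 < Real.log x := Real.log_pos hx1
  set s := Real.sqrt (Real.log x) with hs
  have hs0 : 0 < s := Real.sqrt_pos.2 hL0
  have hLD : 0 < Real.log D := Real.log_pos (by linarith)
  set t := Real.sqrt (Real.log D) with ht
  have ht0 : 0 < t := Real.sqrt_pos.2 hLD
  set z := x ^ e with hz
  set R := level θ₂ x with hR
  have hRdef : R = x ^ (θ₂ / 2) := rfl
  have hzR : z ≤ R := Real.rpow_le_rpow_of_exponent_le hx1.le heR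
  have hzξ : z < x ^ ξ := Real.rpow_lt_rpow_of_exponent_lt hx1 heξ'
  have hqD' : q ≤ ⌊D⌋₊ := by
    apply Nat.le_floor
    have : (0 : ℝ) ≤ q := by positivity
    linarith
  have hw0 : (0 : ℝ) < (q3 q : ℝ) ^ 2 * (W q η x : ℝ) ^ 2 := by
    have h1 : (0 : ℝ) < q3 q := by exact_mod_cast q3_pos q
    have h2 : (0 : ℝ) < W q η x := by exact_mod_cast W_pos q η x
    positivity
  set X := Real.exp (K * (recipSum ⌊R⌋₊ - recipSum ⌊D⌋₊) - (recipSum ⌊z⌋₊ - recipSum ⌊D⌋₊)) with hX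
  -- As `D₀, z ≤ R` and `K ≥ 1`, the exponent is nonnegative, so the sieve error is at most the main
  -- term; this is the factor 2 in `Ξ` below.
  have hX1 : 1 ≤ X := by
    apply Real.one_le_exp
    have h1 := recipSum_mono (Nat.floor_le_floor hzR)
    have h2 := recipSum_mono (Nat.floor_le_floor (hDz.trans hzR))
    have h3 : (1 : ℝ) ≤ K := by exact_mod_cast hK
    have h4 := le_mul_of_one_le_left (sub_nonneg.2 h2) h3
    linarith
  have herr : (R * z ^ A) ^ 8 ≤ x / ((q3 q : ℝ) ^ 2 * (W q η x : ℝ) ^ 2) * X := by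
    have h1 : (R * z ^ A) ^ 8 ≤ x ^ (4 / 9 : ℝ) := by
      rw [hRdef, hz, ← Real.rpow_mul hx0.le, ← Real.rpow_add hx0, ← Real.rpow_natCast,
        ← Real.rpow_mul hx0.le, heA]
      exact Real.rpow_le_rpow_of_exponent_le hx1.le hexp
    have h2 : x ^ (4 / 9 : ℝ) * x ^ (5 / 9 : ℝ) = x := by
      rw [← Real.rpow_add hx0]; norm_num
    calc _ ≤ x ^ (4 / 9 : ℝ) := h1
      _ ≤ x / ((q3 q : ℝ) ^ 2 * (W q η x : ℝ) ^ 2) := by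
          rw [le_div_iff₀ hw0]
          calc _ ≤ x ^ (4 / 9 : ℝ) * x ^ (5 / 9 : ℝ) := by gcongr
            _ = x := h2
      _ ≤ _ := le_mul_of_one_le_right (by positivity) hX1
  have hmain := exclusionSum_le (N := N) (θ₂ := θ₂) (ξ := ξ) hK hη.le hq0 hqD' α₁ α₂
    (Ξ := E * (2 * (x / ((q3 q : ℝ) ^ 2 * (W q η x : ℝ) ^ 2) * X))) (by positivity)
    (fun b hb hadm c hcD hc ν => (S6_le hq α₁ α₂ hx1.le hqD hDz hzR hzξ hb hadm hcD hc ν).trans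
      (by gcongr; linarith)) hx.1 hx.2 r
  refine hmain.trans ?_
  set ρ := (q3 q : ℝ) / (Nat.totient (q3 q) : ℝ) with hρ
  have hρ1 : 1 ≤ ρ := one_le_q3_div_totient q
  have hz2 : 2 ≤ z := hD2.trans hDz
  have hRl : Real.sqrt (Real.log R) ≤ Real.sqrt θ₂ * s := by
    rw [hRdef, Real.log_rpow hx0, hs, ← Real.sqrt_mul hθ.le]
    exact Real.sqrt_le_sqrt (mul_le_mul_of_nonneg_right (by linarith) hL0.le)
  have hzl : Real.sqrt (Real.log z) = Real.sqrt ξ * θ₂ / Real.sqrt A * s := by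
    rw [hz, Real.log_rpow hx0, Real.sqrt_mul he0.le, he, Real.sqrt_div (by positivity),
      Real.sqrt_mul hξ.le, Real.sqrt_sq hθ.le]
  have hbR := (hM R (hz2.trans hzR)).2
  have hbD := (hM D hD2).1
  have hbz := (hM z hz2).1
  rw [hzl] at hbz
  have hXe : Real.exp (- recipSum ⌊D⌋₊) * X =
      Real.exp (recipSum ⌊R⌋₊) ^ K * Real.exp (- recipSum ⌊D⌋₊) ^ K * Real.exp (- recipSum ⌊z⌋₊) := by
    rw [hX, ← Real.exp_add, ← Real.exp_nat_mul, ← Real.exp_nat_mul, ← Real.exp_add, ← Real.exp_add]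
    congr 1; ring
  have hXb : Real.exp (- recipSum ⌊D⌋₊) * X ≤ (C₂ * (Real.sqrt θ₂ * s)) ^ K * (C₂ / t) ^ K *
      (C₂ / (Real.sqrt ξ * θ₂ / Real.sqrt A * s)) := by
    rw [hXe]
    gcongr
    exact hbR.trans (by gcongr)
  have hw' : (0 : ℝ) < W q η x := by exact_mod_cast W_pos q η x
  have hq3' : (0 : ℝ) < q3 q := by exact_mod_cast q3_pos q
  have hq' : (0 : ℝ) < q := by exact_mod_cast Nat.pos_of_ne_zero hq0
  have hξe : ξ ^ (-(1 / 2) : ℝ) = 1 / Real.sqrt ξ := by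
    rw [Real.rpow_neg hξ.le, ← Real.sqrt_eq_rpow, one_div]
  have hθe : θ₂ ^ ((K : ℝ) / 2 - 1) = Real.sqrt θ₂ ^ K / θ₂ := by
    rw [Real.rpow_sub hθ, Real.rpow_one, Real.sqrt_eq_rpow, ← Real.rpow_natCast,
      ← Real.rpow_mul hθ.le]
    congr 2; ring
  have hLe : Real.log x ^ ((K : ℝ) - 1 / 2) = s ^ (2 * K) / s := by
    rw [Real.rpow_sub hL0, Real.rpow_natCast, ← Real.sqrt_eq_rpow, pow_mul, hs,
      Real.sq_sqrt hL0.le]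
  have hDe : Real.log D ^ K = t ^ (2 * K) := by
    rw [pow_mul, ht, Real.sq_sqrt hLD.le]
  have hDs : D = η * s := rfl
  rw [hξe, hθe, hLe, hDe]
  have hsξ : 0 < Real.sqrt ξ := Real.sqrt_pos.2 hξ
  have hsθ : 0 < Real.sqrt θ₂ := Real.sqrt_pos.2 hθ
  have hsA : 0 < Real.sqrt A := Real.sqrt_pos.2 (by linarith)
  exact main_term_le hK (by positivity) hC₁ hsA hsξ hsθ hθ hρ1 hη hq3' hq' hs0 ht0 hx0 hw' hDs hXb

end TwoSquareSieve

theorem mainTheorem3 (K : ℕ) (hK : 1 ≤ K) :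
    ∃ C : ℝ, 0 < C ∧
      ∀ (k M M₁ q : ℕ), K = k * M → 1 ≤ M₁ → M₁ ≤ M → Odd q → Squarefree q →
      ∀ (α₁ α₂ : ZMod q), IsUnit α₁ → IsUnit α₂ →
      ∀ (η θ₂ ξ : ℝ), 0 < η → 0 < θ₂ → θ₂ < 1 / 18 → 0 < ξ → ξ < 1 / 4 →
      ∀ᶠ x : ℝ in Filter.atTop,
        TwoSquareSieve.exclusionSum K q (M₁ * k) α₁ α₂ η θ₂ ξ x
            (Finset.range (TwoSquareSieve.q3 q ^ 2 * TwoSquareSieve.W q η x ^ 2)) ≤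
          C * (ξ ^ (-(1 / 2) : ℝ) * θ₂ ^ ((K : ℝ) / 2 - 1) * TwoSquareSieve.LK K *
            ((TwoSquareSieve.q3 q : ℝ) / (Nat.totient (TwoSquareSieve.q3 q) : ℝ)) ^ K *
            (η ^ K / (q : ℝ) ^ (K - 1)) *
            (Real.log x ^ ((K : ℝ) - 1 / 2) / Real.log (TwoSquareSieve.D0 η x) ^ K) * x) ∧
        ∀ r : ℕ,
          TwoSquareSieve.exclusionSum K q (M₁ * k) α₁ α₂ η θ₂ ξ x
              ((Finset.range (TwoSquareSieve.q3 q ^ 2 * TwoSquareSieve.W q η x ^ 2)).filter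
                (fun ν => ν ≡ r [MOD TwoSquareSieve.q3 q ^ 2])) ≤
            C * (ξ ^ (-(1 / 2) : ℝ) * θ₂ ^ ((K : ℝ) / 2 - 1) * TwoSquareSieve.LK K *
              ((TwoSquareSieve.q3 q : ℝ) / (Nat.totient (TwoSquareSieve.q3 q) : ℝ)) ^ K *
              (η ^ K / ((TwoSquareSieve.q3 q : ℝ) ^ 2 * (q : ℝ) ^ (K - 1))) *
              (Real.log x ^ ((K : ℝ) - 1 / 2) / Real.log (TwoSquareSieve.D0 η x) ^ K) * x) := by
  have hLK := TwoSquareSieve.LK_pos hK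
  obtain ⟨C, hC, h⟩ := TwoSquareSieve.exists_exclusionSum_le K hK
  -- `LK K` depends on `K` only, so it can be put into the bound by dividing the constant by it.
  refine ⟨C / TwoSquareSieve.LK K, by positivity, ?_⟩
  intro k M M₁ q _ _ _ hq _ α₁ α₂ _ _ η θ₂ ξ hη hθ hθ' hξ hξ'
  have hq3 : (0 : ℝ) < TwoSquareSieve.q3 q := by exact_mod_cast TwoSquareSieve.q3_pos q
  filter_upwards [h (M₁ * k) q hq α₁ α₂ η θ₂ ξ hη hθ hθ' hξ hξ'] with x hx
  constructor
  -- The bound for one class is uniform in `r`, so the `q₃²` classes cancel the `q₃²` in its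
  -- denominator.
  · rw [TwoSquareSieve.exclusionSum_range_eq]
    refine (Finset.sum_le_sum fun r _ => hx r).trans (le_of_eq ?_)
    rw [Finset.sum_const, Finset.card_range, nsmul_eq_mul]
    push_cast
    field_simp
  · intro r
    convert hx r using 1
    field_simp
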